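/- **Theorem 3 (Privacy, Method I).** Let $2p\le n$, $\beta\in\mathbb R^p$, $\sigma\ge 0$, and consider designs $X\in\mathbb R^{n\times p}$ with responses $y=X\beta+w$, $w\sim\mathcal N(0,\sigma^2I_n)$. Call $X$ *admissible* if $\Sigma=X^\top X$ is invertible and $B$ is an upper bound for the $\ell_2$-norms of the rows of $X$ and a lower bound for the $\ell_2$-norms of its columns. Let $X'$ be $X$ with its columns normalized to $\ell_2$-norm $1$, $\Sigma'=X'^\top X'$, and let $\widetilde{X'}$ be a knockoff copy of $X'$ with $\mathrm{diag}(s)=\lambda_{\min}(\Sigma')I_p$, i.e. $\widetilde{X'}=X'(I-\Sigma'^{-1}\mathrm{diag}(s))+\tilde UC$, where $\tilde U^\top\tilde U=I_p$, $\tilde U^\top X'=0$, and $C$ is upper triangular with nonnegative diagonal such that $C^\top C=\Sigma'-(\Sigma'-\mathrm{diag}(s))\Sigma'^{-1}(\Sigma'-\mathrm{diag}(s))$. Let $G'=[X'\ \widetilde{X'}]^\top[X'\ \widetilde{X'}]$. Two data sets $(X,y)$, $(\bar X,\bar y)$ are adjacent if they differ in at most one observation (a row of $X$ together with the corresponding entry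 of $y$). Let $0<\epsilon,\epsilon_2<1$, $\epsilon_1>0$, $0<\delta,\delta_1<1$, $\delta_2>2e^{-p/2}$. For the observed admissible design $X$, let $C_{\min}$ be the smallest $\ell_2$-norm of a column of $X$, assume $C_{\min}>B$, and put $\eta^2=B^2/(C_{\min}^2-B^2)$ with $\eta>0$, $\zeta=2p\sigma^2/\bigl(1-\sqrt{\tfrac2p\ln(2/\delta_2)}\bigr)$, $\gamma=2\lambda_{\max}(\Sigma')-\lambda_{\min}(\Sigma')$ and $$\Delta_2=\zeta^{1/2}\Bigl(2\sqrt\gamma+\eta\bigl(3+2\lambda_{\max}(\Sigma')+\lambda_{\min}(\Sigma')\bigr)^{1/2}\Bigr)+\|\beta\|_2\Bigl(\sqrt2\bigl(\tfrac\eta B-\tfrac1{C_{\min}}\bigr)\|\Sigma\|_F+2\eta B+\bigl(C_{\min}-\tfrac B\eta\bigr)\lambda_{\min}(\Sigma')+\eta^2(\lambda_{\min}(\Sigma')+1)\sqrt{C_{\min}^2+B^2}\Bigr).$$ Let $E=\theta_1\begin{bmatrix}0&I_p\\I_p&0\end{bmatrix}+\begin{bmatrix}1&1\\1&1\end{bmatrix}\otimes\theta_2$,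 where $\theta_1\sim\mathrm{Lap}\bigl(\eta^2(1+\lambda_{\min}(\Sigma'))/\epsilon_1\bigr)$, and $\theta_2$ is a symmetric $p\times p$ matrix with zero diagonal whose strictly upper triangular entries are i.i.d. $\mathcal N(0,\kappa_1^2)$ with $\kappa_1^2\ge\frac{2\ln(1.25/\delta)}{\epsilon_2^2}\eta^4(\sqrt2+\|\Sigma'\|_F)^2$. Let $e\in\mathbb R^{2p}$ have i.i.d. $\mathcal N(0,\kappa_2^2)$ entries with $\kappa_2^2>\frac{2\ln(1.25/\delta_1)}{\epsilon^2}\Delta_2^2$. The variables $\theta_1$, $\theta_2$, $e$ and the model errors are independent. Then, for every measurable $f$, releasing $f\bigl(G'+E,\,[X'\ \widetilde{X'}]^\top y+e\bigr)$ is $(\epsilon+\epsilon_1+\epsilon_2,\ \delta+\delta_1+\delta_2)$-differentially private in the local sense. That is, let $\bar X$ be an admissible design with a knockoff copy of its normalization as above, and let $y=X\beta+w$, $\bar y=\bar X\beta+\bar w$, where $w,\bar w\sim\mathcal N(0,\sigma^2I_n)$ are defined on one probability space and the data sets $(X,y)$ and $(\bar X,\bar y)$ are almost surely adjacent; let the noise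 $(E,e)$, calibrated to the observed data $X$ as above, be used for both data sets. Then: 1. $\bigl\|[X'\ \widetilde{X'}]^\top y-[\bar X'\ \widetilde{\bar X'}]^\top\bar y\bigr\|_2\le\Delta_2$ with probability at least $1-\delta_2$ over the model errors; 2. with probability at least $1-\delta_2$ over the model errors, the conditional laws $\mu,\nu$ of the two outputs, given the two data sets, satisfy $\mu(S)\le e^{\epsilon+\epsilon_1+\epsilon_2}\nu(S)+\delta+\delta_1$ and $\nu(S)\le e^{\epsilon+\epsilon_1+\epsilon_2}\mu(S)+\delta+\delta_1$ for all measurable $S$; 3. the unconditional laws $\mu,\nu$ of the two outputs (over the model errors and the noise) satisfy $\mu(S)\le e^{\epsilon+\epsilon_1+\epsilon_2}\nu(S)+\delta+\delta_1+\delta_2$ and $\nu(S)\le e^{\epsilon+\epsilon_1+\epsilon_2}\mu(S)+\delta+\delta_1+\delta_2$ for all measurable $S$. -/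

import Mathlib

open MeasureTheory ProbabilityTheory Matrix
open scoped ENNReal NNReal

noncomputable section

namespace PrivateKnockoff

/-- The entrywise (Borel) sigma-algebra on real matrices. -/
instance instMeasurableSpaceMatrix {m n : Type*} : MeasurableSpace (Matrix m n ℝ) :=
  inferInstanceAs (MeasurableSpace (m → n → ℝ))

/-! ### Norms and extreme eigenvalues -/

/-- Euclidean norm of a real vector. -/
def l2norm {ι : Type*} [Fintype ι] (v : ι → ℝ) : ℝ := Real.sqrt (∑ i, v i ^ 2)

/-- Frobenius norm of a real matrix. -/
def frobNorm {m n : Type*} [Fintype m] [Fintype n] (A : Matrix m n ℝ) : ℝ :=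
  Real.sqrt (∑ i, ∑ j, A i j ^ 2)

/-- Smallest eigenvalue (used for symmetric real matrices only). -/
def lamMin {p : ℕ} (A : Matrix (Fin p) (Fin p) ℝ) : ℝ := sInf (spectrum ℝ A)

/-- Largest eigenvalue (used for symmetric real matrices only). -/
def lamMax {p : ℕ} (A : Matrix (Fin p) (Fin p) ℝ) : ℝ := sSup (spectrum ℝ A)

/-! ### Design matrices and knockoffs -/

section Design

variable {n p : ℕ}

/-- Gram matrix `Xᵀ X`. -/
def gram (X : Matrix (Fin n) (Fin p) ℝ) : Matrix (Fin p) (Fin p) ℝ := Xᵀ * X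

/-- Euclidean norm of the `j`-th column. -/
def colNorm (X : Matrix (Fin n) (Fin p) ℝ) (j : Fin p) : ℝ := l2norm (fun i => X i j)

/-- The design with every column divided by its Euclidean norm. -/
def normalizeCols (X : Matrix (Fin n) (Fin p) ℝ) : Matrix (Fin n) (Fin p) ℝ :=
  Matrix.of fun i j => X i j / colNorm X j

/-- `Xt` is a knockoff copy of `X` with parameter vector `s`:
`Xt = X (I - Σ⁻¹ diag s) + U C`, where `Σ = XᵀX`, `U` has orthonormal columns that are orthogonal
to those of `X`, and `C` is a Cholesky factor (upper triangular, nonnegative diagonal) of the Schur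
complement `Σ - (Σ - diag s) Σ⁻¹ (Σ - diag s)` of the joint Gram matrix. -/
def IsKnockoff (X : Matrix (Fin n) (Fin p) ℝ) (s : Fin p → ℝ)
    (Xt : Matrix (Fin n) (Fin p) ℝ) : Prop :=
  ∃ (U : Matrix (Fin n) (Fin p) ℝ) (C : Matrix (Fin p) (Fin p) ℝ),
    Uᵀ * U = 1 ∧ Uᵀ * X = 0 ∧
    (∀ i j, j < i → C i j = 0) ∧ (∀ i, 0 ≤ C i i) ∧
    Cᵀ * C = gram X - (gram X - diagonal s) * (gram X)⁻¹ * (gram X - diagonal s) ∧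
    Xt = X * (1 - (gram X)⁻¹ * diagonal s) + U * C

/-- The standing assumptions on a design: `XᵀX` is invertible, and `B` is an upper bound for the
Euclidean norms of the rows and a lower bound for those of the columns. -/
def Admissible (B : ℝ) (X : Matrix (Fin n) (Fin p) ℝ) : Prop :=
  IsUnit (gram X) ∧ (∀ i, l2norm (X i) ≤ B) ∧ (∀ j, B ≤ colNorm X j)

/-- `Xt` is a knockoff copy of the normalized design `X'` of `X`, with
`diag s = λ_min(X'ᵀX') I`. -/
def IsNormalizedKnockoff (X Xt : Matrix (Fin n) (Fin p) ℝ) : Prop :=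
  IsKnockoff (normalizeCols X) (fun _ => lamMin (gram (normalizeCols X))) Xt

/-- The augmented normalized design `[X' X̃']`. -/
def augmented (X Xt : Matrix (Fin n) (Fin p) ℝ) : Matrix (Fin n) (Fin p ⊕ Fin p) ℝ :=
  fromCols (normalizeCols X) Xt

/-- The Gram matrix `G' = [X' X̃']ᵀ [X' X̃']`. -/
def augGram (X Xt : Matrix (Fin n) (Fin p) ℝ) : Matrix (Fin p ⊕ Fin p) (Fin p ⊕ Fin p) ℝ :=
  (augmented X Xt)ᵀ * augmented X Xt

/-- The feature-response product `[X' X̃']ᵀ y`. -/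
def featResp (X Xt : Matrix (Fin n) (Fin p) ℝ) (y : Fin n → ℝ) : Fin p ⊕ Fin p → ℝ :=
  (augmented X Xt)ᵀ *ᵥ y

/-- Two data sets (design, response) are adjacent if they differ in at most one observation. -/
def Adjacent (A A' : Matrix (Fin n) (Fin p) ℝ × (Fin n → ℝ)) : Prop :=
  ∃ i, ∀ j, j ≠ i → A.1 j = A'.1 j ∧ A.2 j = A'.2 j

/-! ### The data-dependent calibration of the noise -/

/-- Smallest column norm. -/
def cMin (X : Matrix (Fin n) (Fin p) ℝ) : ℝ := ⨅ j, colNorm X j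

/-- `η`, the square root of `B² / (C_min² - B²)`. -/
def eta (B : ℝ) (X : Matrix (Fin n) (Fin p) ℝ) : ℝ :=
  Real.sqrt (B ^ 2 / (cMin X ^ 2 - B ^ 2))

/-- `Σ'`, the Gram matrix of the normalized design. -/
def gramN (X : Matrix (Fin n) (Fin p) ℝ) : Matrix (Fin p) (Fin p) ℝ := gram (normalizeCols X)

/-- Scale of the Laplace noise: `η² (1 + λ_min(Σ')) / ε₁`. -/
def laplaceScale (B ε₁ : ℝ) (X : Matrix (Fin n) (Fin p) ℝ) : ℝ :=
  eta B X ^ 2 * (1 + lamMin (gramN X)) / ε₁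

/-- The lower bound `2 ln(1.25/δ) η⁴ (√2 + ‖Σ'‖_F)² / ε₂²` for `κ₁²`. -/
def kappaOneSqBound (B ε₂ δ : ℝ) (X : Matrix (Fin n) (Fin p) ℝ) : ℝ :=
  2 * Real.log (1.25 / δ) / ε₂ ^ 2 *
    (eta B X ^ 4 * (Real.sqrt 2 + frobNorm (gramN X)) ^ 2)

/-- `ζ = 2 p σ² / (1 - √((2/p) ln(2/δ₂)))`. -/
def zeta (p : ℕ) (σ δ₂ : ℝ) : ℝ :=
  2 * p * σ ^ 2 / (1 - Real.sqrt (2 / p * Real.log (2 / δ₂)))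

/-- `γ = 2 λ_max(Σ') - λ_min(Σ')`. -/
def gam (X : Matrix (Fin n) (Fin p) ℝ) : ℝ := 2 * lamMax (gramN X) - lamMin (gramN X)

/-- The sensitivity bound for the feature-response product. -/
def sensFeatResp (B σ δ₂ : ℝ) (β : Fin p → ℝ) (X : Matrix (Fin n) (Fin p) ℝ) : ℝ :=
  Real.sqrt (zeta p σ δ₂) *
      (2 * Real.sqrt (gam X) +
        eta B X * Real.sqrt (3 + 2 * lamMax (gramN X) + lamMin (gramN X))) +
    l2norm β *
      (Real.sqrt 2 * (eta B X / B - 1 / cMin X) * frobNorm (gram X) + 2 * eta B X * B +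
        (cMin X - B / eta B X) * lamMin (gramN X) +
        eta B X ^ 2 * (lamMin (gramN X) + 1) * Real.sqrt (cMin X ^ 2 + B ^ 2))

/-- The strict lower bound `2 ln(1.25/δ₁) Δ₂² / ε²` for `κ₂²`. -/
def kappaTwoSqBound (B σ ε δ₁ δ₂ : ℝ) (β : Fin p → ℝ) (X : Matrix (Fin n) (Fin p) ℝ) : ℝ :=
  2 * Real.log (1.25 / δ₁) / ε ^ 2 * sensFeatResp B σ δ₂ β X ^ 2

end Design

/-! ### The noise and the released statistic -/

/-- The law on `ι → ℝ` of a vector with i.i.d. `N(0, κ²)` entries. -/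
def iidGaussian (ι : Type*) [Fintype ι] (κ : ℝ≥0) : Measure (ι → ℝ) :=
  Measure.pi fun _ => gaussianReal 0 (κ ^ 2)

/-- The centred Laplace distribution with scale `b`. -/
def laplace (b : ℝ) : Measure ℝ :=
  volume.withDensity fun x => ENNReal.ofReal (1 / (2 * b) * Real.exp (-|x| / b))

/-- Index pairs of the strict upper triangle. -/
abbrev UpperPairs (p : ℕ) : Type := {q : Fin p × Fin p // q.1 < q.2}

/-- The symmetric matrix with zero diagonal and the given strict upper triangle. -/
def symmOfUpper {p : ℕ} (g : UpperPairs p → ℝ) : Matrix (Fin p) (Fin p) ℝ :=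
  Matrix.of fun i j =>
    if h : i < j then g ⟨(i, j), h⟩ else if h : j < i then g ⟨(j, i), h⟩ else 0

/-- `E = θ₁ [[O, I], [I, O]] + [[1, 1], [1, 1]] ⊗ θ₂`. -/
def gramNoise {p : ℕ} (θ₁ : ℝ) (θ₂ : Matrix (Fin p) (Fin p) ℝ) :
    Matrix (Fin p ⊕ Fin p) (Fin p ⊕ Fin p) ℝ :=
  θ₁ • fromBlocks 0 1 1 0 + fromBlocks θ₂ θ₂ θ₂ θ₂

/-- The joint law of the noise `(E, e)`: `θ₁` is Laplace with scale `b`, the strict upper triangle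
of `θ₂` is i.i.d. `N(0, κ₁²)`, `e` is i.i.d. `N(0, κ₂²)`, all independent. -/
def noiseLaw (p : ℕ) (b : ℝ) (κ₁ κ₂ : ℝ≥0) :
    Measure (Matrix (Fin p ⊕ Fin p) (Fin p ⊕ Fin p) ℝ × (Fin p ⊕ Fin p → ℝ)) :=
  ((laplace b).prod
      ((iidGaussian (UpperPairs p) κ₁).prod (iidGaussian (Fin p ⊕ Fin p) κ₂))).map
    fun t => (gramNoise t.1 (symmOfUpper t.2.1), t.2.2)

section Release

variable {n p : ℕ} {R : Type*}

/-- The released statistic `f(G' + E, [X' X̃']ᵀ y + e)` for a given value `(E, e)` of the noise. -/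
def statistic (f : Matrix (Fin p ⊕ Fin p) (Fin p ⊕ Fin p) ℝ → (Fin p ⊕ Fin p → ℝ) → R)
    (X Xt : Matrix (Fin n) (Fin p) ℝ) (y : Fin n → ℝ)
    (z : Matrix (Fin p ⊕ Fin p) (Fin p ⊕ Fin p) ℝ × (Fin p ⊕ Fin p → ℝ)) : R :=
  f (augGram X Xt + z.1) (featResp X Xt y + z.2)

variable [MeasurableSpace R]

/-- The law of the released statistic on the fixed data set `(X, y)`, when the noise `(E, e)` has
law `N`. -/
def release (f : Matrix (Fin p ⊕ Fin p) (Fin p ⊕ Fin p) ℝ → (Fin p ⊕ Fin p → ℝ) → R)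
    (N : Measure (Matrix (Fin p ⊕ Fin p) (Fin p ⊕ Fin p) ℝ × (Fin p ⊕ Fin p → ℝ)))
    (X Xt : Matrix (Fin n) (Fin p) ℝ) (y : Fin n → ℝ) : Measure R :=
  N.map (statistic f X Xt y)

/-- The law of the released statistic when the response `y` is random on the probability space
`(Ω, P)`, independent of the noise, and the noise has law `N`. -/
def releaseRandom {Ω : Type*} [MeasurableSpace Ω] (P : Measure Ω)
    (f : Matrix (Fin p ⊕ Fin p) (Fin p ⊕ Fin p) ℝ → (Fin p ⊕ Fin p → ℝ) → R)
    (N : Measure (Matrix (Fin p ⊕ Fin p) (Fin p ⊕ Fin p) ℝ × (Fin p ⊕ Fin p → ℝ)))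
    (X Xt : Matrix (Fin n) (Fin p) ℝ) (y : Ω → Fin n → ℝ) : Measure R :=
  (P.prod N).map fun t => statistic f X Xt (y t.1) t.2

/-- The two inequalities of `(ε, δ)`-differential privacy for the output laws of a mechanism on a
pair of neighbouring inputs. -/
def DPClose (ε δ : ℝ) (μ ν : Measure R) : Prop :=
  ∀ S : Set R, MeasurableSet S →
    μ S ≤ ENNReal.ofReal (Real.exp ε) * ν S + ENNReal.ofReal δ ∧
    ν S ≤ ENNReal.ofReal (Real.exp ε) * μ S + ENNReal.ofReal δ

end Release

end PrivateKnockoff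

end

noncomputable section

namespace PrivateKnockoff

/-! ### Approximate domination of measures -/

/-! Replacing the data set `(X, y)` by a neighbouring one acts on the release as a translation of
the noise. The knockoff equations give the joint Gram matrix the blocks `Σ'` on the diagonal and `Σ'
- λ_min(Σ') I` off it, so `G'` depends on the design only through `Σ'`. Normalized columns fix the
diagonal of `Σ'`, so the change of `G'` is a scalar shift of the off-diagonal blocks plus a
symmetric zero-diagonal matrix repeated in all four blocks. These are the directions of `θ₁` and
`θ₂` (`augGram_eq_add_gramNoise`). Both releases are therefore images under one map of the base
noise and of a translate of it (`dpClose_release`). It remains to bound the translation in each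
independent component and to compose the Laplace mechanism with two Gaussian mechanisms. Composition
is done with `ApproxDominated`, which adds both parameters under products and passes to images.

The shifts of `θ₁` and `θ₂` are deterministic. In the form `v ↦ ‖X' v‖²`, changing a row rescales
coordinates by the ratios of column norms, removes one square and adds another
(`l2norm_normalizeCols_mulVec_sq`). The squared ratios are within `η²` of `1` and each square is at
most `η² ‖v‖²`. This controls `λ_min`, `λ_max` and `‖Σ'‖_F`.

The shift of `e` has a random and a deterministic part. For the random part, the largest eigenvalue
of `G'` is at most `γ`, and a Chernoff bound keeps `‖[X' X̃']ᵀ w‖²` below `γ ζ` except with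
probability `δ₂ / 2`. The same holds for the neighbour, and a union bound gives `δ₂` whatever the
coupling of the two error vectors.

The deterministic part is the most delicate. The entry of the knockoff block for column `j` can
change by an amount growing with the norm `ℓ j` of that column, while the terms of the sensitivity
bound for that block involve only the smallest norm `C`. Two reserves pay for the growth: `(2 - √2)
η B`, because the rank-one change of `XᵀX` costs only `√2 η B`, and the Frobenius term, because the
change of `1 / ℓ j` decays like `ℓ j ^ (-3)` (`min_mul_sub_le_excess`, `excess_sq_mul_le`,
`l2norm_weighted_mulVec_add_le`).

Conditional privacy off an event of probability at most `δ₂` is finally averaged over the model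
errors. -/

/-- `μ` is dominated by `exp ε • ν` up to a part of mass at most `δ`. -/
def ApproxDominated {α : Type*} [MeasurableSpace α] (ε δ : ℝ) (μ ν : Measure α) : Prop :=
  ∃ a ρ : Measure α, μ = a + ρ ∧ a ≤ ENNReal.ofReal (Real.exp ε) • ν ∧
    ρ Set.univ ≤ ENNReal.ofReal δ

namespace ApproxDominated

variable {α α' : Type*} [MeasurableSpace α] [MeasurableSpace α'] {ε δ : ℝ} {μ ν : Measure α}

lemma measure_le (h : ApproxDominated ε δ μ ν) (S : Set α) :
    μ S ≤ ENNReal.ofReal (Real.exp ε) * ν S + ENNReal.ofReal δ := by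
  obtain ⟨a, ρ, rfl, ha, hρ⟩ := h
  rw [Measure.add_apply]
  exact add_le_add (by simpa using ha S) ((measure_mono (Set.subset_univ S)).trans hρ)

lemma of_le (h : μ ≤ ENNReal.ofReal (Real.exp ε) • ν) : ApproxDominated ε 0 μ ν :=
  ⟨μ, 0, by simp, h, by simp⟩

lemma map (h : ApproxDominated ε δ μ ν) {f : α → α'} (hf : Measurable f) :
    ApproxDominated ε δ (μ.map f) (ν.map f) := by
  obtain ⟨a, ρ, rfl, ha, hρ⟩ := h
  refine ⟨a.map f, ρ.map f, Measure.map_add _ _ hf, ?_, ?_⟩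
  · rw [← Measure.map_smul]
    exact Measure.map_mono ha hf
  · rwa [Measure.map_apply hf MeasurableSet.univ, Set.preimage_univ]

/-- Expand `μ × μ' = a × a' + a × ρ' + ρ × μ'`: the first term is dominated with factor `exp (ε +
ε')`, and the others have mass at most `δ'` and `δ`. An explicit decomposition makes this immediate,
which the setwise inequalities of differential privacy do not. -/
lemma prod {ε' δ' : ℝ} {μ' ν' : Measure α'} [IsProbabilityMeasure μ] [IsProbabilityMeasure ν]
    [IsProbabilityMeasure μ'] [IsProbabilityMeasure ν'] (hδ : 0 ≤ δ) (hδ' : 0 ≤ δ')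
    (h : ApproxDominated ε δ μ ν) (h' : ApproxDominated ε' δ' μ' ν') :
    ApproxDominated (ε + ε') (δ + δ') (μ.prod μ') (ν.prod ν') := by
  obtain ⟨a, ρ, hμ, ha, hρ⟩ := h
  obtain ⟨a', ρ', hμ', ha', hρ'⟩ := h'
  have hal : a ≤ μ := hμ ▸ Measure.le_add_right le_rfl
  have hρl : ρ ≤ μ := hμ ▸ Measure.le_add_left le_rfl
  have hal' : a' ≤ μ' := hμ' ▸ Measure.le_add_right le_rfl
  have hρl' : ρ' ≤ μ' := hμ' ▸ Measure.le_add_left le_rfl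
  have : IsFiniteMeasure a := isFiniteMeasure_of_le μ hal
  have : IsFiniteMeasure ρ := isFiniteMeasure_of_le μ hρl
  have : IsFiniteMeasure a' := isFiniteMeasure_of_le μ' hal'
  have : IsFiniteMeasure ρ' := isFiniteMeasure_of_le μ' hρl'
  refine ⟨a.prod a', a.prod ρ' + ρ.prod μ', ?_, ?_, ?_⟩
  · conv_lhs => rw [hμ, Measure.add_prod, hμ', Measure.prod_add]
    rw [add_assoc, hμ']
  · refine (Measure.prod_mono ha ha').trans (le_of_eq ?_)
    rw [Measure.prod_smul_left, Measure.prod_smul_right, smul_smul, Real.exp_add,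
      ENNReal.ofReal_mul (Real.exp_pos _).le]
  · rw [Measure.add_apply, ← Set.univ_prod_univ, Measure.prod_prod, Measure.prod_prod,
      ENNReal.ofReal_add hδ hδ', add_comm (ENNReal.ofReal δ)]
    refine add_le_add ?_ ?_
    · calc a Set.univ * ρ' Set.univ ≤ 1 * ENNReal.ofReal δ' :=
            mul_le_mul' ((hal _).trans prob_le_one) hρ'
        _ = _ := one_mul _
    · simpa using hρ

end ApproxDominated

/-! ### Translations of measures -/

lemma map_add_right_withDensity {G : Type*} [AddGroup G] [MeasurableSpace G] [MeasurableAdd G]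
    (m : Measure G) [m.IsAddRightInvariant] (f : G → ℝ≥0∞) (d : G) :
    (m.withDensity f).map (· + d) = m.withDensity fun x => f (x - d) := by
  have hm : Measurable (fun x : G => x - d) := by
    simpa [sub_eq_add_neg] using measurable_add_const (-d)
  ext S hS
  have hS' : MeasurableSet ((· + d) ⁻¹' S) := (measurable_add_const d) hS
  rw [Measure.map_apply (measurable_add_const d) hS, withDensity_apply _ hS',
    withDensity_apply _ hS, ← lintegral_indicator hS, ← lintegral_indicator hS',
    ← lintegral_add_right_eq_self (S.indicator fun x => f (x - d)) d]
  refine lintegral_congr fun x => ?_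
  by_cases hx : x + d ∈ S <;> simp [Set.indicator, hx]

/-! ### The Laplace mechanism -/

lemma isProbabilityMeasure_laplace {b : ℝ} (hb : 0 < b) : IsProbabilityMeasure (laplace b) := by
  have h1 : ∫ x in Set.Ioi (0:ℝ), Real.exp (-x / b) = b := by
    have h := integral_exp_mul_Ioi (a := -b⁻¹) (by simpa using hb) 0
    simp only [mul_zero, Real.exp_zero, neg_div_neg_eq, one_div, inv_inv] at h
    refine Eq.trans (integral_congr_ae (Filter.Eventually.of_forall fun x => ?_)) h
    show Real.exp _ = Real.exp _
    congr 1
    field_simp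
  have h2 : ∫ x : ℝ, 1 / (2 * b) * Real.exp (-|x| / b) = 1 := by
    rw [integral_comp_abs (f := fun x => 1 / (2 * b) * Real.exp (-x / b)), integral_const_mul, h1]
    field_simp
  -- The Bochner integral of a non-integrable function is `0` by convention, so the value `1`
  -- already forces integrability.
  have hI : Integrable (fun x : ℝ => 1 / (2 * b) * Real.exp (-|x| / b)) := by
    by_contra h
    rw [integral_undef h] at h2
    exact zero_ne_one h2
  constructor
  rw [laplace, withDensity_apply _ MeasurableSet.univ, Measure.restrict_univ,
    ← ofReal_integral_eq_lintegral_ofReal hI (Filter.Eventually.of_forall fun x => by positivity),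
    h2, ENNReal.ofReal_one]

lemma laplace_approxDominated {b ε a : ℝ} (hb : 0 < b) (ha : |a| ≤ b * ε) :
    ApproxDominated ε 0 (laplace b) ((laplace b).map (· + a)) := by
  refine .of_le ?_
  rw [laplace, map_add_right_withDensity,
    ← withDensity_smul _ (by fun_prop)]
  refine withDensity_mono (Filter.Eventually.of_forall fun x => ?_)
  simp only [Pi.smul_apply, smul_eq_mul]
  rw [← ENNReal.ofReal_mul (Real.exp_pos _).le]
  refine ENNReal.ofReal_le_ofReal ?_
  rw [mul_left_comm, ← Real.exp_add]
  refine mul_le_mul_of_nonneg_left (Real.exp_le_exp.2 ?_) (by positivity)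
  have h1 : |x - a| ≤ |x| + |a| := abs_sub x a
  rw [← sub_nonneg, show ε + -|x - a| / b - -|x| / b = (b * ε - |x - a| + |x|) / b by
    field_simp; ring]
  exact div_nonneg (by linarith) hb.le

/-- Translate the comparison for the shift `-a` by `a`; this gives the second of the two privacy
inequalities. -/
lemma laplace_map_add_approxDominated {b ε a : ℝ} (hb : 0 < b) (ha : |a| ≤ b * ε) :
    ApproxDominated ε 0 ((laplace b).map (· + a)) (laplace b) := by
  have h := (laplace_approxDominated (a := -a) hb (by rwa [abs_neg])).map (measurable_add_const a)
  rwa [Measure.map_map (measurable_add_const a) (measurable_add_const (-a)),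
    show ((· + a) ∘ (· + -a) : ℝ → ℝ) = id by ext x; simp, Measure.map_id] at h

/-! ### Gaussian tails -/

lemma gaussianReal_Ioi_zero_le : gaussianReal 0 1 (Set.Ioi 0) ≤ 1 / 2 := by
  have h1 : gaussianReal 0 1 (Set.Iio 0) = gaussianReal 0 1 (Set.Ioi 0) := by
    conv_rhs => rw [← neg_zero, ← gaussianReal_map_neg,
      Measure.map_apply measurable_neg measurableSet_Ioi]
    congr 1
    ext x
    simp
  have h2 : gaussianReal 0 1 (Set.Iio 0) + gaussianReal 0 1 (Set.Ioi 0) ≤ 1 := by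
    have hd : Disjoint (Set.Iio (0:ℝ)) (Set.Ioi 0) :=
      Set.disjoint_left.2 fun x hx hx' => lt_asymm (Set.mem_Iio.1 hx) (Set.mem_Ioi.1 hx')
    rw [← measure_union hd measurableSet_Ioi]
    exact prob_le_one
  rw [h1, ← two_mul] at h2
  rw [ENNReal.le_div_iff_mul_le (by simp) (by simp), mul_comm]
  exact h2

/-- After recentring at `t`, the density at `x > 0` is `exp (-t²/2) exp (-t x)` times the standard
one, and `exp (-t x) ≤ 1`. The remaining half-line has mass at most `1/2`. -/
lemma gaussianReal_Ioi_le_of_nonneg {t : ℝ} (ht : 0 ≤ t) :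
    gaussianReal 0 1 (Set.Ioi t) ≤ ENNReal.ofReal (Real.exp (-t ^ 2 / 2) / 2) := by
  have h1 : gaussianReal 0 1 (Set.Ioi t) = gaussianReal (-t) 1 (Set.Ioi 0) := by
    conv_lhs => rw [← neg_add_cancel t, ← gaussianReal_map_add_const,
      Measure.map_apply (measurable_add_const t) measurableSet_Ioi]
    congr 1
    ext x
    simp
  rw [h1, gaussianReal_apply _ one_ne_zero]
  calc ∫⁻ x in Set.Ioi 0, gaussianPDF (-t) 1 x
      ≤ ∫⁻ x in Set.Ioi 0, ENNReal.ofReal (Real.exp (-t ^ 2 / 2)) * gaussianPDF 0 1 x := by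
        refine setLIntegral_mono (by fun_prop) fun x hx => ?_
        rw [gaussianPDF, gaussianPDF, ← ENNReal.ofReal_mul (Real.exp_pos _).le]
        refine ENNReal.ofReal_le_ofReal ?_
        rw [gaussianPDFReal, gaussianPDFReal, mul_left_comm, ← Real.exp_add]
        refine mul_le_mul_of_nonneg_left (Real.exp_le_exp.2 ?_) (by positivity)
        have hx' : (0:ℝ) < x := hx
        simp only [NNReal.coe_one]
        nlinarith [mul_nonneg ht hx'.le]
    _ = ENNReal.ofReal (Real.exp (-t ^ 2 / 2)) * gaussianReal 0 1 (Set.Ioi 0) := by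
        rw [lintegral_const_mul _ (by fun_prop), gaussianReal_apply _ one_ne_zero]
    _ ≤ ENNReal.ofReal (Real.exp (-t ^ 2 / 2)) * (1 / 2) := by
        gcongr; exact gaussianReal_Ioi_zero_le
    _ = _ := by
        rw [ENNReal.ofReal_div_of_pos two_pos, mul_one_div]
        norm_num

/-- The standard density is at most `1`, so `(t, 0]` has mass at most `-t`. This crude bound is
needed only for thresholds just below `0`. -/
lemma gaussianReal_Ioi_le_of_neg {t : ℝ} (ht : t < 0) :
    gaussianReal 0 1 (Set.Ioi t) ≤ ENNReal.ofReal (1 / 2 - t) := by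
  have h1 : gaussianReal 0 1 (Set.Ioc t 0) ≤ ENNReal.ofReal (-t) := by
    rw [gaussianReal_apply _ one_ne_zero]
    calc ∫⁻ x in Set.Ioc t 0, gaussianPDF 0 1 x ≤ ∫⁻ x in Set.Ioc t 0, 1 := by
          refine setLIntegral_mono (by fun_prop) fun x _ => ?_
          rw [gaussianPDF, ← ENNReal.ofReal_one]
          refine ENNReal.ofReal_le_ofReal ?_
          rw [gaussianPDFReal]
          refine mul_le_one₀ ?_ (Real.exp_pos _).le ?_
          · refine inv_le_one_of_one_le₀ (Real.one_le_sqrt.2 ?_)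
            have := Real.pi_gt_three
            simp only [NNReal.coe_one]
            linarith
          · rw [Real.exp_le_one_iff, NNReal.coe_one]
            nlinarith [sq_nonneg (x - 0)]
      _ = ENNReal.ofReal (-t) := by simp
  calc gaussianReal 0 1 (Set.Ioi t)
      ≤ gaussianReal 0 1 (Set.Ioc t 0) + gaussianReal 0 1 (Set.Ioi 0) := by
        rw [← Set.Ioc_union_Ioi_eq_Ioi ht.le]
        exact measure_union_le _ _
    _ ≤ ENNReal.ofReal (-t) + 1 / 2 := add_le_add h1 gaussianReal_Ioi_zero_le
    _ = _ := by
        rw [sub_eq_add_neg, add_comm (1 / 2 : ℝ), ENNReal.ofReal_add (by linarith) (by norm_num),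
          ENNReal.ofReal_div_of_pos two_pos]
        norm_num

/-- This is where the constant `1.25` is used: `δ = 1.25 exp (-c²/2)`. If `u = c - 1/(2c) ≥ 0`, then
`u² ≥ c² - 1` and the tail is at most `(√e / 2) exp (-c²/2)`, with `√e ≤ 2`. If `u < 0`, then `c² <
1/2`, so `δ` is close to `1` and the crude tail bound suffices. -/
lemma gaussianReal_Ioi_le_delta {δ c t : ℝ} (hδ : 0 < δ) (hδ' : δ < 1) (hc : 0 < c)
    (hcδ : c ^ 2 = 2 * Real.log (1.25 / δ)) (ht : c - 1 / (2 * c) ≤ t) :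
    gaussianReal 0 1 (Set.Ioi t) ≤ ENNReal.ofReal δ := by
  have hδe : δ = 1.25 * Real.exp (-c ^ 2 / 2) := by
    rw [hcδ, show -(2 * Real.log (1.25 / δ)) / 2 = -Real.log (1.25 / δ) by ring, Real.exp_neg,
      Real.exp_log (by positivity)]
    field_simp
  refine (measure_mono (Set.Ioi_subset_Ioi ht)).trans ?_
  set u := c - 1 / (2 * c) with hu
  have hu2 : u ^ 2 = c ^ 2 - 1 + 1 / (4 * c ^ 2) := by rw [hu]; field_simp; ring
  rcases le_or_gt 0 u with h | h
  · refine (gaussianReal_Ioi_le_of_nonneg h).trans (ENNReal.ofReal_le_ofReal ?_)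
    have h1 : Real.exp (-u ^ 2 / 2) ≤ Real.exp (1 / 2) * Real.exp (-c ^ 2 / 2) := by
      rw [← Real.exp_add, hu2]
      refine Real.exp_le_exp.2 ?_
      have : 0 ≤ 1 / (4 * c ^ 2) := by positivity
      linarith
    have h2 : Real.exp (1 / 2) ≤ 2 := by
      have h3 : Real.exp (1 / 2) ^ 2 = Real.exp 1 := by
        rw [← Real.exp_nat_mul]; norm_num
      nlinarith [Real.exp_one_lt_d9, Real.exp_pos (1 / 2)]
    rw [hδe]
    nlinarith [Real.exp_pos (-c ^ 2 / 2)]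
  · refine (gaussianReal_Ioi_le_of_neg h).trans (ENNReal.ofReal_le_ofReal ?_)
    -- Since `δ < 1`, `c² ≥ 0.4`; hence `1/2 - u ≤ 0.5 - 0.632 + 0.8 < 0.7`, while `δ ≥ 1.25 (1 -
    -- c²/2) > 0.9`.
    have hlog : (0.2:ℝ) ≤ Real.log (1.25 / δ) := by
      have h1 : 1 - (1.25 / δ)⁻¹ ≤ Real.log (1.25 / δ) :=
        Real.one_sub_inv_le_log_of_pos (by positivity)
      have : (1.25 / δ)⁻¹ = δ * 0.8 := by field_simp; norm_num
      linarith
    have hc1 : c ^ 2 < 1 / 2 := by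
      have h1 : c * u < 0 := mul_neg_of_pos_of_neg hc h
      have h2 : c * u = c ^ 2 - 1 / 2 := by rw [hu]; field_simp
      linarith
    have hc2 : (0.632:ℝ) ≤ c := by
      nlinarith
    have h4 : 1 / (2 * c) ≤ 0.8 := by
      rw [div_le_iff₀ (by positivity)]; linarith
    have h5 : 1 + (-c ^ 2 / 2) ≤ Real.exp (-c ^ 2 / 2) := by
      linarith [Real.add_one_le_exp (-c ^ 2 / 2)]
    rw [hδe]
    linarith

/-! ### Vectors with i.i.d. Gaussian entries -/

variable {ι : Type*} [Fintype ι]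

lemma l2norm_nonneg (v : ι → ℝ) : 0 ≤ l2norm v := Real.sqrt_nonneg _

lemma l2norm_sq (v : ι → ℝ) : l2norm v ^ 2 = ∑ i, v i ^ 2 :=
  Real.sq_sqrt (Finset.sum_nonneg fun _ _ => sq_nonneg _)

instance (κ : ℝ≥0) : IsProbabilityMeasure (iidGaussian ι κ) := by
  unfold iidGaussian; infer_instance

lemma lintegral_pi_prod {κ : ℝ≥0} {f : ι → ℝ → ℝ≥0∞} (hf : ∀ i, Measurable (f i)) :
    ∫⁻ x, ∏ i, f i (x i) ∂iidGaussian ι κ = ∏ i, ∫⁻ x, f i x ∂gaussianReal 0 (κ ^ 2) := by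
  have h := iIndepFun_pi (μ := fun _ : ι => gaussianReal 0 (κ ^ 2)) (X := f)
    (fun i => (hf i).aemeasurable)
  rw [iidGaussian, lintegral_prod_eq_prod_lintegral_of_indepFun Finset.univ
    (fun i (x : ι → ℝ) => f i (x i)) h fun i => (hf i).comp (measurable_pi_apply i)]
  refine Finset.prod_congr rfl fun i _ => ?_
  exact (measurePreserving_eval (fun _ : ι => gaussianReal 0 (κ ^ 2)) i).lintegral_comp (hf i)

lemma iidGaussian_map_add (κ : ℝ≥0) (d : ι → ℝ) :
    (iidGaussian ι κ).map (· + d) = Measure.pi fun i => gaussianReal (d i) (κ ^ 2) := by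
  have h := Measure.pi_map_pi (μ := fun _ : ι => gaussianReal 0 (κ ^ 2))
    (f := fun i (x : ℝ) => x + d i) fun i => by fun_prop
  simp only [gaussianReal_map_add_const, zero_add] at h
  rw [← h]
  rfl

lemma gaussianReal_eq_withDensity {v : ℝ≥0} (hv : v ≠ 0) (d : ℝ) :
    gaussianReal d v = (gaussianReal 0 v).withDensity
      fun x => ENNReal.ofReal (Real.exp ((d * x - d ^ 2 / 2) / v)) := by
  rw [gaussianReal_of_var_ne_zero _ hv, gaussianReal_of_var_ne_zero _ hv,
    ← withDensity_mul _ (by fun_prop) (by fun_prop)]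
  congr 1
  ext x
  rw [Pi.mul_apply, gaussianPDF, gaussianPDF, ← ENNReal.ofReal_mul (gaussianPDFReal_nonneg _ _ _),
    gaussianPDFReal, gaussianPDFReal, mul_assoc _ (Real.exp _), ← Real.exp_add]
  congr 3
  have : (v : ℝ) ≠ 0 := by exact_mod_cast hv
  field_simp
  ring

lemma iidGaussian_map_add_eq_withDensity {κ : ℝ≥0} (hκ : κ ≠ 0) (d : ι → ℝ) :
    (iidGaussian ι κ).map (· + d) = (iidGaussian ι κ).withDensity
      fun x => ENNReal.ofReal (Real.exp ((∑ i, d i * x i - l2norm d ^ 2 / 2) / (κ : ℝ) ^ 2)) := by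
  rw [iidGaussian_map_add]
  refine Measure.pi_eq (μ := fun i => gaussianReal (d i) (κ ^ 2)) fun s hs => ?_
  have hm : MeasurableSet (Set.univ.pi s) := MeasurableSet.univ_pi hs
  rw [withDensity_apply _ hm, ← lintegral_indicator hm]
  have h1 : ∀ i, gaussianReal (d i) (κ ^ 2) (s i) = ∫⁻ x, (s i).indicator
      (fun x => ENNReal.ofReal (Real.exp ((d i * x - d i ^ 2 / 2) / (κ : ℝ) ^ 2))) x
        ∂gaussianReal 0 (κ ^ 2) := fun i => by
    rw [gaussianReal_eq_withDensity (pow_ne_zero 2 hκ), withDensity_apply _ (hs i),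
      lintegral_indicator (hs i)]
    simp
  simp only [h1]
  rw [← lintegral_pi_prod fun i => Measurable.indicator (by fun_prop) (hs i)]
  refine lintegral_congr fun x => ?_
  by_cases hx : x ∈ Set.univ.pi s
  · rw [Set.indicator_of_mem hx]
    have : ∀ i, x i ∈ s i := fun i => hx i (Set.mem_univ i)
    simp only [Set.indicator_of_mem (this _)]
    rw [← ENNReal.ofReal_prod_of_nonneg fun i _ => (Real.exp_pos _).le, ← Real.exp_sum,
      l2norm_sq, ← Finset.sum_div, Finset.sum_sub_distrib, Finset.sum_div]
  · rw [Set.indicator_of_notMem hx]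
    have : ∃ i, x i ∉ s i := by
      simpa [Set.mem_pi] using hx
    obtain ⟨i, hi⟩ := this
    exact (Finset.prod_eq_zero (Finset.mem_univ i) (Set.indicator_of_notMem hi _)).symm

lemma iidGaussian_map_sum (κ : ℝ≥0) (d : ι → ℝ) :
    (iidGaussian ι κ).map (fun x => ∑ i, d i * x i) =
      gaussianReal 0 ((l2norm d).toNNReal ^ 2 * κ ^ 2) := by
  have hm : Measurable fun x : ι → ℝ => ∑ i, d i * x i := by fun_prop
  have : IsProbabilityMeasure ((iidGaussian ι κ).map (fun x => ∑ i, d i * x i)) :=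
    Measure.isProbabilityMeasure_map hm.aemeasurable
  refine Measure.ext_of_charFun ?_
  ext t
  rw [charFun_apply_real, charFun_gaussianReal, integral_map hm.aemeasurable (by fun_prop)]
  have h1 : ∀ x : ι → ℝ, Complex.exp (t * ((∑ i, d i * x i : ℝ) : ℂ) * Complex.I) =
      ∏ i, Complex.exp (((t * d i : ℝ) : ℂ) * (x i : ℂ) * Complex.I) := fun x => by
    rw [← Complex.exp_sum]
    congr 1
    push_cast
    rw [Finset.mul_sum, Finset.sum_mul]
    exact Finset.sum_congr rfl fun i _ => by ring
  simp only [h1]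
  rw [iidGaussian, integral_fintype_prod_eq_prod
    (f := fun i (y : ℝ) => Complex.exp (((t * d i : ℝ) : ℂ) * (y : ℂ) * Complex.I))]
  simp only [← charFun_apply_real, charFun_gaussianReal]
  rw [← Complex.exp_sum]
  congr 1
  push_cast
  rw [Real.coe_toNNReal _ (l2norm_nonneg d), ← Complex.ofReal_pow (l2norm d), l2norm_sq]
  push_cast
  simp only [mul_zero, zero_mul, zero_sub, Finset.sum_neg_distrib, Finset.sum_mul, Finset.sum_div]
  congr 1
  exact Finset.sum_congr rfl fun i _ => by ring

/-! ### The Gaussian mechanism -/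

lemma ApproxDominated.refl {α : Type*} [MeasurableSpace α] {ε δ : ℝ} (hε : 0 ≤ ε)
    (μ : Measure α) : ApproxDominated ε δ μ μ := by
  refine ⟨μ, 0, by simp, ?_, by simp⟩
  intro S
  rw [Measure.smul_apply, smul_eq_mul]
  exact le_mul_of_one_le_left' (by simpa using hε)

/-- The log-likelihood ratio of the translate is affine. Where it is at least `-ε` domination holds
pointwise; elsewhere is a half-space orthogonal to `d`, whose mass is a one-dimensional Gaussian
tail. -/
lemma iidGaussian_approxDominated {ε δ Δ : ℝ} {κ : ℝ≥0} {d : ι → ℝ} (hε : 0 < ε) (hε' : ε < 1)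
    (hδ : 0 < δ) (hδ' : δ < 1) (hd : l2norm d ≤ Δ)
    (hκ : 2 * Real.log (1.25 / δ) / ε ^ 2 * Δ ^ 2 ≤ (κ : ℝ) ^ 2) :
    ApproxDominated ε δ (iidGaussian ι κ) ((iidGaussian ι κ).map (· + d)) := by
  -- The case `d = 0` is separate because `κ` may then vanish and there is no density to compare;
  -- for `d ≠ 0` the calibration forces `κ > 0`.
  rcases (l2norm_nonneg d).eq_or_lt with h0 | h0
  · have hd0 : d = 0 := by
      have h1 : ∑ i, d i ^ 2 = 0 := by rw [← l2norm_sq, ← h0]; ring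
      ext i
      have := (Finset.sum_eq_zero_iff_of_nonneg fun i _ => sq_nonneg (d i)).1 h1 i (Finset.mem_univ i)
      simpa using this
    subst hd0
    simp only [add_zero, Measure.map_id']
    exact .refl hε.le _
  set m := l2norm d with hm
  have hlog : 0 < Real.log (1.25 / δ) := by
    apply Real.log_pos
    rw [lt_div_iff₀ hδ]
    linarith
  set c := Real.sqrt (2 * Real.log (1.25 / δ)) with hc
  have hcpos : 0 < c := Real.sqrt_pos.2 (by linarith)
  have hc2 : c ^ 2 = 2 * Real.log (1.25 / δ) := Real.sq_sqrt (by linarith)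
  have hkc : c * m ≤ ε * κ := by
    rw [← hc2] at hκ
    have h1 : (c * m) ^ 2 ≤ (ε * κ) ^ 2 := by
      have h2 : (c / ε * Δ) ^ 2 ≤ (κ : ℝ) ^ 2 := by rw [mul_pow, div_pow]; exact hκ
      have h3 : c / ε * Δ ≤ κ := abs_le_of_sq_le_sq' h2 κ.2 |>.2
      have h4 : c / ε * m ≤ κ := (mul_le_mul_of_nonneg_left hd (by positivity)).trans h3
      have h5 : c * m ≤ ε * κ := by
        calc c * m = ε * (c / ε * m) := by field_simp
          _ ≤ _ := mul_le_mul_of_nonneg_left h4 hε.le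
      exact pow_le_pow_left₀ (by positivity) h5 2
    exact abs_le_of_sq_le_sq' h1 (by positivity) |>.2
  have hκpos : 0 < (κ : ℝ) := by
    by_contra h
    have : (κ : ℝ) = 0 := le_antisymm (not_lt.1 h) κ.2
    rw [this, mul_zero] at hkc
    exact absurd hkc (not_le.2 (by positivity))
  have hκ0 : κ ≠ 0 := by
    rintro rfl; simp at hκpos
  set ℓ : (ι → ℝ) → ℝ := fun x => (∑ i, d i * x i - m ^ 2 / 2) / (κ : ℝ) ^ 2 with hℓ
  have hℓm : Measurable ℓ := by fun_prop
  set G : Set (ι → ℝ) := {x | -ε ≤ ℓ x} with hG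
  have hGm : MeasurableSet G := measurableSet_le measurable_const hℓm
  refine ⟨(iidGaussian ι κ).restrict G, (iidGaussian ι κ).restrict Gᶜ,
    (Measure.restrict_add_restrict_compl hGm).symm, ?_, ?_⟩
  · rw [iidGaussian_map_add_eq_withDensity hκ0]
    refine Measure.le_iff.2 fun S hS => ?_
    rw [Measure.smul_apply, smul_eq_mul, withDensity_apply _ hS, Measure.restrict_apply hS,
      ← lintegral_const_mul _ (by fun_prop), ← setLIntegral_one]
    refine (setLIntegral_mono' (hS.inter hGm) fun x hx => ?_).trans
      (lintegral_mono_set Set.inter_subset_left)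
    rw [← ENNReal.ofReal_mul (Real.exp_pos _).le, ← Real.exp_add, ENNReal.one_le_ofReal,
      Real.one_le_exp_iff]
    have : -ε ≤ ℓ x := hx.2
    show 0 ≤ ε + ℓ x
    linarith
  · rw [Measure.restrict_apply MeasurableSet.univ, Set.univ_inter]
    set t := (ε * (κ : ℝ) ^ 2 - m ^ 2 / 2) / (m * κ) with ht
    have h1 : Gᶜ ⊆ (fun x => ∑ i, (-d i / (m * κ)) * x i) ⁻¹' Set.Ioi t := by
      intro x hx
      have hx' : ℓ x < -ε := not_le.1 hx
      rw [hℓ, div_lt_iff₀ (by positivity)] at hx'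
      simp only [Set.mem_preimage, Set.mem_Ioi]
      have : ∑ i, (-d i / (m * κ)) * x i = (-∑ i, d i * x i) / (m * κ) := by
        rw [← Finset.sum_neg_distrib, Finset.sum_div]
        exact Finset.sum_congr rfl fun i _ => by ring
      rw [this, ht]
      exact div_lt_div_of_pos_right (by linarith) (by positivity)
    refine (measure_mono h1).trans ?_
    rw [← Measure.map_apply (by fun_prop) measurableSet_Ioi, iidGaussian_map_sum]
    have h2 : l2norm (fun i => -d i / (m * κ)) = 1 / κ := by
      rw [l2norm]
      have h3 : ∑ i, (-d i / (m * κ)) ^ 2 = (1 / κ) ^ 2 := by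
        simp only [div_pow, neg_sq]
        rw [← Finset.sum_div, ← l2norm_sq, ← hm]
        field_simp
      rw [h3, Real.sqrt_sq (by positivity)]
    have h4 : (l2norm fun i => -d i / (m * κ)).toNNReal ^ 2 * κ ^ 2 = 1 := by
      rw [h2]
      ext
      push_cast
      rw [Real.coe_toNNReal _ (by positivity)]
      field_simp
    rw [h4]
    refine gaussianReal_Ioi_le_delta hδ hδ' hcpos hc2 ?_
    -- With `y = κ / m` the threshold is `t = ε y - 1/(2y)`. Calibration gives `ε y ≥ c`, and `ε <
    -- 1` then gives `y ≥ c`, so `t ≥ c - 1/(2c)`.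
    have hy : c / ε ≤ κ / m := by
      rw [div_le_div_iff₀ hε h0]; linarith
    have ht' : t = ε * (κ / m) - 1 / (2 * (κ / m)) := by
      rw [ht]; field_simp
    rw [ht']
    have h5 : c ≤ ε * (κ / m) := by
      calc c = ε * (c / ε) := by field_simp
        _ ≤ _ := mul_le_mul_of_nonneg_left hy hε.le
    have h6 : c ≤ κ / m := h5.trans (mul_le_of_le_one_left (by positivity) hε'.le)
    have h7 : 1 / (2 * (κ / m)) ≤ 1 / (2 * c) := by
      apply one_div_le_one_div_of_le (by positivity); linarith
    linarith

lemma l2norm_neg (v : ι → ℝ) : l2norm (-v) = l2norm v := by simp [l2norm]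

lemma iidGaussian_map_add_approxDominated {ε δ Δ : ℝ} {κ : ℝ≥0} {d : ι → ℝ} (hε : 0 < ε)
    (hε' : ε < 1) (hδ : 0 < δ) (hδ' : δ < 1) (hd : l2norm d ≤ Δ)
    (hκ : 2 * Real.log (1.25 / δ) / ε ^ 2 * Δ ^ 2 ≤ (κ : ℝ) ^ 2) :
    ApproxDominated ε δ ((iidGaussian ι κ).map (· + d)) (iidGaussian ι κ) := by
  have h := (iidGaussian_approxDominated hε hε' hδ hδ' ((l2norm_neg d).trans_le hd) hκ).map
    (measurable_add_const d)
  rwa [Measure.map_map (measurable_add_const d) (measurable_add_const (-d)),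
    show ((· + d) ∘ (· + -d) : (ι → ℝ) → ι → ℝ) = id by ext x; simp, Measure.map_id] at h

/-! ### Quadratic forms of Gaussian vectors -/

section Tail

variable {ι : Type*} [Fintype ι]

lemma lintegral_exp_mul_gaussianReal (v : ℝ≥0) (d : ℝ) :
    ∫⁻ x, ENNReal.ofReal (Real.exp (d * x)) ∂gaussianReal 0 v =
      ENNReal.ofReal (Real.exp (v * d ^ 2 / 2)) := by
  rw [← ofReal_integral_eq_lintegral_ofReal (integrable_exp_mul_gaussianReal d)
    (Filter.Eventually.of_forall fun x => (Real.exp_pos _).le)]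
  have h := mgf_gaussianReal (p := gaussianReal 0 v) (X := id) (μ := 0) (v := v) (by simp) d
  simp only [mgf, id_eq, zero_mul, zero_add] at h
  rw [h]

lemma lintegral_exp_sum_iidGaussian (κ : ℝ≥0) (d : ι → ℝ) :
    ∫⁻ x, ENNReal.ofReal (Real.exp (∑ i, d i * x i)) ∂iidGaussian ι κ =
      ENNReal.ofReal (Real.exp ((κ : ℝ) ^ 2 * l2norm d ^ 2 / 2)) := by
  have h : ∀ x : ι → ℝ, ENNReal.ofReal (Real.exp (∑ i, d i * x i)) =
      ∏ i, ENNReal.ofReal (Real.exp (d i * x i)) := fun x => by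
    rw [Real.exp_sum, ENNReal.ofReal_prod_of_nonneg fun i _ => (Real.exp_pos _).le]
  simp only [h]
  rw [lintegral_pi_prod (f := fun i y => ENNReal.ofReal (Real.exp (d i * y)))
    fun i => by fun_prop]
  simp only [lintegral_exp_mul_gaussianReal]
  rw [← ENNReal.ofReal_prod_of_nonneg fun i _ => (Real.exp_pos _).le, ← Real.exp_sum, l2norm_sq,
    Finset.mul_sum, Finset.sum_div]
  simp

lemma lintegral_exp_sq_gaussianReal {a : ℝ} (ha : 2 * a < 1) :
    ∫⁻ x, ENNReal.ofReal (Real.exp (a * x ^ 2)) ∂gaussianReal 0 1 =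
      ENNReal.ofReal (Real.sqrt (1 - 2 * a))⁻¹ := by
  have ha' : 0 < 1 - 2 * a := by linarith
  set v : ℝ≥0 := ⟨(1 - 2 * a)⁻¹, (inv_pos.2 ha').le⟩ with hv
  have hv0 : v ≠ 0 := by
    intro h
    have := congrArg NNReal.toReal h
    simp only [hv, NNReal.coe_zero] at this
    exact (inv_pos.2 ha').ne' this
  have hvr : (v : ℝ) = (1 - 2 * a)⁻¹ := rfl
  rw [gaussianReal_of_var_ne_zero _ one_ne_zero,
    lintegral_withDensity_eq_lintegral_mul _ (by fun_prop) (by fun_prop)]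
  calc ∫⁻ x, (gaussianPDF 0 1 * fun x => ENNReal.ofReal (Real.exp (a * x ^ 2))) x
      = ∫⁻ x, ENNReal.ofReal (Real.sqrt (1 - 2 * a))⁻¹ * gaussianPDF 0 v x := by
        refine lintegral_congr fun x => ?_
        rw [Pi.mul_apply, gaussianPDF, gaussianPDF,
          ← ENNReal.ofReal_mul (gaussianPDFReal_nonneg _ _ _),
          ← ENNReal.ofReal_mul (by positivity), gaussianPDFReal, gaussianPDFReal,
          mul_assoc _ (Real.exp _), ← Real.exp_add, ← mul_assoc]
        congr 2
        · rw [hvr, ← mul_inv, ← Real.sqrt_mul ha'.le]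
          congr 2
          simp only [NNReal.coe_one]
          field_simp
        · rw [hvr]
          congr 1
          simp only [NNReal.coe_one]
          field_simp
          ring
    _ = _ := by
        rw [lintegral_const_mul _ (by fun_prop), lintegral_gaussianPDF_eq_one _ hv0, mul_one]

lemma lintegral_exp_l2norm_sq_iidGaussian {a : ℝ} (ha : 2 * a < 1) :
    ∫⁻ x, ENNReal.ofReal (Real.exp (a * l2norm x ^ 2)) ∂iidGaussian ι 1 =
      ENNReal.ofReal (Real.sqrt (1 - 2 * a))⁻¹ ^ Fintype.card ι := by
  have h : ∀ x : ι → ℝ, ENNReal.ofReal (Real.exp (a * l2norm x ^ 2)) =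
      ∏ i, ENNReal.ofReal (Real.exp (a * x i ^ 2)) := fun x => by
    rw [l2norm_sq, Finset.mul_sum, Real.exp_sum,
      ENNReal.ofReal_prod_of_nonneg fun i _ => (Real.exp_pos _).le]
  simp only [h]
  rw [lintegral_pi_prod (f := fun _ y => ENNReal.ofReal (Real.exp (a * y ^ 2)))
    fun i => by fun_prop]
  simp [lintegral_exp_sq_gaussianReal ha]

lemma measurable_l2norm : Measurable (l2norm : (ι → ℝ) → ℝ) := by
  unfold l2norm; fun_prop

lemma sum_mulVec_mul {m : Type*} [Fintype m] (A : Matrix m ι ℝ) (g : ι → ℝ) (w : m → ℝ) :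
    ∑ i, (A *ᵥ g) i * w i = ∑ k, (Aᵀ *ᵥ w) k * g k := by
  simp only [mulVec, dotProduct, Finset.sum_mul, transpose_apply]
  rw [Finset.sum_comm]
  exact Finset.sum_congr rfl fun _ _ => Finset.sum_congr rfl fun _ _ => by ring

lemma measurable_mulVec {m : Type*} [Fintype m] (A : Matrix m ι ℝ) :
    Measurable fun g : ι → ℝ => A *ᵥ g := by
  refine measurable_pi_iff.2 fun i => ?_
  simp only [mulVec, dotProduct]
  fun_prop

lemma l2norm_smul (c : ℝ) (v : ι → ℝ) : l2norm (c • v) = |c| * l2norm v := by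
  rw [l2norm, l2norm, ← Real.sqrt_sq_eq_abs, ← Real.sqrt_mul (sq_nonneg c), Finset.mul_sum]
  simp [mul_pow]

/-- The exponential moments of `‖Aᵀ w‖²` for Gaussian `w` are controlled by the largest eigenvalue
of `Aᵀ A`. -/
lemma lintegral_exp_l2norm_transpose_mulVec_le {m : Type*} [Fintype m] (A : Matrix m ι ℝ)
    {t γ : ℝ} (σ : ℝ≥0) (ht : 0 ≤ t) (hA : ∀ g, l2norm (A *ᵥ g) ^ 2 ≤ γ * l2norm g ^ 2)
    (ha : 2 * ((σ : ℝ) ^ 2 * t * γ) < 1) :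
    ∫⁻ w, ENNReal.ofReal (Real.exp (t * l2norm (Aᵀ *ᵥ w) ^ 2)) ∂iidGaussian m σ ≤
      ENNReal.ofReal (Real.sqrt (1 - 2 * ((σ : ℝ) ^ 2 * t * γ)))⁻¹ ^ Fintype.card ι := by
  -- Linearization: `exp (t ‖Aᵀ w‖²)` is the mean of `exp (√(2t) ⟨Aᵀ w, g⟩)` over a standard
  -- Gaussian `g` indexed by `ι`. Integrating over `w` first leaves `exp (σ² t ‖A g‖²)`, where the
  -- bound on `A` applies, and the exponent is `card ι` rather than the number of rows.
  set s := Real.sqrt (2 * t) with hs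
  have hs2 : s ^ 2 = 2 * t := Real.sq_sqrt (by linarith)
  have h1 : ∀ w : m → ℝ, ENNReal.ofReal (Real.exp (t * l2norm (Aᵀ *ᵥ w) ^ 2)) =
      ∫⁻ g, ENNReal.ofReal (Real.exp (∑ k, (s • (Aᵀ *ᵥ w)) k * g k)) ∂iidGaussian ι 1 :=
    fun w => by
      rw [lintegral_exp_sum_iidGaussian, l2norm_smul, mul_pow, sq_abs, hs2]
      congr 2
      simp only [NNReal.coe_one]
      ring
  have h2 : ∀ (w : m → ℝ) (g : ι → ℝ),
      ∑ k, (s • (Aᵀ *ᵥ w)) k * g k = ∑ i, (s • (A *ᵥ g)) i * w i := fun w g => by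
    simp only [Pi.smul_apply, smul_eq_mul, mul_assoc]
    rw [← Finset.mul_sum, ← Finset.mul_sum, ← sum_mulVec_mul]
  simp only [h1, h2]
  rw [lintegral_lintegral_swap]
  · rw [← lintegral_exp_l2norm_sq_iidGaussian ha]
    refine lintegral_mono fun g => ?_
    simp only
    rw [lintegral_exp_sum_iidGaussian, l2norm_smul, mul_pow, sq_abs, hs2]
    refine ENNReal.ofReal_le_ofReal (Real.exp_le_exp.2 ?_)
    calc (σ : ℝ) ^ 2 * (2 * t * l2norm (A *ᵥ g) ^ 2) / 2
        = (σ : ℝ) ^ 2 * t * l2norm (A *ᵥ g) ^ 2 := by ring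
      _ ≤ (σ : ℝ) ^ 2 * t * (γ * l2norm g ^ 2) :=
          mul_le_mul_of_nonneg_left (hA g) (by positivity)
      _ = _ := by ring
  · refine Measurable.aemeasurable ?_
    have h3 : Measurable fun z : (m → ℝ) × (ι → ℝ) => A *ᵥ z.2 :=
      (measurable_mulVec A).comp measurable_snd
    have h4 : ∀ i, Measurable fun z : (m → ℝ) × (ι → ℝ) => (A *ᵥ z.2) i := fun i =>
      (measurable_pi_apply i).comp h3
    refine ENNReal.measurable_ofReal.comp (Real.measurable_exp.comp ?_)
    refine Finset.measurable_sum _ fun i _ => ?_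
    exact ((h4 i).const_smul s).mul ((measurable_pi_apply i).comp measurable_fst)

/-- Apply `x ≤ sinh x` at `x = -log (1 - τ)`; the remaining difference is `τ³ / (2 (1 - τ)) ≥ 0`.
This closes the Chernoff exponent below. -/
lemma sq_half_sub_le_log {τ : ℝ} (h0 : 0 ≤ τ) (h1 : τ < 1) :
    τ ^ 2 / 2 - τ / (1 - τ) ≤ Real.log (1 - τ) := by
  have hp : 0 < 1 - τ := by linarith
  have h2 : Real.log (1 - τ)⁻¹ ≤ Real.sinh (Real.log (1 - τ)⁻¹) :=
    Real.self_le_sinh_iff.2 (Real.log_nonneg (by rw [one_le_inv₀ hp]; linarith))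
  rw [Real.sinh_log (inv_pos.2 hp), Real.log_inv, inv_inv] at h2
  have h3 : ((1 - τ)⁻¹ - (1 - τ)) / 2 ≤ τ / (1 - τ) - τ ^ 2 / 2 := by
    rw [← sub_nonneg]
    have : τ / (1 - τ) - τ ^ 2 / 2 - ((1 - τ)⁻¹ - (1 - τ)) / 2 = τ ^ 3 / (2 * (1 - τ)) := by
      field_simp; ring
    rw [this]
    positivity
  linarith

/-- With probability at least `1 - δ₂ / 2`, `‖Aᵀ w‖² ≤ γ ζ`. -/
lemma measure_l2norm_transpose_mulVec_gt_le {m : Type*} [Fintype m] {p : ℕ} (hp : 0 < p)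
    (A : Matrix m ι ℝ) (hι : Fintype.card ι = 2 * p) {γ δ₂ : ℝ} (σ : ℝ≥0) (hγ : 0 < γ)
    (hA : ∀ g, l2norm (A *ᵥ g) ^ 2 ≤ γ * l2norm g ^ 2)
    (hδ₂ : 2 * Real.exp (-(p : ℝ) / 2) < δ₂) :
    iidGaussian m σ {w | γ * zeta p σ δ₂ < l2norm (Aᵀ *ᵥ w) ^ 2} ≤ ENNReal.ofReal (δ₂ / 2) := by
  have hp' : (0:ℝ) < p := by exact_mod_cast hp
  have hδpos : 0 < δ₂ := lt_trans (by positivity) hδ₂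
  -- For `δ₂ ≥ 2` the claimed bound is at least `1`. Otherwise `log (2 / δ₂) > 0`, and the
  -- hypothesis on `δ₂` is what makes `τ < 1`.
  rcases le_or_gt 2 δ₂ with h2 | h2
  · refine prob_le_one.trans ?_
    rw [ENNReal.one_le_ofReal]
    linarith
  set L := Real.log (2 / δ₂) with hL
  have hLpos : 0 < L := Real.log_pos (by rw [lt_div_iff₀ hδpos]; linarith)
  have hLexp : Real.exp (-L) = δ₂ / 2 := by
    rw [Real.exp_neg, hL, Real.exp_log (by positivity), inv_div]
  have hLp : L < p / 2 := by
    have : Real.exp (-(p : ℝ) / 2) < Real.exp (-L) := by rw [hLexp]; linarith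
    have := Real.exp_lt_exp.1 this
    linarith
  set τ := Real.sqrt (2 / p * L) with hτ
  have hτ0 : 0 < τ := Real.sqrt_pos.2 (by positivity)
  have hτ2 : τ ^ 2 = 2 / p * L := Real.sq_sqrt (by positivity)
  have hτ1 : τ < 1 := by
    have : τ ^ 2 < 1 := by
      rw [hτ2, div_mul_eq_mul_div, div_lt_one hp']; linarith
    nlinarith
  have hz : zeta p σ δ₂ = 2 * p * (σ : ℝ) ^ 2 / (1 - τ) := rfl
  -- For `σ = 0` the law is a point mass and the Chernoff parameter below would divide by zero.
  rcases eq_or_ne σ 0 with h0 | h0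
  · subst h0
    have h3 : iidGaussian m 0 = Measure.dirac 0 := by
      have h4 := Measure.map_const (iidGaussian m 0) (0 : m → ℝ)
      rw [measure_univ, one_smul] at h4
      rw [← h4, iidGaussian]
      simp only [ne_eq, OfNat.ofNat_ne_zero, not_false_eq_true, zero_pow, gaussianReal_zero_var]
      refine (Measure.pi_eq (μ := fun _ : m => Measure.dirac (0:ℝ)) fun s hs => ?_)
      rw [Measure.map_const, measure_univ, one_smul,
        Measure.dirac_apply' _ (MeasurableSet.univ_pi hs)]
      simp only [Measure.dirac_apply' _ (hs _)]
      by_cases hx : (0 : m → ℝ) ∈ Set.univ.pi s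
      · have : ∀ i, (0:ℝ) ∈ s i := fun i => hx i (Set.mem_univ i)
        simp [hx, this]
      · have : ∃ i, (0:ℝ) ∉ s i := by simpa [Set.mem_pi] using hx
        obtain ⟨i, hi⟩ := this
        rw [Set.indicator_of_notMem hx]
        exact (Finset.prod_eq_zero (Finset.mem_univ i) (Set.indicator_of_notMem hi _)).symm
    have hS : MeasurableSet {w : m → ℝ | γ * zeta p ((0:ℝ≥0):ℝ) δ₂ < l2norm (Aᵀ *ᵥ w) ^ 2} :=
      measurableSet_lt measurable_const ((measurable_l2norm.comp (measurable_mulVec _)).pow_const 2)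
    rw [h3, Measure.dirac_apply' _ hS, Set.indicator_of_notMem]
    · exact zero_le
    · rw [Set.mem_ofPred_eq, hz]
      simp [l2norm]
  have hσ : 0 < (σ : ℝ) := by positivity
  -- This choice makes the moment bound `(1 - τ) ^ (-p)` and the threshold exponent `p τ / (1 - τ)`.
  -- Their quotient is at most `exp (-p τ² / 2) = δ₂ / 2`.
  set t := τ / (2 * (σ : ℝ) ^ 2 * γ) with ht
  have htpos : 0 < t := by positivity
  have h2a : 2 * ((σ : ℝ) ^ 2 * t * γ) = τ := by rw [ht]; field_simp
  have hmgf := lintegral_exp_l2norm_transpose_mulVec_le A σ htpos.le hA (by rw [h2a]; exact hτ1)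
  rw [h2a, hι] at hmgf
  have htz : t * (γ * zeta p σ δ₂) = p * (τ / (1 - τ)) := by
    rw [hz, ht]
    have : 1 - τ ≠ 0 := by linarith
    field_simp
  have hsub : {w : m → ℝ | γ * zeta p σ δ₂ < l2norm (Aᵀ *ᵥ w) ^ 2} ⊆
      {w | ENNReal.ofReal (Real.exp (p * (τ / (1 - τ)))) ≤
        ENNReal.ofReal (Real.exp (t * l2norm (Aᵀ *ᵥ w) ^ 2))} := by
    intro w hw
    refine ENNReal.ofReal_le_ofReal (Real.exp_le_exp.2 ?_)
    rw [← htz]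
    exact mul_le_mul_of_nonneg_left (le_of_lt hw) htpos.le
  refine (measure_mono hsub).trans ?_
  have hmeas : Measurable fun w : m → ℝ =>
      ENNReal.ofReal (Real.exp (t * l2norm (Aᵀ *ᵥ w) ^ 2)) := by
    refine ENNReal.measurable_ofReal.comp (Real.measurable_exp.comp ?_)
    exact ((measurable_l2norm.comp (measurable_mulVec _)).pow_const 2).const_mul t
  refine (meas_ge_le_lintegral_div hmeas.aemeasurable
    (by simpa using Real.exp_pos _) ENNReal.ofReal_ne_top).trans ?_
  refine (ENNReal.div_le_div_right hmgf _).trans ?_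
  rw [← ENNReal.ofReal_pow (by positivity), ← ENNReal.ofReal_div_of_pos (Real.exp_pos _)]
  refine ENNReal.ofReal_le_ofReal ?_
  have hpos : 0 < 1 - τ := by linarith
  have h5 : (Real.sqrt (1 - τ))⁻¹ ^ (2 * p) = Real.exp (-(p * Real.log (1 - τ))) := by
    rw [pow_mul, inv_pow, Real.sq_sqrt hpos.le, Real.exp_neg, Real.exp_nat_mul,
      Real.exp_log hpos, inv_pow]
  rw [h5, ← Real.exp_sub, ← hLexp]
  refine Real.exp_le_exp.2 ?_
  have h6 := mul_le_mul_of_nonneg_left (sq_half_sub_le_log hτ0.le hτ1) hp'.le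
  have h7 : (p : ℝ) * (τ ^ 2 / 2) = L := by rw [hτ2]; field_simp
  rw [mul_sub, h7] at h6
  linarith

end Tail

/-! ### Privacy of the release on fixed data -/

section Mechanism

variable {n p : ℕ} {R : Type*} [MeasurableSpace R]

lemma measurable_matrix {α m k : Type*} [MeasurableSpace α] {g : α → Matrix m k ℝ}
    (h : ∀ i j, Measurable fun a => g a i j) : Measurable g :=
  measurable_pi_iff.2 fun i => measurable_pi_iff.2 fun j => h i j

lemma measurable_matrix_apply {m k : Type*} (i : m) (j : k) :
    Measurable fun A : Matrix m k ℝ => A i j :=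
  (measurable_pi_apply j).comp (measurable_pi_apply (X := fun _ : m => k → ℝ) i)

lemma measurable_symmOfUpper_apply (i j : Fin p) :
    Measurable fun g : UpperPairs p → ℝ => symmOfUpper g i j := by
  simp only [symmOfUpper, of_apply]
  split_ifs
  · exact measurable_pi_apply _
  · exact measurable_pi_apply _
  · exact measurable_const

lemma symmOfUpper_add (g h : UpperPairs p → ℝ) :
    symmOfUpper (g + h) = symmOfUpper g + symmOfUpper h := by
  ext i j
  simp only [symmOfUpper, of_apply, Matrix.add_apply, Pi.add_apply]
  split_ifs <;> simp

lemma gramNoise_add (a b : ℝ) (M N : Matrix (Fin p) (Fin p) ℝ) :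
    gramNoise (a + b) (M + N) = gramNoise a M + gramNoise b N := by
  simp only [gramNoise, add_smul, ← fromBlocks_add]
  abel

/-- The law of the independent noise variables `θ₁`, the upper triangle of `θ₂`, and `e`. -/
def baseNoise (p : ℕ) (b : ℝ) (κ₁ κ₂ : ℝ≥0) :
    Measure (ℝ × (UpperPairs p → ℝ) × (Fin p ⊕ Fin p → ℝ)) :=
  (laplace b).prod ((iidGaussian (UpperPairs p) κ₁).prod (iidGaussian (Fin p ⊕ Fin p) κ₂))

lemma measurable_noise :
    Measurable fun t : ℝ × (UpperPairs p → ℝ) × (Fin p ⊕ Fin p → ℝ) =>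
      (gramNoise t.1 (symmOfUpper t.2.1), t.2.2) := by
  refine Measurable.prodMk (measurable_matrix fun i j => ?_) (by fun_prop)
  have h : ∀ i j, Measurable fun t : ℝ × (UpperPairs p → ℝ) × (Fin p ⊕ Fin p → ℝ) =>
      symmOfUpper t.2.1 i j := fun i j =>
    (measurable_symmOfUpper_apply i j).comp (measurable_fst.comp measurable_snd)
  rcases i with i | i <;> rcases j with j | j <;>
  · simp only [gramNoise, Matrix.add_apply, Matrix.smul_apply, fromBlocks_apply₁₁, fromBlocks_apply₁₂,
      fromBlocks_apply₂₁, fromBlocks_apply₂₂, smul_eq_mul]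
    exact (measurable_fst.mul_const _).add (h i j)

lemma measurable_statistic_prod
    {f : Matrix (Fin p ⊕ Fin p) (Fin p ⊕ Fin p) ℝ → (Fin p ⊕ Fin p → ℝ) → R}
    (hf : Measurable (Function.uncurry f)) (X Xt : Matrix (Fin n) (Fin p) ℝ) :
    Measurable fun t : (Fin n → ℝ) ×
        (Matrix (Fin p ⊕ Fin p) (Fin p ⊕ Fin p) ℝ × (Fin p ⊕ Fin p → ℝ)) =>
      statistic f X Xt t.1 t.2 := by
  refine hf.comp (Measurable.prodMk (measurable_matrix fun i j => ?_) ?_)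
  · show Measurable fun t : (Fin n → ℝ) × (Matrix (Fin p ⊕ Fin p) (Fin p ⊕ Fin p) ℝ ×
      (Fin p ⊕ Fin p → ℝ)) => augGram X Xt i j + t.2.1 i j
    exact measurable_const.add ((measurable_matrix_apply i j).comp
      (measurable_fst.comp measurable_snd))
  · exact ((measurable_mulVec _).comp measurable_fst).add (measurable_snd.comp measurable_snd)

lemma measurable_statistic
    {f : Matrix (Fin p ⊕ Fin p) (Fin p ⊕ Fin p) ℝ → (Fin p ⊕ Fin p → ℝ) → R}
    (hf : Measurable (Function.uncurry f)) (X Xt : Matrix (Fin n) (Fin p) ℝ) (y : Fin n → ℝ) :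
    Measurable (statistic f X Xt y) :=
  (measurable_statistic_prod hf X Xt).comp measurable_prodMk_left

lemma baseNoise_map_add (p : ℕ) {b : ℝ} (hb : 0 < b) (κ₁ κ₂ : ℝ≥0)
    (s : ℝ × (UpperPairs p → ℝ) × (Fin p ⊕ Fin p → ℝ)) :
    (baseNoise p b κ₁ κ₂).map (· + s) =
      ((laplace b).map (· + s.1)).prod (((iidGaussian (UpperPairs p) κ₁).map (· + s.2.1)).prod
        ((iidGaussian (Fin p ⊕ Fin p) κ₂).map (· + s.2.2))) := by
  have := isProbabilityMeasure_laplace hb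
  rw [Measure.map_prod_map _ _ (measurable_add_const _) (measurable_add_const _),
    Measure.map_prod_map _ _ (measurable_add_const _)
      ((measurable_add_const _).prodMap (measurable_add_const _))]
  rfl

/-- Differential privacy of the release for two data sets whose Gram matrices and feature-response
products differ by small shifts of the noise variables. -/
lemma dpClose_release
    {f : Matrix (Fin p ⊕ Fin p) (Fin p ⊕ Fin p) ℝ → (Fin p ⊕ Fin p → ℝ) → R}
    (hf : Measurable (Function.uncurry f)) {ε ε₁ ε₂ δ δ₁ b Δ₁ Δ₂ : ℝ}
    (hε : 0 < ε) (hε' : ε < 1) (hε₂ : 0 < ε₂) (hε₂' : ε₂ < 1)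
    (hδ : 0 < δ) (hδ' : δ < 1) (hδ₁ : 0 < δ₁) (hδ₁' : δ₁ < 1) (hb : 0 < b)
    {X Z Xt Zt : Matrix (Fin n) (Fin p) ℝ} {y yz : Fin n → ℝ} {κ₁ κ₂ : ℝ≥0}
    (a : ℝ) (h : UpperPairs p → ℝ)
    (hG : augGram Z Zt = augGram X Xt + gramNoise a (symmOfUpper h))
    (ha : |a| ≤ b * ε₁) (hh : l2norm h ≤ Δ₁)
    (hd : l2norm (featResp X Xt y - featResp Z Zt yz) ≤ Δ₂)
    (hκ₁ : 2 * Real.log (1.25 / δ) / ε₂ ^ 2 * Δ₁ ^ 2 ≤ (κ₁ : ℝ) ^ 2)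
    (hκ₂ : 2 * Real.log (1.25 / δ₁) / ε ^ 2 * Δ₂ ^ 2 ≤ (κ₂ : ℝ) ^ 2) :
    DPClose (ε + (ε₁ + ε₂)) (δ + δ₁)
      (release f (noiseLaw p b κ₁ κ₂) X Xt y) (release f (noiseLaw p b κ₁ κ₂) Z Zt yz) := by
  have := isProbabilityMeasure_laplace hb
  set d := featResp Z Zt yz - featResp X Xt y with hdd
  have hd' : l2norm d ≤ Δ₂ := by rwa [hdd, ← neg_sub, l2norm_neg]
  set F : ℝ × (UpperPairs p → ℝ) × (Fin p ⊕ Fin p → ℝ) → R := fun t =>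
    statistic f X Xt y (gramNoise t.1 (symmOfUpper t.2.1), t.2.2) with hF
  have hFm : Measurable F := (measurable_statistic hf X Xt y).comp measurable_noise
  have hX : release f (noiseLaw p b κ₁ κ₂) X Xt y = (baseNoise p b κ₁ κ₂).map F := by
    rw [release, noiseLaw, Measure.map_map (measurable_statistic hf X Xt y) measurable_noise]
    rfl
  -- The difference of the two statistics is absorbed into the noise variables, so the same
  -- post-processing `F` serves both data sets.
  have hZ : release f (noiseLaw p b κ₁ κ₂) Z Zt yz =
      ((baseNoise p b κ₁ κ₂).map (· + (a, h, d))).map F := by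
    rw [release, noiseLaw, Measure.map_map (measurable_statistic hf Z Zt yz) measurable_noise,
      Measure.map_map hFm (measurable_add_const _)]
    have hfun : (statistic f Z Zt yz ∘ fun t : ℝ × (UpperPairs p → ℝ) × (Fin p ⊕ Fin p → ℝ) =>
        (gramNoise t.1 (symmOfUpper t.2.1), t.2.2)) = F ∘ fun t => t + (a, h, d) := by
      ext t
      have e1 : augGram Z Zt + gramNoise t.1 (symmOfUpper t.2.1) =
          augGram X Xt + gramNoise (t.1 + a) (symmOfUpper (t.2.1 + h)) := by
        rw [hG, symmOfUpper_add, gramNoise_add]; abel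
      have e2 : featResp Z Zt yz + t.2.2 = featResp X Xt y + (t.2.2 + d) := by
        rw [hdd]; abel
      show f _ _ = f _ _
      exact congrArg₂ f e1 e2
    rw [hfun]
    rfl
  have hp1 : IsProbabilityMeasure ((laplace b).map (· + a)) :=
    Measure.isProbabilityMeasure_map (measurable_add_const _).aemeasurable
  have hp2 : IsProbabilityMeasure ((iidGaussian (UpperPairs p) κ₁).map (· + h)) :=
    Measure.isProbabilityMeasure_map (measurable_add_const _).aemeasurable
  have hp3 : IsProbabilityMeasure ((iidGaussian (Fin p ⊕ Fin p) κ₂).map (· + d)) :=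
    Measure.isProbabilityMeasure_map (measurable_add_const _).aemeasurable
  have eε : ε₁ + (ε₂ + ε) = ε + (ε₁ + ε₂) := by ring
  have eδ : 0 + (δ + δ₁) = δ + δ₁ := by ring
  have h12 := (laplace_approxDominated hb ha).prod le_rfl (add_pos hδ hδ₁).le
    ((iidGaussian_approxDominated hε₂ hε₂' hδ hδ' hh hκ₁).prod hδ.le hδ₁.le
      (iidGaussian_approxDominated hε hε' hδ₁ hδ₁' hd' hκ₂))
  have h21 := (laplace_map_add_approxDominated hb ha).prod le_rfl (add_pos hδ hδ₁).le
    ((iidGaussian_map_add_approxDominated hε₂ hε₂' hδ hδ' hh hκ₁).prod hδ.le hδ₁.le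
      (iidGaussian_map_add_approxDominated hε hε' hδ₁ hδ₁' hd' hκ₂))
  rw [eε, eδ] at h12 h21
  intro S _
  rw [hX, hZ, baseNoise_map_add p hb]
  exact ⟨(h12.map hFm).measure_le S, (h21.map hFm).measure_le S⟩

lemma isProbabilityMeasure_noiseLaw (p : ℕ) {b : ℝ} (hb : 0 < b) (κ₁ κ₂ : ℝ≥0) :
    IsProbabilityMeasure (noiseLaw p b κ₁ κ₂) := by
  have := isProbabilityMeasure_laplace hb
  exact Measure.isProbabilityMeasure_map measurable_noise.aemeasurable

lemma dpClose_refl {ε δ : ℝ} (hε : 0 ≤ ε) (μ : Measure R) : DPClose ε δ μ μ := by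
  intro S _
  have : μ S ≤ ENNReal.ofReal (Real.exp ε) * μ S + ENNReal.ofReal δ :=
    le_add_right (le_mul_of_one_le_left' (by simpa using hε))
  exact ⟨this, this⟩

/-! ### Averaging over the responses -/

lemma releaseRandom_apply {Ω : Type*} [MeasurableSpace Ω] {P : Measure Ω} [SFinite P]
    {f : Matrix (Fin p ⊕ Fin p) (Fin p ⊕ Fin p) ℝ → (Fin p ⊕ Fin p → ℝ) → R}
    (hf : Measurable (Function.uncurry f))
    {N : Measure (Matrix (Fin p ⊕ Fin p) (Fin p ⊕ Fin p) ℝ × (Fin p ⊕ Fin p → ℝ))} [SFinite N]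
    (X Xt : Matrix (Fin n) (Fin p) ℝ) {y : Ω → Fin n → ℝ} (hy : AEMeasurable y P)
    {S : Set R} (hS : MeasurableSet S) :
    releaseRandom P f N X Xt y S = ∫⁻ ω, release f N X Xt (y ω) S ∂P := by
  have hm := measurable_statistic_prod hf X Xt
  have hm' : Measurable fun t : Ω ×
      (Matrix (Fin p ⊕ Fin p) (Fin p ⊕ Fin p) ℝ × (Fin p ⊕ Fin p → ℝ)) =>
      statistic f X Xt (hy.mk y t.1) t.2 :=
    hm.comp ((hy.measurable_mk.comp measurable_fst).prodMk measurable_snd)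
  have he : (fun t : Ω × (Matrix (Fin p ⊕ Fin p) (Fin p ⊕ Fin p) ℝ × (Fin p ⊕ Fin p → ℝ)) =>
      statistic f X Xt (y t.1) t.2) =ᵐ[P.prod N] fun t => statistic f X Xt (hy.mk y t.1) t.2 := by
    have h1 : ∀ᵐ t ∂P.prod N, y t.1 = hy.mk y t.1 :=
      Measure.quasiMeasurePreserving_fst.ae hy.ae_eq_mk
    filter_upwards [h1] with t ht
    rw [ht]
  rw [releaseRandom, Measure.map_congr he, Measure.map_apply hm' hS,
    Measure.prod_apply (hm' hS)]
  refine lintegral_congr_ae ?_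
  filter_upwards [hy.ae_eq_mk] with ω hω
  rw [release, Measure.map_apply (measurable_statistic hf X Xt _) hS, hω]
  rfl

/-- Integrate the conditional inequality; on the exceptional set bound the output probability by
`1`, which costs at most `δ'`. -/
lemma dpClose_releaseRandom {Ω : Type*} [MeasurableSpace Ω] {P : Measure Ω}
    [IsProbabilityMeasure P]
    {f : Matrix (Fin p ⊕ Fin p) (Fin p ⊕ Fin p) ℝ → (Fin p ⊕ Fin p → ℝ) → R}
    (hf : Measurable (Function.uncurry f))
    {N : Measure (Matrix (Fin p ⊕ Fin p) (Fin p ⊕ Fin p) ℝ × (Fin p ⊕ Fin p → ℝ))}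
    [IsProbabilityMeasure N] {X Xt Z Zt : Matrix (Fin n) (Fin p) ℝ} {y yz : Ω → Fin n → ℝ}
    (hy : AEMeasurable y P) (hyz : AEMeasurable yz P) {ε δ δ' : ℝ} (hδ : 0 ≤ δ) (hδ' : 0 ≤ δ')
    (h : P {ω | ¬ DPClose ε δ (release f N X Xt (y ω)) (release f N Z Zt (yz ω))} ≤
      ENNReal.ofReal δ') :
    DPClose ε (δ + δ') (releaseRandom P f N X Xt y) (releaseRandom P f N Z Zt yz) := by
  set bad := {ω | ¬ DPClose ε δ (release f N X Xt (y ω)) (release f N Z Zt (yz ω))} with hbad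
  -- The exceptional set quantifies over all measurable `S` and need not be measurable; its
  -- measurable hull has the same measure.
  set T := toMeasurable P bad with hT
  have hTm : MeasurableSet T := measurableSet_toMeasurable P bad
  have hTP : P T ≤ ENNReal.ofReal δ' := by rwa [hT, measure_toMeasurable]
  have key : ∀ r r' : Ω → ℝ≥0∞, (∀ ω, r ω ≤ 1) →
      (∀ ω, ω ∉ bad → r ω ≤ ENNReal.ofReal (Real.exp ε) * r' ω + ENNReal.ofReal δ) →
      ∫⁻ ω, r ω ∂P ≤ ENNReal.ofReal (Real.exp ε) * ∫⁻ ω, r' ω ∂P + ENNReal.ofReal (δ + δ') := by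
    intro r r' hr1 hr
    calc ∫⁻ ω, r ω ∂P ≤ ∫⁻ ω, (ENNReal.ofReal (Real.exp ε) * r' ω +
          (ENNReal.ofReal δ + T.indicator 1 ω)) ∂P := by
          refine lintegral_mono fun ω => ?_
          by_cases hω : ω ∈ T
          · simp only [Set.indicator_of_mem hω, Pi.one_apply]
            exact (hr1 ω).trans (le_add_left (le_add_left le_rfl))
          · simp only [Set.indicator_of_notMem hω, add_zero]
            exact hr ω fun hb => hω (subset_toMeasurable P bad hb)
      _ = ENNReal.ofReal (Real.exp ε) * ∫⁻ ω, r' ω ∂P + (ENNReal.ofReal δ + P T) := by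
          have hm : Measurable fun ω => ENNReal.ofReal δ + T.indicator 1 ω :=
            (measurable_one.indicator hTm).const_add _
          rw [lintegral_add_right _ hm,
            lintegral_const_mul' _ _ ENNReal.ofReal_ne_top,
            lintegral_add_left measurable_const, lintegral_indicator_one hTm]
          simp
      _ ≤ _ := by
          rw [ENNReal.ofReal_add hδ hδ']
          gcongr
  have hprob : ∀ (X Xt : Matrix (Fin n) (Fin p) ℝ) (y : Fin n → ℝ) (S : Set R),
      release f N X Xt y S ≤ 1 := fun X Xt y S => by
    have : IsProbabilityMeasure (release f N X Xt y) :=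
      Measure.isProbabilityMeasure_map (measurable_statistic hf X Xt y).aemeasurable
    exact prob_le_one
  intro S hS
  rw [releaseRandom_apply hf X Xt hy hS, releaseRandom_apply hf Z Zt hyz hS]
  refine ⟨key _ _ (fun ω => hprob _ _ _ _) fun ω hω => ?_,
    key _ _ (fun ω => hprob _ _ _ _) fun ω hω => ?_⟩
  · exact (not_not.1 hω S hS).1
  · exact (not_not.1 hω S hS).2

end Mechanism

/-! ### The Euclidean norm -/

section Norm

variable {ι : Type*} [Fintype ι]

lemma l2norm_eq_norm (v : ι → ℝ) : l2norm v = ‖WithLp.toLp 2 v‖ := by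
  simp [l2norm, EuclideanSpace.norm_eq]

lemma l2norm_add_le (u v : ι → ℝ) : l2norm (u + v) ≤ l2norm u + l2norm v := by
  simp only [l2norm_eq_norm, WithLp.toLp_add]
  exact norm_add_le _ _

lemma l2norm_sub_le (u v : ι → ℝ) : l2norm (u - v) ≤ l2norm u + l2norm v := by
  rw [sub_eq_add_neg, ← l2norm_neg v]
  exact l2norm_add_le _ _

lemma l2norm_mono {u v : ι → ℝ} (h : ∀ i, |u i| ≤ |v i|) : l2norm u ≤ l2norm v :=
  Real.sqrt_le_sqrt (Finset.sum_le_sum fun i _ => sq_le_sq.2 (h i))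

lemma l2norm_le_iff_sq_le {v : ι → ℝ} {c : ℝ} (hc : 0 ≤ c) :
    l2norm v ≤ c ↔ l2norm v ^ 2 ≤ c ^ 2 :=
  (pow_le_pow_iff_left₀ (l2norm_nonneg v) hc two_ne_zero).symm

lemma dotProduct_self_eq_l2norm_sq (v : ι → ℝ) : v ⬝ᵥ v = l2norm v ^ 2 := by
  rw [l2norm_sq, dotProduct]
  exact Finset.sum_congr rfl fun i _ => (sq (v i)).symm

lemma dotProduct_sq_le (u v : ι → ℝ) : (u ⬝ᵥ v) ^ 2 ≤ l2norm u ^ 2 * l2norm v ^ 2 := by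
  rw [l2norm_sq, l2norm_sq]
  exact Finset.sum_mul_sq_le_sq_mul_sq _ _ _

lemma dotProduct_le_l2norm_mul (u v : ι → ℝ) : u ⬝ᵥ v ≤ l2norm u * l2norm v := by
  refine le_of_sq_le_sq ?_ (mul_nonneg (l2norm_nonneg u) (l2norm_nonneg v))
  rw [mul_pow]
  exact dotProduct_sq_le u v

lemma abs_le_l2norm (v : ι → ℝ) (i : ι) : |v i| ≤ l2norm v := by
  rw [← Real.sqrt_sq_eq_abs]
  exact Real.sqrt_le_sqrt
    (Finset.single_le_sum (f := fun i => v i ^ 2) (fun _ _ => sq_nonneg _) (Finset.mem_univ i))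

lemma frobNorm_eq_l2norm {m k : Type*} [Fintype m] [Fintype k] (A : Matrix m k ℝ) :
    frobNorm A = l2norm fun q : m × k => A q.1 q.2 := by
  rw [frobNorm, l2norm, Fintype.sum_prod_type]

lemma frobNorm_nonneg {m k : Type*} [Fintype m] [Fintype k] (A : Matrix m k ℝ) :
    0 ≤ frobNorm A := Real.sqrt_nonneg _

lemma frobNorm_sq {m k : Type*} [Fintype m] [Fintype k] (A : Matrix m k ℝ) :
    frobNorm A ^ 2 = ∑ i, ∑ j, A i j ^ 2 :=
  Real.sq_sqrt (Finset.sum_nonneg fun _ _ => Finset.sum_nonneg fun _ _ => sq_nonneg _)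

end Norm

/-! ### Rayleigh quotients of Gram matrices -/

section Rayleigh

variable {n p : ℕ}

lemma gram_isHermitian (Y : Matrix (Fin n) (Fin p) ℝ) : (gram Y).IsHermitian := by
  have := isHermitian_conjTranspose_mul_self Y
  rwa [conjTranspose_eq_transpose_of_trivial] at this

lemma gram_transpose (Y : Matrix (Fin n) (Fin p) ℝ) : (gram Y)ᵀ = gram Y := by
  simp [gram]

lemma dotProduct_gram_mulVec (Y : Matrix (Fin n) (Fin p) ℝ) (u v : Fin p → ℝ) :
    u ⬝ᵥ (gram Y *ᵥ v) = (Y *ᵥ u) ⬝ᵥ (Y *ᵥ v) := by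
  rw [gram, ← mulVec_mulVec, dotProduct_mulVec, vecMul_transpose]

lemma gram_apply (Y : Matrix (Fin n) (Fin p) ℝ) (i j : Fin p) :
    gram Y i j = ∑ a, Y a i * Y a j := by
  simp [gram, mul_apply]

lemma lamMin_mul_le (Y : Matrix (Fin n) (Fin p) ℝ) (v : Fin p → ℝ) :
    lamMin (gram Y) * l2norm v ^ 2 ≤ l2norm (Y *ᵥ v) ^ 2 := by
  have hps : (gram Y - algebraMap ℝ _ (lamMin (gram Y))).PosSemidef := by
    refine posSemidef_iff_isHermitian_and_spectrum_nonneg.2 ⟨?_, ?_⟩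
    · refine (gram_isHermitian Y).sub ?_
      rw [Algebra.algebraMap_eq_smul_one]
      simp [IsHermitian]
    · rw [← spectrum.sub_singleton_eq]
      rintro _ ⟨a, ha, b, rfl, rfl⟩
      exact sub_nonneg.2 (csInf_le finite_real_spectrum.bddBelow ha)
  have h := hps.dotProduct_mulVec_nonneg v
  rw [sub_mulVec, dotProduct_sub, Algebra.algebraMap_eq_smul_one, smul_mulVec, one_mulVec,
    dotProduct_smul, star_trivial, dotProduct_gram_mulVec, dotProduct_self_eq_l2norm_sq,
    dotProduct_self_eq_l2norm_sq, smul_eq_mul] at h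
  linarith

lemma le_lamMax_mul (Y : Matrix (Fin n) (Fin p) ℝ) (v : Fin p → ℝ) :
    l2norm (Y *ᵥ v) ^ 2 ≤ lamMax (gram Y) * l2norm v ^ 2 := by
  have hps : (algebraMap ℝ _ (lamMax (gram Y)) - gram Y).PosSemidef := by
    refine posSemidef_iff_isHermitian_and_spectrum_nonneg.2 ⟨?_, ?_⟩
    · refine IsHermitian.sub ?_ (gram_isHermitian Y)
      rw [Algebra.algebraMap_eq_smul_one]
      simp [IsHermitian]
    · rw [← spectrum.singleton_sub_eq]
      rintro _ ⟨b, rfl, a, ha, rfl⟩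
      exact sub_nonneg.2 (le_csSup finite_real_spectrum.bddAbove ha)
  have h := hps.dotProduct_mulVec_nonneg v
  rw [sub_mulVec, dotProduct_sub, Algebra.algebraMap_eq_smul_one, smul_mulVec, one_mulVec,
    dotProduct_smul, star_trivial, dotProduct_gram_mulVec, dotProduct_self_eq_l2norm_sq,
    dotProduct_self_eq_l2norm_sq, smul_eq_mul] at h
  linarith

lemma exists_l2norm_mulVec_eq_of_mem_spectrum (Y : Matrix (Fin n) (Fin p) ℝ) {c : ℝ}
    (hc : c ∈ spectrum ℝ (gram Y)) : ∃ v, l2norm v = 1 ∧ l2norm (Y *ᵥ v) ^ 2 = c := by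
  have hA := gram_isHermitian Y
  rw [hA.spectrum_real_eq_range_eigenvalues] at hc
  obtain ⟨i, rfl⟩ := hc
  have h1 : l2norm (hA.eigenvectorBasis i).ofLp = 1 := by
    rw [l2norm_eq_norm]
    exact hA.eigenvectorBasis.orthonormal.1 i
  refine ⟨(hA.eigenvectorBasis i).ofLp, h1, ?_⟩
  rw [← dotProduct_self_eq_l2norm_sq, ← dotProduct_gram_mulVec, hA.mulVec_eigenvectorBasis,
    dotProduct_smul, dotProduct_self_eq_l2norm_sq, h1, smul_eq_mul]
  ring

lemma spectrum_gram_nonempty [NeZero p] (Y : Matrix (Fin n) (Fin p) ℝ) :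
    (spectrum ℝ (gram Y)).Nonempty := by
  rw [(gram_isHermitian Y).spectrum_real_eq_range_eigenvalues]
  exact Set.range_nonempty _

lemma exists_l2norm_mulVec_eq_lamMin [NeZero p] (Y : Matrix (Fin n) (Fin p) ℝ) :
    ∃ v, l2norm v = 1 ∧ l2norm (Y *ᵥ v) ^ 2 = lamMin (gram Y) :=
  exists_l2norm_mulVec_eq_of_mem_spectrum Y
    ((spectrum_gram_nonempty Y).csInf_mem finite_real_spectrum)

lemma exists_l2norm_mulVec_eq_lamMax [NeZero p] (Y : Matrix (Fin n) (Fin p) ℝ) :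
    ∃ v, l2norm v = 1 ∧ l2norm (Y *ᵥ v) ^ 2 = lamMax (gram Y) :=
  exists_l2norm_mulVec_eq_of_mem_spectrum Y
    ((spectrum_gram_nonempty Y).csSup_mem finite_real_spectrum)

lemma lamMin_nonneg [NeZero p] (Y : Matrix (Fin n) (Fin p) ℝ) : 0 ≤ lamMin (gram Y) := by
  obtain ⟨v, -, hv⟩ := exists_l2norm_mulVec_eq_lamMin Y
  rw [← hv]
  positivity

lemma l2norm_single (j : Fin p) : l2norm (Pi.single j (1:ℝ)) = 1 := by
  rw [l2norm_eq_norm]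
  simp

lemma lamMin_le_one [NeZero p] {Y : Matrix (Fin n) (Fin p) ℝ} (hY : ∀ j, colNorm Y j = 1) :
    lamMin (gram Y) ≤ 1 := by
  have h := lamMin_mul_le Y (Pi.single 0 1)
  rw [l2norm_single, mulVec_single_one] at h
  have h1 : l2norm (Y.col 0) = 1 := hY 0
  rw [h1] at h
  linarith

lemma one_le_lamMax [NeZero p] {Y : Matrix (Fin n) (Fin p) ℝ} (hY : ∀ j, colNorm Y j = 1) :
    1 ≤ lamMax (gram Y) := by
  have h := le_lamMax_mul Y (Pi.single 0 1)
  rw [l2norm_single, mulVec_single_one] at h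
  have h1 : l2norm (Y.col 0) = 1 := hY 0
  rw [h1] at h
  linarith

end Rayleigh

/-! ### Normalized designs and the joint Gram matrix of a knockoff copy -/

section Knockoff

variable {n p : ℕ}

lemma colNorm_sq (X : Matrix (Fin n) (Fin p) ℝ) (j : Fin p) :
    colNorm X j ^ 2 = ∑ a, X a j ^ 2 := l2norm_sq _

lemma gram_self (X : Matrix (Fin n) (Fin p) ℝ) (j : Fin p) : gram X j j = colNorm X j ^ 2 := by
  rw [gram_apply, colNorm_sq]
  exact Finset.sum_congr rfl fun a _ => (sq _).symm

lemma normalizeCols_eq_mul_diagonal (X : Matrix (Fin n) (Fin p) ℝ) :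
    normalizeCols X = X * diagonal fun j => (colNorm X j)⁻¹ := by
  ext a j
  rw [mul_diagonal, normalizeCols, of_apply, div_eq_mul_inv]

lemma normalizeCols_mul_diagonal {X : Matrix (Fin n) (Fin p) ℝ} (h : ∀ j, 0 < colNorm X j) :
    normalizeCols X * diagonal (colNorm X) = X := by
  ext a j
  rw [mul_diagonal, normalizeCols, of_apply, div_mul_cancel₀ _ (h j).ne']

lemma colNorm_normalizeCols {X : Matrix (Fin n) (Fin p) ℝ} (h : ∀ j, 0 < colNorm X j)
    (j : Fin p) : colNorm (normalizeCols X) j = 1 := by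
  have h1 : colNorm (normalizeCols X) j ^ 2 = 1 := by
    rw [colNorm_sq]
    simp only [normalizeCols, of_apply, div_pow]
    rw [← Finset.sum_div, ← colNorm_sq, div_self (pow_ne_zero 2 (h j).ne')]
  have h2 : 0 ≤ colNorm (normalizeCols X) j := l2norm_nonneg _
  nlinarith

lemma gram_normalizeCols_apply (X : Matrix (Fin n) (Fin p) ℝ) (i j : Fin p) :
    gram (normalizeCols X) i j = gram X i j / (colNorm X i * colNorm X j) := by
  simp only [gram_apply, normalizeCols, of_apply, Finset.sum_div]
  exact Finset.sum_congr rfl fun a _ => by rw [div_mul_div_comm]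

lemma isUnit_gram_normalizeCols {X : Matrix (Fin n) (Fin p) ℝ} (h : ∀ j, 0 < colNorm X j)
    (hX : IsUnit (gram X)) : IsUnit (gram (normalizeCols X)) := by
  have h1 : gram (normalizeCols X) =
      diagonal (fun j => (colNorm X j)⁻¹) * gram X * diagonal (fun j => (colNorm X j)⁻¹) := by
    rw [gram, normalizeCols_eq_mul_diagonal, transpose_mul, diagonal_transpose, gram]
    simp only [Matrix.mul_assoc]
  have h2 : IsUnit (diagonal fun j => (colNorm X j)⁻¹) := by
    rw [isUnit_diagonal, Pi.isUnit_iff]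
    exact fun j => (inv_pos.2 (h j)).ne'.isUnit
  rw [h1]
  exact (h2.mul hX).mul h2

lemma IsKnockoff.transpose_mul {Y Yt : Matrix (Fin n) (Fin p) ℝ} {s : ℝ}
    (hY : IsUnit (gram Y)) (h : IsKnockoff Y (fun _ => s) Yt) :
    Yᵀ * Yt = gram Y - s • (1 : Matrix (Fin p) (Fin p) ℝ) := by
  obtain ⟨U, C, -, hUY, -, -, -, rfl⟩ := h
  have hYU : Yᵀ * U = 0 := by
    have := congrArg transpose hUY
    rwa [Matrix.transpose_mul, transpose_transpose, transpose_zero] at this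
  have hd : IsUnit (gram Y).det := (isUnit_iff_isUnit_det _).1 hY
  rw [Matrix.mul_add, ← Matrix.mul_assoc, ← Matrix.mul_assoc, hYU, Matrix.zero_mul, add_zero,
    ← gram, Matrix.mul_sub, Matrix.mul_one, ← Matrix.mul_assoc, mul_nonsing_inv _ hd,
    Matrix.one_mul, smul_one_eq_diagonal]

/-- With `Q = 1 - s Σ⁻¹`, orthogonality of `U` to `Y` leaves `Q Σ Q + CᵀC`. Since `Q Σ Q = (Σ - s)
Σ⁻¹ (Σ - s)`, the Schur complement `CᵀC` restores exactly `Σ`. -/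
lemma IsKnockoff.gram_eq {Y Yt : Matrix (Fin n) (Fin p) ℝ} {s : ℝ}
    (hY : IsUnit (gram Y)) (h : IsKnockoff Y (fun _ => s) Yt) : gram Yt = gram Y := by
  obtain ⟨U, C, hUU, hUY, -, -, hC, rfl⟩ := h
  have hYU : Yᵀ * U = 0 := by
    have := congrArg transpose hUY
    rwa [Matrix.transpose_mul, transpose_transpose, transpose_zero] at this
  have hd : IsUnit (gram Y).det := (isUnit_iff_isUnit_det _).1 hY
  set S := gram Y with hS
  have hSS : Yᵀ * Y = S := rfl
  have hST : S * S⁻¹ = 1 := mul_nonsing_inv _ hd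
  have hTS : S⁻¹ * S = 1 := nonsing_inv_mul _ hd
  have hTt : (S⁻¹)ᵀ = S⁻¹ := by rw [transpose_nonsing_inv, hS, gram_transpose]
  set T := S⁻¹ with hT
  rw [← smul_one_eq_diagonal] at hC ⊢
  set Q := (1 : Matrix (Fin p) (Fin p) ℝ) - T * s • (1 : Matrix (Fin p) (Fin p) ℝ) with hQ
  have hQ' : Q = 1 - s • T := by rw [hQ, mul_smul_comm, Matrix.mul_one]
  have hQt : Qᵀ = Q := by rw [hQ', transpose_sub, transpose_one, transpose_smul, hTt]
  have h1 : gram (Y * Q + U * C) = Q * S * Q + Cᵀ * C := by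
    rw [gram, transpose_add, Matrix.transpose_mul, Matrix.transpose_mul, hQt, Matrix.add_mul,
      Matrix.mul_add, Matrix.mul_add]
    have e1 : Q * Yᵀ * (Y * Q) = Q * S * Q := by
      rw [← hSS]; simp only [Matrix.mul_assoc]
    have e2 : Q * Yᵀ * (U * C) = 0 := by
      rw [Matrix.mul_assoc, ← Matrix.mul_assoc Yᵀ, hYU]; simp
    have e3 : Cᵀ * Uᵀ * (Y * Q) = 0 := by
      rw [Matrix.mul_assoc, ← Matrix.mul_assoc Uᵀ, hUY]; simp
    have e4 : Cᵀ * Uᵀ * (U * C) = Cᵀ * C := by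
      rw [Matrix.mul_assoc, ← Matrix.mul_assoc Uᵀ, hUU, Matrix.one_mul]
    rw [e1, e2, e3, e4, add_zero, zero_add]
  rw [h1, hC, hQ']
  simp only [Matrix.sub_mul, Matrix.mul_sub, Matrix.one_mul, Matrix.mul_one, smul_mul_assoc,
    mul_smul_comm, hST, hTS]
  abel

lemma augGram_eq_fromBlocks {X Xt : Matrix (Fin n) (Fin p) ℝ}
    (hX : IsUnit (gram (normalizeCols X))) (h : IsNormalizedKnockoff X Xt) :
    augGram X Xt = fromBlocks (gramN X) (gramN X - lamMin (gramN X) • 1)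
      (gramN X - lamMin (gramN X) • 1) (gramN X) := by
  have h1 := IsKnockoff.transpose_mul hX h
  have h2 := IsKnockoff.gram_eq hX h
  have h3 : Xtᵀ * normalizeCols X = gramN X - lamMin (gramN X) • 1 := by
    have := congrArg transpose h1
    rwa [Matrix.transpose_mul, transpose_transpose, transpose_sub, gram_transpose, transpose_smul,
      transpose_one] at this
  rw [augGram, augmented, transpose_fromCols, fromRows_mul_fromCols, h1, h3]
  congr 1

lemma l2norm_sumElim_sq (u v : Fin p → ℝ) :
    l2norm (Sum.elim u v) ^ 2 = l2norm u ^ 2 + l2norm v ^ 2 := by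
  simp only [l2norm_sq, Fintype.sum_sum_type, Sum.elim_inl, Sum.elim_inr]

/-- The largest eigenvalue of the joint Gram matrix is at most `γ`. -/
lemma l2norm_augmented_mulVec_sq_le {X Xt : Matrix (Fin n) (Fin p) ℝ}
    (hX : IsUnit (gram (normalizeCols X))) (h : IsNormalizedKnockoff X Xt)
    (hle : lamMin (gramN X) ≤ lamMax (gramN X)) (g : Fin p ⊕ Fin p → ℝ) :
    l2norm (augmented X Xt *ᵥ g) ^ 2 ≤ gam X * l2norm g ^ 2 := by
  obtain ⟨u, v, rfl⟩ : ∃ u v : Fin p → ℝ, g = Sum.elim u v :=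
    ⟨g ∘ Sum.inl, g ∘ Sum.inr, (Sum.elim_comp_inl_inr g).symm⟩
  set Y := normalizeCols X with hY
  have h1 : Yᵀ * Xt = gram Y - lamMin (gramN X) • 1 := IsKnockoff.transpose_mul hX h
  have h2 : gram Xt = gram Y := IsKnockoff.gram_eq hX h
  set s := lamMin (gramN X) with hs
  set L := lamMax (gramN X) with hL
  have e1 : augmented X Xt *ᵥ Sum.elim u v = Y *ᵥ u + Xt *ᵥ v := by
    rw [augmented, fromCols_mulVec]; rfl
  have e2 : (Xt *ᵥ v) ⬝ᵥ (Xt *ᵥ v) = (Y *ᵥ v) ⬝ᵥ (Y *ᵥ v) := by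
    rw [← dotProduct_gram_mulVec, h2, dotProduct_gram_mulVec]
  have e3 : (Y *ᵥ u) ⬝ᵥ (Xt *ᵥ v) = (Y *ᵥ u) ⬝ᵥ (Y *ᵥ v) - s * (u ⬝ᵥ v) := by
    have : (Y *ᵥ u) ⬝ᵥ (Xt *ᵥ v) = u ⬝ᵥ ((Yᵀ * Xt) *ᵥ v) := by
      rw [← mulVec_mulVec, dotProduct_mulVec u, vecMul_transpose]
    rw [this, h1, sub_mulVec, dotProduct_sub, dotProduct_gram_mulVec, smul_mulVec, one_mulVec,
      dotProduct_smul, smul_eq_mul]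
  -- Completing `‖Y (u + v)‖²` leaves only `-2 s ⟨u, v⟩`. Bounding the square by `L ‖u + v‖²` and
  -- then `2 ⟨u, v⟩ ≤ ‖u‖² + ‖v‖²`, with nonnegative coefficient `L - s`, gives `2 L - s`.
  have e4 : l2norm (augmented X Xt *ᵥ Sum.elim u v) ^ 2 =
      l2norm (Y *ᵥ (u + v)) ^ 2 - 2 * s * (u ⬝ᵥ v) := by
    rw [← dotProduct_self_eq_l2norm_sq, ← dotProduct_self_eq_l2norm_sq, e1, mulVec_add]
    simp only [add_dotProduct, dotProduct_add, e2, dotProduct_comm (Xt *ᵥ v) (Y *ᵥ u), e3,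
      dotProduct_comm (Y *ᵥ v) (Y *ᵥ u)]
    ring
  have h3 := le_lamMax_mul Y (u + v)
  have h4 : l2norm (u + v) ^ 2 = l2norm u ^ 2 + 2 * (u ⬝ᵥ v) + l2norm v ^ 2 := by
    simp only [← dotProduct_self_eq_l2norm_sq, add_dotProduct, dotProduct_add,
      dotProduct_comm v u]
    ring
  have h5 : 2 * (u ⬝ᵥ v) ≤ l2norm u ^ 2 + l2norm v ^ 2 := by
    have := dotProduct_le_l2norm_mul u v
    nlinarith [sq_nonneg (l2norm u - l2norm v)]
  have h6 : lamMax (gram Y) = L := rfl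
  rw [h4, h6] at h3
  rw [e4, l2norm_sumElim_sq, gam, ← hs, ← hL]
  nlinarith [mul_le_mul_of_nonneg_left h5 (sub_nonneg.2 hle)]

/-- The noiseless feature-response product. -/
lemma featResp_mulVec {X Xt : Matrix (Fin n) (Fin p) ℝ} (hpos : ∀ j, 0 < colNorm X j)
    (hX : IsUnit (gram (normalizeCols X))) (h : IsNormalizedKnockoff X Xt) (β : Fin p → ℝ) :
    featResp X Xt (X *ᵥ β) = Sum.elim (((normalizeCols X)ᵀ * X) *ᵥ β)
      (((normalizeCols X)ᵀ * X) *ᵥ β - fun j => lamMin (gramN X) * colNorm X j * β j) := by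
  have h1 := congrArg transpose (IsKnockoff.transpose_mul hX h)
  rw [Matrix.transpose_mul, transpose_transpose, transpose_sub, gram_transpose, transpose_smul,
    transpose_one] at h1
  rw [featResp, augmented, transpose_fromCols, fromRows_mulVec]
  congr 1
  · rw [mulVec_mulVec]
  · rw [mulVec_mulVec]
    -- Writing `X = X' D` gives `X̃'ᵀ X = (Σ' - s I) D = X'ᵀ X - s D`.
    conv_lhs => rw [← normalizeCols_mul_diagonal hpos]
    rw [← Matrix.mul_assoc, h1, Matrix.sub_mul, sub_mulVec, gram, Matrix.mul_assoc,
      normalizeCols_mul_diagonal hpos, smul_mul_assoc, Matrix.one_mul]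
    congr 1
    ext j
    rw [smul_mulVec, Pi.smul_apply, mulVec_diagonal, smul_eq_mul]
    simp only [gramN, gram]
    ring

end Knockoff

/-! ### Elementary estimates for the change of a column norm

Here `h = √(C² - B²)`, `ℓ` is the norm of a column before and `z` its norm after the change of one
entry of size at most `B`. -/

section Scalar

variable {B C h ℓ z : ℝ}

/-- The relative loss `B² / ℓ²` is largest at `ℓ = C`, where `1 - B² / C² = (h / C)²`. -/
lemma div_mul_le_of_sq_le (hC : 0 < C) (hhC : h ^ 2 = C ^ 2 - B ^ 2)
    (hℓ : C ≤ ℓ) (hz : 0 < z) (hz1 : ℓ ^ 2 - B ^ 2 ≤ z ^ 2) : h / C * ℓ ≤ z := by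
  refine le_of_sq_le_sq ?_ hz.le
  refine le_trans ?_ hz1
  have h1 : B ^ 2 * C ^ 2 ≤ B ^ 2 * ℓ ^ 2 :=
    mul_le_mul_of_nonneg_left (pow_le_pow_left₀ hC.le hℓ 2) (sq_nonneg B)
  have h2 : (h / C * ℓ) ^ 2 = (C ^ 2 - B ^ 2) * ℓ ^ 2 / C ^ 2 := by
    rw [mul_pow, div_pow, hhC]; ring
  rw [h2, div_le_iff₀ (by positivity)]
  nlinarith

/-- The difference is `|ℓ² - z²| / (ℓ z (ℓ + z))`, and `z ≥ (h/C) ℓ` makes the denominator at least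
of order `ℓ³`. The bound is attained in form at `ℓ = C`; its cubic decay for longer columns is the
reserve used later. -/
lemma abs_inv_sub_inv_le (hh : 0 < h) (hC : 0 < C) (hhC : h ^ 2 = C ^ 2 - B ^ 2)
    (hℓ : 0 < ℓ) (hz : h / C * ℓ ≤ z) (hz1 : |ℓ ^ 2 - z ^ 2| ≤ B ^ 2) :
    |1 / ℓ - 1 / z| ≤ (1 / h - 1 / C) * (C / ℓ) ^ 3 := by
  set g := h / C with hg
  have hgpos : 0 < g := by positivity
  have hzpos : 0 < z := lt_of_lt_of_le (by positivity) hz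
  have h1 : (1 / ℓ - 1 / z) = -(ℓ ^ 2 - z ^ 2) / (ℓ * z * (ℓ + z)) := by
    field_simp; ring
  rw [h1, abs_div, abs_neg, abs_of_pos (show 0 < ℓ * z * (ℓ + z) by positivity)]
  have h2 : ℓ * (g * ℓ) * (ℓ + g * ℓ) ≤ ℓ * z * (ℓ + z) := by gcongr
  have hpos2 : 0 < ℓ * (g * ℓ) * (ℓ + g * ℓ) := by positivity
  calc |ℓ ^ 2 - z ^ 2| / (ℓ * z * (ℓ + z)) ≤ B ^ 2 / (ℓ * (g * ℓ) * (ℓ + g * ℓ)) := by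
        gcongr
    _ = _ := by
        have hB2 : B ^ 2 = C ^ 2 - h ^ 2 := by linarith
        rw [hB2, hg]
        field_simp
        ring

lemma abs_sub_le_sub (hh : 0 < h) (hC : 0 < C) (hhC : h ^ 2 = C ^ 2 - B ^ 2)
    (hℓ : C ≤ ℓ) (hz : h / C * ℓ ≤ z) (hz1 : |ℓ ^ 2 - z ^ 2| ≤ B ^ 2) :
    |ℓ - z| ≤ C - h := by
  have hℓpos : 0 < ℓ := hC.trans_le hℓ
  have hzpos : 0 < z := lt_of_lt_of_le (by positivity) hz
  have h1 : h ≤ z := by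
    calc h = h / C * C := by field_simp
      _ ≤ h / C * ℓ := by gcongr
      _ ≤ z := hz
  have h2 : |ℓ - z| * (ℓ + z) ≤ (C - h) * (C + h) := by
    calc |ℓ - z| * (ℓ + z) = |ℓ ^ 2 - z ^ 2| := by
          rw [show ℓ ^ 2 - z ^ 2 = (ℓ - z) * (ℓ + z) by ring, abs_mul,
            abs_of_pos (show 0 < ℓ + z by positivity)]
      _ ≤ _ := by nlinarith
  have h3 : |ℓ - z| * (C + h) ≤ (C - h) * (C + h) :=
    (mul_le_mul_of_nonneg_left (by linarith) (abs_nonneg _)).trans h2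
  exact le_of_mul_le_mul_right h3 (by positivity)

lemma abs_div_sq_sub_one_le (hh : 0 < h) (hC : 0 < C) (hℓ : C ≤ ℓ) (hz : h / C * ℓ ≤ z)
    (hz1 : |ℓ ^ 2 - z ^ 2| ≤ B ^ 2) : |(ℓ / z) ^ 2 - 1| ≤ (B / h) ^ 2 := by
  have h1 : h ≤ z := by
    calc h = h / C * C := by field_simp
      _ ≤ h / C * ℓ := by gcongr
      _ ≤ z := hz
  have hzpos : 0 < z := hh.trans_le h1
  have h2 : (ℓ / z) ^ 2 - 1 = (ℓ ^ 2 - z ^ 2) / z ^ 2 := by field_simp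
  rw [h2, abs_div, abs_of_pos (show 0 < z ^ 2 by positivity), div_pow]
  gcongr

/-- The product `a b` is the geometric mean of `a²` and `b²`. It is the factor by which
renormalization multiplies an entry of `Σ'`. -/
lemma abs_mul_sub_one_le {x a b : ℝ} (ha : 0 < a) (hb : 0 < b)
    (ha' : |a ^ 2 - 1| ≤ x) (hb' : |b ^ 2 - 1| ≤ x) : |a * b - 1| ≤ x := by
  rw [abs_le] at ha' hb' ⊢
  have hab := mul_pos ha hb
  constructor
  · by_contra hlt
    have h1 : a * b < 1 - x := by linarith
    have h2 : (1 - x) * (1 - x) ≤ a ^ 2 * b ^ 2 :=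
      mul_le_mul (by linarith) (by linarith) (by linarith) (sq_nonneg a)
    nlinarith
  · nlinarith [sq_nonneg (a - b)]

/-- The growth of the diagonal part of the sensitivity, beyond its value at the smallest column,
is dominated by the slack left by the other terms. -/
lemma min_mul_sub_le_excess {g ρ : ℝ} (hg : 0 < g) (hg1 : g < 1) (hρ : 0 ≤ ρ) :
    min 1 (2 * ((1 - g ^ 2) / g ^ 2)) * ρ - (2 - Real.sqrt 2) * ((1 - g ^ 2) / g) ≤
      (1 - g) / g * max 0 (4.45 * ρ - 1.06) := by
  have hs : Real.sqrt 2 ≤ 1.4143 := Real.sqrt_le_iff.2 ⟨by norm_num, by norm_num⟩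
  have hk : 0 < (1 - g) / g := div_pos (by linarith) hg
  have hs' : (0.5857:ℝ) * ((1 - g ^ 2) / g) ≤ (2 - Real.sqrt 2) * ((1 - g ^ 2) / g) :=
    mul_le_mul_of_nonneg_right (by linarith) (div_nonneg (by nlinarith) hg.le)
  -- The two arguments of the minimum cross at `g = √(2/3) ≈ 0.8165`. The constants `4.45` and
  -- `1.06` are roundings of `2 (1 + g) / g` and `(2 - √2)(1 + g)` there.
  rcases le_or_gt g 0.8165 with hle | hlt
  · have h1 : min 1 (2 * ((1 - g ^ 2) / g ^ 2)) * ρ ≤ ρ :=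
      mul_le_of_le_one_left hρ (min_le_left _ _)
    -- This `θ` makes the coefficient of `ρ` equal to `1`; `θ ≤ 1` means `g ≤ 4.45 / 5.45`, just
    -- above the cut.
    set θ := g / (4.45 * (1 - g)) with hθ
    have h1g : 0 < 1 - g := by linarith
    have hθ0 : 0 ≤ θ := by positivity
    have hθ1 : θ ≤ 1 := by
      rw [hθ, div_le_one (by positivity)]; linarith
    have h2 : θ * (4.45 * ρ - 1.06) ≤ max 0 (4.45 * ρ - 1.06) := by
      calc θ * (4.45 * ρ - 1.06) ≤ θ * max 0 (4.45 * ρ - 1.06) :=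
            mul_le_mul_of_nonneg_left (le_max_right _ _) hθ0
        _ ≤ _ := mul_le_of_le_one_left (le_max_left _ _) hθ1
    have h3 := mul_le_mul_of_nonneg_left h2 hk.le
    have h4 : (1 - g) / g * (θ * (4.45 * ρ - 1.06)) = ρ - 1.06 / 4.45 := by
      rw [hθ]; field_simp
    have h5 : (1.06:ℝ) / 4.45 ≤ 0.5857 * ((1 - g ^ 2) / g) := by
      rw [← mul_div_assoc, div_le_div_iff₀ (by norm_num) hg]
      nlinarith
    linarith
  · have h1 : min 1 (2 * ((1 - g ^ 2) / g ^ 2)) * ρ ≤ 2 * ((1 - g ^ 2) / g ^ 2) * ρ :=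
      mul_le_mul_of_nonneg_right (min_le_right _ _) hρ
    have h2 : 2 * ((1 - g ^ 2) / g ^ 2) * ρ - 0.5857 * ((1 - g ^ 2) / g) =
        (1 - g) / g * (2 * (1 + g) / g * ρ - 0.5857 * (1 + g)) := by
      field_simp; ring
    have h3 : 2 * (1 + g) / g * ρ - 0.5857 * (1 + g) ≤ 4.45 * ρ - 1.06 := by
      have h4 : 2 * (1 + g) / g ≤ 4.45 := by
        rw [div_le_iff₀ hg]; linarith
      have h5 := mul_le_mul_of_nonneg_right h4 hρ
      linarith
    have h6 := mul_le_mul_of_nonneg_left (h3.trans (le_max_right 0 _)) hk.le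
    linarith

/-- The excess is small compared with the decay of the off-diagonal weights. -/
lemma excess_sq_mul_le {r : ℝ} (hr : 1 ≤ r) (hm : 0 < 4.45 * (r - 1) - 1.06) :
    (4.45 * (r - 1) - 1.06) ^ 2 * (1 + (1 - (1 / r) ^ 6)) ≤
      2 * (1 - (1 / r) ^ 6) ^ 3 * r ^ 4 := by
  have hrpos : 0 < r := by linarith
  set m := 4.45 * (r - 1) - 1.06 with hmdef
  set D := 1 - (1 / r) ^ 6 with hD
  have hD1 : D ≤ 1 := by
    have : 0 ≤ (1 / r) ^ 6 := by positivity
    linarith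
  -- A numerical certificate: `d` bounds `D` below, `k` bounds `m / r²` above, and `k² (1 + d) ≤ 2
  -- d³` carries over from `d` to every larger `D ≤ 1`.
  have key : ∀ d k : ℝ, 0 < d → 0 ≤ k → d ≤ D → k ^ 2 * (1 + d) ≤ 2 * d ^ 3 → m ≤ k * r ^ 2 →
      m ^ 2 * (1 + D) ≤ 2 * D ^ 3 * r ^ 4 := by
    intro d k hd hk hdD hkd hmk
    have h1 : m ^ 2 ≤ k ^ 2 * r ^ 4 := by
      calc m ^ 2 ≤ (k * r ^ 2) ^ 2 := pow_le_pow_left₀ hm.le hmk 2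
        _ = _ := by ring
    have h2 : k ^ 2 * (1 + D) ≤ 2 * D ^ 3 := by
      have h3 : k ^ 2 ≤ 2 * d ^ 2 := by
        have h4 : k ^ 2 * (1 + d) ≤ 2 * d ^ 2 * (1 + d) := by nlinarith [sq_nonneg d]
        exact le_of_mul_le_mul_right h4 (by linarith)
      have h5 : d ^ 2 * (D - d) ≤ D ^ 3 - d ^ 3 := by
        have : D ^ 3 - d ^ 3 - d ^ 2 * (D - d) = (D - d) * (D * (D + d)) := by ring
        have h6 : 0 ≤ (D - d) * (D * (D + d)) :=
          mul_nonneg (by linarith) (mul_nonneg (by linarith) (by linarith))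
        linarith
      nlinarith [mul_le_mul_of_nonneg_right h3 (sub_nonneg.2 hdD)]
    calc m ^ 2 * (1 + D) ≤ k ^ 2 * r ^ 4 * (1 + D) :=
          mul_le_mul_of_nonneg_right h1 (by linarith)
      _ = k ^ 2 * (1 + D) * r ^ 4 := by ring
      _ ≤ _ := mul_le_mul_of_nonneg_right h2 (by positivity)
  have hDge : ∀ a c : ℝ, 0 < a → a ≤ r → (1 / a) ^ 6 ≤ c → 1 - c ≤ D := by
    intro a c ha har hc
    have : (1 / r) ^ 6 ≤ (1 / a) ^ 6 :=
      pow_le_pow_left₀ (by positivity) (one_div_le_one_div_of_le ha har) 6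
    linarith
  -- Positivity of `m` forces `r ≥ 1.238`, so `D ≥ 1 - 0.278` on the first range; on the second `D ≥
  -- 1 - 0.0597`, and `0.9256 r²` dominates `m` for every `r`.
  rcases le_or_gt r 1.6 with h | h
  · refine key (1 - 0.278) 0.661 (by norm_num) (by norm_num)
      (hDge 1.238 _ (by norm_num) (by linarith) (by norm_num)) (by norm_num) ?_
    nlinarith
  · refine key (1 - 0.0597) 0.9256 (by norm_num) (by norm_num)
      (hDge 1.6 _ (by norm_num) h.le (by norm_num)) (by norm_num) ?_
    nlinarith [sq_nonneg (0.9256 * r - 2.225)]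

end Scalar

/-! ### Row-weighted symmetric matrices -/

section Weighted

variable {p : ℕ}

lemma l2norm_sum_le {ι κ : Type*} [Fintype ι] (s : Finset κ) (u : κ → ι → ℝ) :
    l2norm (∑ k ∈ s, u k) ≤ ∑ k ∈ s, l2norm (u k) := by
  simp only [l2norm_eq_norm, WithLp.toLp_sum]
  exact norm_sum_le _ _

lemma l2norm_le_sum_abs {ι : Type*} [Fintype ι] (u : ι → ℝ) : l2norm u ≤ ∑ i, |u i| := by
  rw [l2norm_le_iff_sq_le (Finset.sum_nonneg fun i _ => abs_nonneg _), l2norm_sq]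
  calc ∑ i, u i ^ 2 = ∑ i, |u i| ^ 2 := by simp only [sq_abs]
    _ ≤ _ := Finset.sum_sq_le_sq_sum_of_nonneg fun i _ => abs_nonneg _

lemma l2norm_mul_le_sum {ι : Type*} [Fintype ι] (u β : ι → ℝ) :
    ∑ j, |β j| * u j ≤ l2norm u * l2norm β := by
  have h := dotProduct_le_l2norm_mul u (fun j => |β j|)
  have h1 : l2norm (fun j => |β j|) = l2norm β := by simp [l2norm]
  rw [h1] at h
  refine le_trans (le_of_eq (Finset.sum_congr rfl fun j _ => mul_comm _ _)) h

/-- A symmetric matrix with diagonal `ℓ²` whose rows are damped by factors decaying like `ℓ⁻³`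
leaves room, below its Frobenius norm, for a diagonal perturbation growing linearly in `ℓ`. -/
lemma l2norm_weighted_mulVec_add_le (S : Matrix (Fin p) (Fin p) ℝ) (hS : ∀ i j, S i j = S j i)
    {ℓ κ : Fin p → ℝ} {C K : ℝ} (hdiag : ∀ j, S j j = ℓ j ^ 2) (hC : 0 < C) (hℓ : ∀ j, C ≤ ℓ j)
    (hK : 0 ≤ K) (hκ : ∀ i, |κ i| ≤ K * (C / ℓ i) ^ 3) (β : Fin p → ℝ) :
    Real.sqrt 2 * l2norm (fun i => ∑ j, κ i * S i j * β j) +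
        l2norm (fun j => K * C ^ 2 * max 0 (4.45 * (ℓ j / C - 1) - 1.06) * β j) ≤
      Real.sqrt 2 * K * frobNorm S * l2norm β := by
  have hℓpos : ∀ j, 0 < ℓ j := fun j => hC.trans_le (hℓ j)
  set c : Fin p → ℝ := fun j => l2norm fun i => κ i * S i j with hc
  set e : Fin p → ℝ := fun j => K * C ^ 2 * max 0 (4.45 * (ℓ j / C - 1) - 1.06) with he
  set T : Fin p → ℝ := fun j => (C / ℓ j) ^ 3 with hT
  set H : Fin p → ℝ := fun j => ∑ i, S i j ^ 2 with hH
  have he0 : ∀ j, 0 ≤ e j := fun j => by simp only [he]; positivity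
  have hc0 : ∀ j, 0 ≤ c j := fun j => l2norm_nonneg _
  have hH0 : ∀ j, 0 ≤ H j := fun j => Finset.sum_nonneg fun _ _ => sq_nonneg _
  have hT0 : ∀ j, 0 ≤ T j := fun j => by have := hℓpos j; simp only [hT]; positivity
  have hT1 : ∀ j, T j ≤ 1 := fun j => by
    have := hℓpos j
    exact pow_le_one₀ (by positivity) ((div_le_one this).2 (hℓ j))
  have hT2 : ∀ j, T j ^ 2 ≤ 1 := fun j => pow_le_one₀ (hT0 j) (hT1 j)
  have hκ2 : ∀ i, κ i ^ 2 ≤ K ^ 2 * T i ^ 2 := fun i => by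
    rw [← mul_pow, ← sq_abs]
    exact pow_le_pow_left₀ (abs_nonneg _) (hκ i) 2
  have hsq2 : Real.sqrt 2 ^ 2 = 2 := Real.sq_sqrt (by norm_num)
  have h1 : l2norm (fun i => ∑ j, κ i * S i j * β j) ≤ ∑ j, |β j| * c j := by
    have h2 : (fun i => ∑ j, κ i * S i j * β j) = ∑ j, β j • fun i => κ i * S i j := by
      ext i
      simp only [Finset.sum_apply, Pi.smul_apply, smul_eq_mul]
      exact Finset.sum_congr rfl fun j _ => mul_comm _ _
    rw [h2]
    refine (l2norm_sum_le _ _).trans (le_of_eq (Finset.sum_congr rfl fun j _ => ?_))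
    rw [l2norm_smul]
  have h2 : l2norm (fun j => e j * β j) ≤ ∑ j, |β j| * e j := by
    refine (l2norm_le_sum_abs _).trans (le_of_eq (Finset.sum_congr rfl fun j _ => ?_))
    rw [abs_mul, abs_of_nonneg (he0 j), mul_comm]
  -- Only the damping of the diagonal entry `ℓ j ^ 2` is kept; the other factors are bounded by `K`.
  have hcol : ∀ j, c j ^ 2 ≤ K ^ 2 * (H j - (1 - T j ^ 2) * ℓ j ^ 4) := by
    intro j
    have h3 : ∀ i, (κ i * S i j) ^ 2 ≤
        K ^ 2 * S i j ^ 2 - if i = j then K ^ 2 * (1 - T j ^ 2) * ℓ j ^ 4 else 0 := by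
      intro i
      rw [mul_pow]
      have h4 := mul_le_mul_of_nonneg_right (hκ2 i) (sq_nonneg (S i j))
      split_ifs with hij
      · subst hij
        rw [hdiag] at h4 ⊢
        nlinarith
      · have h5 := mul_le_mul_of_nonneg_right
          (mul_le_mul_of_nonneg_left (hT2 i) (sq_nonneg K)) (sq_nonneg (S i j))
        linarith
    simp only [hc]
    rw [l2norm_sq]
    refine (Finset.sum_le_sum fun i _ => h3 i).trans (le_of_eq ?_)
    rw [Finset.sum_sub_distrib, Finset.sum_ite_eq' Finset.univ j, if_pos (Finset.mem_univ j),
      ← Finset.mul_sum]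
    ring
  -- The excess of column `j` is charged to the damping `1 - T j ^ 2` of row `j`. By symmetry row
  -- and column `j` have the same square sum `H j`, so after summation the charges complete `K² ∑ T
  -- j ^ 2 H j` to `K² ‖S‖_F²`.
  have hper : ∀ j, (Real.sqrt 2 * c j + e j) ^ 2 ≤
      2 * c j ^ 2 + 2 * K ^ 2 * (1 - T j ^ 2) * H j := by
    intro j
    have hDn : 0 ≤ 1 - T j ^ 2 := sub_nonneg.2 (hT2 j)
    have hexp : (Real.sqrt 2 * c j + e j) ^ 2 =
        2 * c j ^ 2 + (2 * (Real.sqrt 2 * c j) * e j + e j ^ 2) := by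
      have : (Real.sqrt 2 * c j) ^ 2 = 2 * c j ^ 2 := by rw [mul_pow, hsq2]
      linear_combination this
    rw [hexp]
    refine add_le_add_right ?_ _
    rcases le_or_gt (4.45 * (ℓ j / C - 1) - 1.06) 0 with hm | hm
    · have : e j = 0 := by simp only [he]; rw [max_eq_left hm, mul_zero]
      rw [this]
      have := hH0 j
      have : 0 ≤ 2 * K ^ 2 * (1 - T j ^ 2) * H j := by positivity
      linarith
    · set r := ℓ j / C with hr
      have hr1 : 1 ≤ r := (one_le_div hC).2 (hℓ j)
      have hej : e j = K * C ^ 2 * (4.45 * (r - 1) - 1.06) := by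
        simp only [he]; rw [max_eq_right hm.le]
      have hTr : T j ^ 2 = (1 / r) ^ 6 := by
        simp only [hT, hr, one_div_div]; ring
      have hex := excess_sq_mul_le hr1 hm
      rw [← hTr] at hex
      set D := 1 - T j ^ 2 with hD
      have hDpos : 0 < D := by
        rw [hD, hTr]
        have hr2 : 1 < r := by linarith
        have : (1 / r) ^ 6 < 1 := pow_lt_one₀ (by positivity)
          ((div_lt_one (by linarith)).2 hr2) (by norm_num)
        linarith
      have hℓr : ℓ j = C * r := by rw [hr]; field_simp
      have h3 : e j ^ 2 * (1 + D) ≤ 2 * K ^ 2 * D ^ 3 * ℓ j ^ 4 := by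
        rw [hej, hℓr]
        have := mul_le_mul_of_nonneg_left hex (show 0 ≤ K ^ 2 * C ^ 4 by positivity)
        nlinarith
      -- Young's inequality with weight `D`. Inserting `hcol` leaves `e j ^ 2 (1 + D)` against `2 K²
      -- D³ ℓ j ^ 4`, which is `excess_sq_mul_le`.
      have h4 : D * (2 * (Real.sqrt 2 * c j) * e j) ≤ 2 * D ^ 2 * c j ^ 2 + e j ^ 2 := by
        have h5 : (Real.sqrt 2 * c j) ^ 2 = 2 * c j ^ 2 := by rw [mul_pow, hsq2]
        have h6 := sq_nonneg (D * (Real.sqrt 2 * c j) - e j)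
        have h7 : (D * (Real.sqrt 2 * c j) - e j) ^ 2 = D ^ 2 * (Real.sqrt 2 * c j) ^ 2 -
          D * (2 * (Real.sqrt 2 * c j) * e j) + e j ^ 2 := by ring
        rw [h7, h5] at h6
        linarith
      have h5 := mul_le_mul_of_nonneg_left (hcol j) (show 0 ≤ 2 * D ^ 2 by positivity)
      have h6 : D * (2 * (Real.sqrt 2 * c j) * e j + e j ^ 2) ≤ D * (2 * K ^ 2 * D * H j) := by
        nlinarith
      exact le_of_mul_le_mul_left h6 hDpos
  have hsum : l2norm (fun j => Real.sqrt 2 * c j + e j) ≤ Real.sqrt 2 * K * frobNorm S := by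
    have hn : 0 ≤ Real.sqrt 2 * K * frobNorm S :=
      mul_nonneg (mul_nonneg (Real.sqrt_nonneg _) hK) (frobNorm_nonneg S)
    rw [l2norm_le_iff_sq_le hn, l2norm_sq]
    have h3 : ∑ j, c j ^ 2 ≤ ∑ i, K ^ 2 * T i ^ 2 * H i := by
      simp only [hc, l2norm_sq]
      rw [Finset.sum_comm]
      refine Finset.sum_le_sum fun i _ => ?_
      simp only [hH]
      rw [Finset.mul_sum]
      refine Finset.sum_le_sum fun j _ => ?_
      rw [mul_pow, hS i j]
      exact mul_le_mul_of_nonneg_right (hκ2 i) (sq_nonneg _)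
    have h4 : frobNorm S ^ 2 = ∑ j, H j := by
      rw [frobNorm_sq, Finset.sum_comm]
    calc ∑ j, (Real.sqrt 2 * c j + e j) ^ 2
        ≤ ∑ j, (2 * c j ^ 2 + 2 * K ^ 2 * (1 - T j ^ 2) * H j) :=
          Finset.sum_le_sum fun j _ => hper j
      _ = 2 * ∑ j, c j ^ 2 + ∑ j, 2 * K ^ 2 * (1 - T j ^ 2) * H j := by
          rw [Finset.sum_add_distrib, Finset.mul_sum]
      _ ≤ 2 * ∑ i, K ^ 2 * T i ^ 2 * H i + ∑ j, 2 * K ^ 2 * (1 - T j ^ 2) * H j := by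
          linarith
      _ = ∑ j, 2 * K ^ 2 * H j := by
          rw [Finset.mul_sum, ← Finset.sum_add_distrib]
          exact Finset.sum_congr rfl fun j _ => by ring
      _ = (Real.sqrt 2 * K * frobNorm S) ^ 2 := by
          rw [mul_pow, mul_pow, hsq2, h4, Finset.mul_sum]
  calc Real.sqrt 2 * l2norm (fun i => ∑ j, κ i * S i j * β j) + l2norm (fun j => e j * β j)
      ≤ Real.sqrt 2 * ∑ j, |β j| * c j + ∑ j, |β j| * e j :=
        add_le_add (mul_le_mul_of_nonneg_left h1 (Real.sqrt_nonneg _)) h2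
    _ = ∑ j, |β j| * (Real.sqrt 2 * c j + e j) := by
        rw [Finset.mul_sum, ← Finset.sum_add_distrib]
        exact Finset.sum_congr rfl fun j _ => by ring
    _ ≤ l2norm (fun j => Real.sqrt 2 * c j + e j) * l2norm β := l2norm_mul_le_sum _ β
    _ ≤ _ := mul_le_mul_of_nonneg_right hsum (l2norm_nonneg β)

/-- A difference of two rank-one projections of norm at most `B²` has operator norm at most
`B²`. -/
lemma l2norm_rankOne_sub_le {ι : Type*} [Fintype ι] {x z : ι → ℝ} {B : ℝ} (hx : l2norm x ≤ B)
    (hz : l2norm z ≤ B) (β : ι → ℝ) :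
    l2norm ((x ⬝ᵥ β) • x - (z ⬝ᵥ β) • z) ≤ B ^ 2 * l2norm β := by
  set u := (x ⬝ᵥ β) • x - (z ⬝ᵥ β) • z with hu
  have hx2 : ∀ v : ι → ℝ, (x ⬝ᵥ v) ^ 2 ≤ B ^ 2 * l2norm v ^ 2 := fun v =>
    (dotProduct_sq_le x v).trans (mul_le_mul_of_nonneg_right
      (pow_le_pow_left₀ (l2norm_nonneg x) hx 2) (sq_nonneg _))
  have hz2 : ∀ v : ι → ℝ, (z ⬝ᵥ v) ^ 2 ≤ B ^ 2 * l2norm v ^ 2 := fun v =>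
    (dotProduct_sq_le z v).trans (mul_le_mul_of_nonneg_right
      (pow_le_pow_left₀ (l2norm_nonneg z) hz 2) (sq_nonneg _))
  -- Polarization: apply Cauchy–Schwarz to `x` with `β + t u` and to `z` with `β - t u`, and add.
  -- The optimal `t = ‖β‖ / ‖u‖` gives `B²`, where the triangle inequality would give `2 B²`.
  have key : ∀ t : ℝ, 2 * t * l2norm u ^ 2 ≤ B ^ 2 * (l2norm β ^ 2 + t ^ 2 * l2norm u ^ 2) := by
    intro t
    have h1 := hx2 (β + t • u)
    have h2 := hz2 (β - t • u)
    have e1 : l2norm u ^ 2 = (x ⬝ᵥ β) * (x ⬝ᵥ u) - (z ⬝ᵥ β) * (z ⬝ᵥ u) := by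
      rw [← dotProduct_self_eq_l2norm_sq]
      conv_lhs => lhs; rw [hu]
      rw [sub_dotProduct, smul_dotProduct, smul_dotProduct, smul_eq_mul, smul_eq_mul]
    have e2 : l2norm (β + t • u) ^ 2 + l2norm (β - t • u) ^ 2 =
        2 * (l2norm β ^ 2 + t ^ 2 * l2norm u ^ 2) := by
      simp only [← dotProduct_self_eq_l2norm_sq, add_dotProduct, dotProduct_add, sub_dotProduct,
        dotProduct_sub, smul_dotProduct, dotProduct_smul, smul_eq_mul]
      ring
    rw [dotProduct_add, dotProduct_smul, smul_eq_mul] at h1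
    rw [dotProduct_sub, dotProduct_smul, smul_eq_mul] at h2
    have e3 := congrArg (fun y => B ^ 2 * y) e2
    have e4 := congrArg (fun y => t * y) e1
    have h3 := sq_nonneg (x ⬝ᵥ β - t * (x ⬝ᵥ u))
    have h4 := sq_nonneg (z ⬝ᵥ β + t * (z ⬝ᵥ u))
    linarith
  have hB : 0 ≤ B := (l2norm_nonneg x).trans hx
  rcases (l2norm_nonneg u).eq_or_lt with h0 | h0
  · rw [← h0]
    exact mul_nonneg (sq_nonneg B) (l2norm_nonneg β)
  · have h1 := key (l2norm β / l2norm u)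
    have h2 : 2 * (l2norm β / l2norm u) * l2norm u ^ 2 = 2 * l2norm β * l2norm u := by
      field_simp
    have h3 : (l2norm β / l2norm u) ^ 2 * l2norm u ^ 2 = l2norm β ^ 2 := by
      field_simp
    rw [h2, h3] at h1
    rcases (l2norm_nonneg β).eq_or_lt with hb | hb
    · have h4 : β = 0 := by
        ext j
        have := abs_le_l2norm β j
        rw [← hb] at this
        exact abs_eq_zero.1 (le_antisymm this (abs_nonneg _))
      have h5 : u = 0 := by rw [hu, h4]; simp
      rw [h5] at h0
      simp [l2norm] at h0
    · have h4 : l2norm β * l2norm u ≤ l2norm β * (B ^ 2 * l2norm β) := by nlinarith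
      exact le_of_mul_le_mul_left h4 hb

end Weighted

/-! ### Sensitivity of the normalized Gram matrix -/

section Neighbours

variable {n p : ℕ}

/-- Two admissible designs that differ in the row `r` only. -/
structure Neighbours (B : ℝ) (X Z : Matrix (Fin n) (Fin p) ℝ) (r : Fin n) : Prop where
  left : Admissible B X
  right : Admissible B Z
  lt_cMin : B < cMin X
  eq_row : ∀ a, a ≠ r → X a = Z a

/-- If `B ≤ 0`, all rows vanish, and a zero Gram matrix of positive size is not invertible. -/
lemma Admissible.pos [NeZero p] {B : ℝ} {X : Matrix (Fin n) (Fin p) ℝ} (hX : Admissible B X) :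
    0 < B := by
  by_contra hB
  have h0 : X = 0 := by
    ext a j
    have h1 : |X a j| ≤ l2norm (X a) := abs_le_l2norm (X a) j
    have h2 := hX.2.1 a
    exact abs_eq_zero.1 (le_antisymm (by linarith) (abs_nonneg _))
  have h1 := hX.1
  rw [h0, gram, Matrix.mul_zero] at h1
  exact not_isUnit_zero h1

lemma cMin_le_colNorm (X : Matrix (Fin n) (Fin p) ℝ) (j : Fin p) : cMin X ≤ colNorm X j :=
  ciInf_le (Set.finite_range _).bddBelow j

/-- The lower bound `√(C² - B²)` for the column norms after a change of one row. -/
def reducedNorm (B : ℝ) (X : Matrix (Fin n) (Fin p) ℝ) : ℝ := Real.sqrt (cMin X ^ 2 - B ^ 2)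

namespace Neighbours

variable {B : ℝ} {X Z : Matrix (Fin n) (Fin p) ℝ} {r : Fin n}

lemma sum_rows (h : Neighbours B X Z r) (F : (Fin p → ℝ) → ℝ) :
    ∑ a, F (Z a) = ∑ a, F (X a) - F (X r) + F (Z r) := by
  rw [← Finset.add_sum_erase _ _ (Finset.mem_univ r),
    ← Finset.add_sum_erase _ (fun a => F (X a)) (Finset.mem_univ r)]
  have : ∑ a ∈ Finset.univ.erase r, F (Z a) = ∑ a ∈ Finset.univ.erase r, F (X a) :=
    Finset.sum_congr rfl fun a ha => by rw [h.eq_row a (Finset.ne_of_mem_erase ha)]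
  rw [this]
  ring

lemma gram_apply_eq (h : Neighbours B X Z r) (i j : Fin p) :
    gram Z i j = gram X i j - X r i * X r j + Z r i * Z r j := by
  rw [gram_apply, gram_apply]
  exact h.sum_rows fun v => v i * v j

lemma abs_sq_sub_sq_le (h : Neighbours B X Z r) (j : Fin p) :
    |colNorm X j ^ 2 - colNorm Z j ^ 2| ≤ B ^ 2 := by
  have h1 := h.gram_apply_eq j j
  rw [gram_self, gram_self] at h1
  have hx : X r j ^ 2 ≤ B ^ 2 := by
    rw [← sq_abs]
    exact pow_le_pow_left₀ (abs_nonneg _) ((abs_le_l2norm (X r) j).trans (h.left.2.1 r)) 2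
  have hz : Z r j ^ 2 ≤ B ^ 2 := by
    rw [← sq_abs]
    exact pow_le_pow_left₀ (abs_nonneg _) ((abs_le_l2norm (Z r) j).trans (h.right.2.1 r)) 2
  rw [abs_le]
  constructor <;> nlinarith [sq_nonneg (X r j), sq_nonneg (Z r j)]

variable [NeZero p]

lemma B_pos (h : Neighbours B X Z r) : 0 < B := h.left.pos

lemma cMin_pos (h : Neighbours B X Z r) : 0 < cMin X := h.B_pos.trans h.lt_cMin

lemma colNorm_pos (h : Neighbours B X Z r) (j : Fin p) : 0 < colNorm X j :=
  h.B_pos.trans_le (h.left.2.2 j)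

lemma colNorm_pos' (h : Neighbours B X Z r) (j : Fin p) : 0 < colNorm Z j :=
  h.B_pos.trans_le (h.right.2.2 j)

lemma sq_sub_sq_pos (h : Neighbours B X Z r) : 0 < cMin X ^ 2 - B ^ 2 := by
  have := h.B_pos
  have := h.lt_cMin
  nlinarith

lemma reducedNorm_pos (h : Neighbours B X Z r) : 0 < reducedNorm B X :=
  Real.sqrt_pos.2 h.sq_sub_sq_pos

lemma reducedNorm_sq (h : Neighbours B X Z r) : reducedNorm B X ^ 2 = cMin X ^ 2 - B ^ 2 :=
  Real.sq_sqrt h.sq_sub_sq_pos.le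

lemma eta_eq (h : Neighbours B X Z r) : eta B X = B / reducedNorm B X := by
  rw [eta, Real.sqrt_div (sq_nonneg B), Real.sqrt_sq h.B_pos.le, reducedNorm]

lemma eta_pos (h : Neighbours B X Z r) : 0 < eta B X := by
  rw [h.eta_eq]; exact div_pos h.B_pos h.reducedNorm_pos

lemma ratio_mul_le (h : Neighbours B X Z r) (j : Fin p) :
    reducedNorm B X / cMin X * colNorm X j ≤ colNorm Z j :=
  div_mul_le_of_sq_le h.cMin_pos h.reducedNorm_sq (cMin_le_colNorm X j) (h.colNorm_pos' j)
    (by have := (abs_le.1 (h.abs_sq_sub_sq_le j)).2; linarith)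

lemma reducedNorm_le (h : Neighbours B X Z r) (j : Fin p) : reducedNorm B X ≤ colNorm Z j := by
  refine le_trans ?_ (h.ratio_mul_le j)
  have h1 := h.cMin_pos
  have h2 := h.reducedNorm_pos
  calc reducedNorm B X = reducedNorm B X / cMin X * cMin X := by field_simp
    _ ≤ _ := mul_le_mul_of_nonneg_left (cMin_le_colNorm X j) (by positivity)

lemma abs_ratio_sq_sub_one_le (h : Neighbours B X Z r) (j : Fin p) :
    |(colNorm X j / colNorm Z j) ^ 2 - 1| ≤ eta B X ^ 2 := by
  rw [h.eta_eq]
  exact abs_div_sq_sub_one_le h.reducedNorm_pos h.cMin_pos (cMin_le_colNorm X j)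
    (h.ratio_mul_le j) (h.abs_sq_sub_sq_le j)

/-- Dividing a vector by the changed column norms. -/
lemma l2norm_div_le (h : Neighbours B X Z r) (v : Fin p → ℝ) :
    l2norm (fun j => v j / colNorm Z j) ≤ l2norm v / reducedNorm B X := by
  have h1 : l2norm v / reducedNorm B X = l2norm ((reducedNorm B X)⁻¹ • v) := by
    rw [l2norm_smul, abs_of_pos (inv_pos.2 h.reducedNorm_pos), div_eq_inv_mul]
  rw [h1]
  refine l2norm_mono fun j => ?_
  rw [Pi.smul_apply, smul_eq_mul, abs_mul, abs_of_pos (inv_pos.2 h.reducedNorm_pos), abs_div,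
    abs_of_pos (h.colNorm_pos' j), div_eq_inv_mul]
  exact mul_le_mul_of_nonneg_right (inv_anti₀ h.reducedNorm_pos (h.reducedNorm_le j))
    (abs_nonneg _)

lemma dotProduct_div_sq_le (h : Neighbours B X Z r) {x : Fin p → ℝ} (hx : l2norm x ≤ B)
    (v : Fin p → ℝ) :
    (x ⬝ᵥ fun j => v j / colNorm Z j) ^ 2 ≤ eta B X ^ 2 * l2norm v ^ 2 := by
  have h1 := pow_le_pow_left₀ (l2norm_nonneg x) hx 2
  have h2 := pow_le_pow_left₀ (l2norm_nonneg _) (h.l2norm_div_le v) 2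
  calc (x ⬝ᵥ fun j => v j / colNorm Z j) ^ 2
      ≤ l2norm x ^ 2 * l2norm (fun j => v j / colNorm Z j) ^ 2 := dotProduct_sq_le _ _
    _ ≤ B ^ 2 * (l2norm v / reducedNorm B X) ^ 2 := by gcongr
    _ = _ := by rw [h.eta_eq]; ring

/-- All rows but `r` agree, so `Z' v` is `X'` applied to the rescaled vector except in that row. The
eigenvalue perturbation bounds all come from this identity. -/
lemma l2norm_normalizeCols_mulVec_sq (h : Neighbours B X Z r) (v : Fin p → ℝ) :
    l2norm (normalizeCols Z *ᵥ v) ^ 2 =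
      l2norm (normalizeCols X *ᵥ fun j => colNorm X j / colNorm Z j * v j) ^ 2 -
        (X r ⬝ᵥ fun j => v j / colNorm Z j) ^ 2 + (Z r ⬝ᵥ fun j => v j / colNorm Z j) ^ 2 := by
  have e1 : ∀ a, (normalizeCols Z *ᵥ v) a = Z a ⬝ᵥ fun j => v j / colNorm Z j := fun a => by
    simp only [mulVec, dotProduct, normalizeCols, of_apply]
    exact Finset.sum_congr rfl fun j _ => by ring
  have e2 : ∀ a, (normalizeCols X *ᵥ fun j => colNorm X j / colNorm Z j * v j) a =
      X a ⬝ᵥ fun j => v j / colNorm Z j := fun a => by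
    simp only [mulVec, dotProduct, normalizeCols, of_apply]
    refine Finset.sum_congr rfl fun j _ => ?_
    have := (h.colNorm_pos j).ne'
    field_simp
  rw [l2norm_sq, l2norm_sq]
  simp only [e1, e2]
  exact h.sum_rows fun u => (u ⬝ᵥ fun j => v j / colNorm Z j) ^ 2

lemma l2norm_ratio_mul_sq_le (h : Neighbours B X Z r) (v : Fin p → ℝ) :
    l2norm (fun j => colNorm X j / colNorm Z j * v j) ^ 2 ≤ (1 + eta B X ^ 2) * l2norm v ^ 2 := by
  rw [l2norm_sq, l2norm_sq, Finset.mul_sum]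
  refine Finset.sum_le_sum fun j _ => ?_
  rw [mul_pow]
  have := (abs_le.1 (h.abs_ratio_sq_sub_one_le j)).2
  exact mul_le_mul_of_nonneg_right (by linarith) (sq_nonneg _)

lemma le_l2norm_ratio_mul_sq (h : Neighbours B X Z r) (v : Fin p → ℝ) :
    (1 - eta B X ^ 2) * l2norm v ^ 2 ≤ l2norm (fun j => colNorm X j / colNorm Z j * v j) ^ 2 := by
  rw [l2norm_sq, l2norm_sq, Finset.mul_sum]
  refine Finset.sum_le_sum fun j _ => ?_
  rw [mul_pow]
  have := (abs_le.1 (h.abs_ratio_sq_sub_one_le j)).1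
  exact mul_le_mul_of_nonneg_right (by linarith) (sq_nonneg _)

/-- Test with a minimal eigenvector of the new matrix and drop the square that was added. -/
lemma le_lamMin (h : Neighbours B X Z r) :
    lamMin (gramN X) - eta B X ^ 2 * (1 + lamMin (gramN X)) ≤ lamMin (gramN Z) := by
  obtain ⟨v, hv1, hv⟩ := exists_l2norm_mulVec_eq_lamMin (normalizeCols Z)
  rw [gramN, gramN, ← hv, h.l2norm_normalizeCols_mulVec_sq]
  have h1 := lamMin_mul_le (normalizeCols X) fun j => colNorm X j / colNorm Z j * v j
  have h2 := mul_le_mul_of_nonneg_left (h.le_l2norm_ratio_mul_sq v)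
    (lamMin_nonneg (normalizeCols X))
  have h3 := h.dotProduct_div_sq_le (h.left.2.1 r) v
  have h4 := sq_nonneg (Z r ⬝ᵥ fun j => v j / colNorm Z j)
  rw [hv1] at h2 h3
  linarith

/-- Test with the vector whose rescaling is a minimal eigenvector `e` of the old matrix, and drop
the square that was removed. The bound `1 = ‖e‖² ≤ (1 + η²) ‖v‖²` keeps the estimate linear in `η²`.
-/
lemma lamMin_le (h : Neighbours B X Z r) :
    lamMin (gramN Z) ≤ lamMin (gramN X) + eta B X ^ 2 * (1 + lamMin (gramN X)) := by
  obtain ⟨e, he1, he⟩ := exists_l2norm_mulVec_eq_lamMin (normalizeCols X)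
  set v : Fin p → ℝ := fun j => colNorm Z j / colNorm X j * e j with hv
  have hve : (fun j => colNorm X j / colNorm Z j * v j) = e := by
    ext j
    have h1 := (h.colNorm_pos j).ne'
    have h2 := (h.colNorm_pos' j).ne'
    simp only [hv]
    field_simp
  have h1 := lamMin_mul_le (normalizeCols Z) v
  rw [h.l2norm_normalizeCols_mulVec_sq, hve, he] at h1
  have h2 := h.l2norm_ratio_mul_sq_le v
  rw [hve, he1] at h2
  have h3 := h.dotProduct_div_sq_le (h.right.2.1 r) v
  have h4 := sq_nonneg (X r ⬝ᵥ fun j => v j / colNorm Z j)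
  have h5 := mul_le_mul_of_nonneg_left h2 (lamMin_nonneg (normalizeCols X))
  have hvpos : 0 < l2norm v ^ 2 := by
    by_contra hn
    have : l2norm v ^ 2 = 0 := le_antisymm (not_lt.1 hn) (sq_nonneg _)
    rw [this] at h2
    linarith
  have h6 : lamMin (gramN Z) * l2norm v ^ 2 ≤
      (lamMin (gramN X) + eta B X ^ 2 * (1 + lamMin (gramN X))) * l2norm v ^ 2 := by
    simp only [gramN]
    linarith
  exact le_of_mul_le_mul_right h6 hvpos

lemma abs_lamMin_sub_le (h : Neighbours B X Z r) :
    |lamMin (gramN X) - lamMin (gramN Z)| ≤ eta B X ^ 2 * (1 + lamMin (gramN X)) := by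
  rw [abs_le]
  constructor <;> linarith [h.le_lamMin, h.lamMin_le]

lemma lamMax_le (h : Neighbours B X Z r) :
    lamMax (gramN Z) ≤ lamMax (gramN X) + eta B X ^ 2 * (1 + lamMax (gramN X)) := by
  obtain ⟨v, hv1, hv⟩ := exists_l2norm_mulVec_eq_lamMax (normalizeCols Z)
  rw [gramN, gramN, ← hv, h.l2norm_normalizeCols_mulVec_sq]
  have h1 := le_lamMax_mul (normalizeCols X) fun j => colNorm X j / colNorm Z j * v j
  have h0 : 0 ≤ lamMax (gram (normalizeCols X)) :=
    zero_le_one.trans (one_le_lamMax (colNorm_normalizeCols h.colNorm_pos))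
  have h2 := mul_le_mul_of_nonneg_left (h.l2norm_ratio_mul_sq_le v) h0
  have h3 := h.dotProduct_div_sq_le (h.right.2.1 r) v
  have h4 := sq_nonneg (X r ⬝ᵥ fun j => v j / colNorm Z j)
  rw [hv1] at h2 h3
  linarith

lemma gam_le (h : Neighbours B X Z r) :
    gam Z ≤ gam X + eta B X ^ 2 * (3 + 2 * lamMax (gramN X) + lamMin (gramN X)) := by
  rw [gam, gam]
  linarith [h.lamMax_le, h.le_lamMin]

/-- The change splits into an entrywise rescaling of `Σ'` by factors within `η²` of `1`, and `w wᵀ -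
u uᵀ` with `‖u‖, ‖w‖ ≤ η`. The latter has squared norm `‖w‖⁴ + ‖u‖⁴ - 2 ⟨w, u⟩² ≤ 2 η⁴`. -/
lemma frobNorm_gramN_sub_le (h : Neighbours B X Z r) :
    frobNorm (gramN Z - gramN X) ≤ eta B X ^ 2 * (Real.sqrt 2 + frobNorm (gramN X)) := by
  set u : Fin p → ℝ := fun j => X r j / colNorm Z j with hu
  set w : Fin p → ℝ := fun j => Z r j / colNorm Z j with hw
  have hη := h.eta_pos
  have bound : ∀ x : Fin p → ℝ, l2norm x ≤ B →
      l2norm (fun j => x j / colNorm Z j) ^ 2 ≤ eta B X ^ 2 := by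
    intro x hx
    refine pow_le_pow_left₀ (l2norm_nonneg _) ((h.l2norm_div_le x).trans ?_) 2
    rw [h.eta_eq]
    exact div_le_div_of_nonneg_right hx h.reducedNorm_pos.le
  have hu2 : l2norm u ^ 2 ≤ eta B X ^ 2 := bound _ (h.left.2.1 r)
  have hw2 : l2norm w ^ 2 ≤ eta B X ^ 2 := bound _ (h.right.2.1 r)
  have hsplit : (fun q : Fin p × Fin p => (gramN Z - gramN X) q.1 q.2) =
      (fun q : Fin p × Fin p => (colNorm X q.1 / colNorm Z q.1 * (colNorm X q.2 / colNorm Z q.2)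
        - 1) * gramN X q.1 q.2) + fun q : Fin p × Fin p => w q.1 * w q.2 - u q.1 * u q.2 := by
    ext ⟨i, j⟩
    have h1 := (h.colNorm_pos i).ne'
    have h2 := (h.colNorm_pos' i).ne'
    have h3 := (h.colNorm_pos j).ne'
    have h4 := (h.colNorm_pos' j).ne'
    simp only [Matrix.sub_apply, Pi.add_apply, gramN, gram_normalizeCols_apply, h.gram_apply_eq,
      hu, hw]
    field_simp
    ring
  have h1 : l2norm (fun q : Fin p × Fin p => (colNorm X q.1 / colNorm Z q.1 *
      (colNorm X q.2 / colNorm Z q.2) - 1) * gramN X q.1 q.2) ≤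
      eta B X ^ 2 * frobNorm (gramN X) := by
    have e : eta B X ^ 2 * frobNorm (gramN X) =
        l2norm ((eta B X ^ 2) • fun q : Fin p × Fin p => gramN X q.1 q.2) := by
      rw [l2norm_smul, abs_of_nonneg (sq_nonneg _), frobNorm_eq_l2norm]
    rw [e]
    refine l2norm_mono fun q => ?_
    rw [Pi.smul_apply, smul_eq_mul, abs_mul, abs_mul, abs_of_nonneg (sq_nonneg (eta B X))]
    refine mul_le_mul_of_nonneg_right ?_ (abs_nonneg _)
    exact abs_mul_sub_one_le (div_pos (h.colNorm_pos _) (h.colNorm_pos' _))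
      (div_pos (h.colNorm_pos _) (h.colNorm_pos' _)) (h.abs_ratio_sq_sub_one_le _)
      (h.abs_ratio_sq_sub_one_le _)
  have h2 : l2norm (fun q : Fin p × Fin p => w q.1 * w q.2 - u q.1 * u q.2) ≤
      eta B X ^ 2 * Real.sqrt 2 := by
    rw [l2norm_le_iff_sq_le (by positivity), l2norm_sq, Fintype.sum_prod_type]
    have e : ∑ i, ∑ j, (w i * w j - u i * u j) ^ 2 =
        l2norm w ^ 2 * l2norm w ^ 2 + l2norm u ^ 2 * l2norm u ^ 2 - 2 * (w ⬝ᵥ u) ^ 2 := by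
      rw [sq (w ⬝ᵥ u), l2norm_sq, l2norm_sq, dotProduct, Finset.sum_mul_sum, Finset.sum_mul_sum,
        Finset.sum_mul_sum, Finset.mul_sum, ← Finset.sum_add_distrib, ← Finset.sum_sub_distrib]
      refine Finset.sum_congr rfl fun i _ => ?_
      rw [Finset.mul_sum, ← Finset.sum_add_distrib, ← Finset.sum_sub_distrib]
      exact Finset.sum_congr rfl fun j _ => by ring
    rw [e, mul_pow, Real.sq_sqrt (by norm_num)]
    nlinarith [mul_le_mul hu2 hu2 (sq_nonneg _) (sq_nonneg _),
      mul_le_mul hw2 hw2 (sq_nonneg _) (sq_nonneg _), sq_nonneg (w ⬝ᵥ u)]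
  rw [frobNorm_eq_l2norm, hsplit]
  refine (l2norm_add_le _ _).trans ?_
  linarith

end Neighbours

/-! ### The shift of the Gram matrix in terms of the noise variables -/

/-- The strict upper triangle of a matrix. -/
def upperPart (A : Matrix (Fin p) (Fin p) ℝ) : UpperPairs p → ℝ := fun q => A q.1.1 q.1.2

lemma l2norm_upperPart_le (A : Matrix (Fin p) (Fin p) ℝ) : l2norm (upperPart A) ≤ frobNorm A := by
  rw [frobNorm_eq_l2norm]
  refine Real.sqrt_le_sqrt ?_
  calc ∑ q : UpperPairs p, A q.1.1 q.1.2 ^ 2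
      = ∑ q ∈ Finset.univ.map (Function.Embedding.subtype fun q : Fin p × Fin p => q.1 < q.2),
          A q.1 q.2 ^ 2 := by rw [Finset.sum_map]; rfl
    _ ≤ _ := Finset.sum_le_sum_of_subset_of_nonneg (Finset.subset_univ _)
        fun _ _ _ => sq_nonneg _

lemma symmOfUpper_upperPart {A : Matrix (Fin p) (Fin p) ℝ} (hs : ∀ i j, A i j = A j i)
    (hd : ∀ i, A i i = 0) : symmOfUpper (upperPart A) = A := by
  ext i j
  simp only [symmOfUpper, upperPart, of_apply]
  split_ifs with h1 h2
  · rfl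
  · exact hs j i
  · rw [le_antisymm (not_lt.1 h2) (not_lt.1 h1), hd]

/-- Both normalized Gram matrices have unit diagonal, so their difference is recovered from its
strict upper triangle; the off-diagonal blocks differ in addition by the change of `λ_min`. -/
lemma augGram_eq_add_gramNoise {X Z Xt Zt : Matrix (Fin n) (Fin p) ℝ}
    (hX : IsUnit (gram X)) (hZ : IsUnit (gram Z)) (hXc : ∀ j, 0 < colNorm X j)
    (hZc : ∀ j, 0 < colNorm Z j) (hXt : IsNormalizedKnockoff X Xt)
    (hZt : IsNormalizedKnockoff Z Zt) :
    augGram Z Zt = augGram X Xt + gramNoise (lamMin (gramN X) - lamMin (gramN Z))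
      (symmOfUpper (upperPart (gramN Z - gramN X))) := by
  have hsymm : ∀ (Y : Matrix (Fin n) (Fin p) ℝ) (i j : Fin p), gramN Y i j = gramN Y j i :=
    fun Y i j => by
      conv_lhs => rw [gramN, ← gram_transpose]
      rfl
  have hdiag : ∀ {Y : Matrix (Fin n) (Fin p) ℝ}, (∀ j, 0 < colNorm Y j) → ∀ i, gramN Y i i = 1 :=
    fun hY i => by rw [gramN, gram_self, colNorm_normalizeCols hY, one_pow]
  rw [symmOfUpper_upperPart
    (fun i j => by rw [Matrix.sub_apply, Matrix.sub_apply, hsymm, hsymm X])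
    (fun i => by rw [Matrix.sub_apply, hdiag hZc, hdiag hXc, sub_self]),
    augGram_eq_fromBlocks (isUnit_gram_normalizeCols hXc hX) hXt,
    augGram_eq_fromBlocks (isUnit_gram_normalizeCols hZc hZ) hZt, gramNoise, fromBlocks_smul,
    fromBlocks_add, fromBlocks_add]
  congr 1
  · simp
  · rw [sub_smul]; abel
  · rw [sub_smul]; abel
  · simp

end Neighbours

/-! ### Sensitivity of the feature-response product -/

section FeatResp

variable {n p : ℕ}

lemma l2norm_sumElim_sub_le (a b : Fin p → ℝ) :
    l2norm (Sum.elim a (a - b)) ≤ Real.sqrt 2 * l2norm a + l2norm b := by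
  have h1 : Sum.elim a (a - b) = Sum.elim a a - Sum.elim (0 : Fin p → ℝ) b := by
    ext (i | i) <;> simp
  have h2 : l2norm (Sum.elim a a) = Real.sqrt 2 * l2norm a := by
    have h3 : l2norm (Sum.elim a a) ^ 2 = (Real.sqrt 2 * l2norm a) ^ 2 := by
      rw [l2norm_sumElim_sq, mul_pow, Real.sq_sqrt (by norm_num)]
      ring
    exact (pow_left_inj₀ (l2norm_nonneg _)
      (mul_nonneg (Real.sqrt_nonneg _) (l2norm_nonneg _)) two_ne_zero).1 h3
  have h3 : l2norm (Sum.elim (0 : Fin p → ℝ) b) = l2norm b := by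
    have h4 : l2norm (Sum.elim (0 : Fin p → ℝ) b) ^ 2 = l2norm b ^ 2 := by
      rw [l2norm_sumElim_sq]
      simp [l2norm_sq (0 : Fin p → ℝ)]
    exact (pow_left_inj₀ (l2norm_nonneg _) (l2norm_nonneg _) two_ne_zero).1 h4
  rw [h1, ← h2, ← h3]
  exact l2norm_sub_le _ _

namespace Neighbours

variable [NeZero p] {B : ℝ} {X Z : Matrix (Fin n) (Fin p) ℝ} {r : Fin n}

lemma eta_div_eq (h : Neighbours B X Z r) : eta B X / B = 1 / reducedNorm B X := by
  have h1 := h.B_pos.ne'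
  have h2 := h.reducedNorm_pos.ne'
  rw [h.eta_eq]; field_simp

lemma div_eta_eq (h : Neighbours B X Z r) : B / eta B X = reducedNorm B X := by
  have h1 := h.B_pos.ne'
  have h2 := h.reducedNorm_pos.ne'
  rw [h.eta_eq]; field_simp

lemma reducedNorm_lt (h : Neighbours B X Z r) : reducedNorm B X < cMin X := by
  have h1 := h.reducedNorm_sq
  have h2 := h.B_pos
  have h3 := h.cMin_pos
  by_contra hn
  have h4 : cMin X ^ 2 ≤ reducedNorm B X ^ 2 := pow_le_pow_left₀ h3.le (not_lt.1 hn) 2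
  nlinarith

/-- The change of the coefficient of `β j` in the knockoff block. -/
lemma abs_lamMin_mul_colNorm_sub_le (h : Neighbours B X Z r) (j : Fin p) :
    |lamMin (gramN X) * colNorm X j - lamMin (gramN Z) * colNorm Z j| ≤
      (cMin X - reducedNorm B X) * lamMin (gramN X) +
        eta B X ^ 2 * (lamMin (gramN X) + 1) * Real.sqrt (cMin X ^ 2 + B ^ 2) +
        (2 - Real.sqrt 2) * (eta B X * B) +
        (1 / reducedNorm B X - 1 / cMin X) * cMin X ^ 2 *
          max 0 (4.45 * (colNorm X j / cMin X - 1) - 1.06) := by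
  set s := lamMin (gramN X) with hs
  set s' := lamMin (gramN Z) with hs'
  set C := cMin X with hC
  set k := reducedNorm B X with hk
  set l := colNorm X j with hl
  set z := colNorm Z j with hz
  have hCpos : 0 < C := h.cMin_pos
  have hkpos : 0 < k := h.reducedNorm_pos
  have hkC : k < C := h.reducedNorm_lt
  have hk2 : k ^ 2 = C ^ 2 - B ^ 2 := h.reducedNorm_sq
  have hlC : C ≤ l := cMin_le_colNorm X j
  have hzpos : 0 < z := h.colNorm_pos' j
  have hs0 : 0 ≤ s := lamMin_nonneg _
  have hs1 : s ≤ 1 := lamMin_le_one (colNorm_normalizeCols h.colNorm_pos)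
  have hs0' : 0 ≤ s' := lamMin_nonneg _
  have hs1' : s' ≤ 1 := lamMin_le_one (colNorm_normalizeCols h.colNorm_pos')
  have hlz : |l - z| ≤ C - k := abs_sub_le_sub hkpos hCpos hk2 hlC (h.ratio_mul_le j)
    (h.abs_sq_sub_sq_le j)
  set q := |s - s'| with hq
  have hq1 : q ≤ 1 := by rw [hq, abs_le]; constructor <;> linarith
  have hqη : q ≤ eta B X ^ 2 * (1 + s) := h.abs_lamMin_sub_le
  have hq0 : 0 ≤ q := abs_nonneg _
  set A := Real.sqrt (C ^ 2 + B ^ 2) with hA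
  have hA0 : 0 ≤ A := Real.sqrt_nonneg _
  -- The function `l ↦ √(l² + B²)` grows at rate at most `1` from its value `A` at `C`.
  have hzA : z ≤ A + (l - C) := by
    have h1 : z ≤ Real.sqrt (l ^ 2 + B ^ 2) := by
      refine Real.le_sqrt_of_sq_le ?_
      have := (abs_le.1 (h.abs_sq_sub_sq_le j)).1
      linarith
    refine h1.trans (Real.sqrt_le_iff.2 ⟨by linarith, ?_⟩)
    have hCA : C ≤ A := Real.le_sqrt_of_sq_le (by nlinarith [sq_nonneg B])
    have hA2 : A ^ 2 = C ^ 2 + B ^ 2 := Real.sq_sqrt (by positivity)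
    nlinarith
  have htri : |s * l - s' * z| ≤ s * (C - k) + q * z := by
    have e : s * l - s' * z = s * (l - z) + (s - s') * z := by ring
    rw [e]
    refine (abs_add_le _ _).trans ?_
    rw [abs_mul, abs_mul, abs_of_nonneg hs0, abs_of_pos hzpos]
    have := mul_le_mul_of_nonneg_left hlz hs0
    linarith
  set g := k / C with hg
  have hgpos : 0 < g := by positivity
  have hg1 : g < 1 := (div_lt_one hCpos).2 hkC
  have hη : eta B X ^ 2 = (1 - g ^ 2) / g ^ 2 := by
    rw [h.eta_eq, hg, div_pow, div_pow]
    have hB2 : B ^ 2 = C ^ 2 - k ^ 2 := by linarith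
    rw [← hk, hB2]
    field_simp
  have hηB : eta B X * B = C * ((1 - g ^ 2) / g) := by
    rw [h.eta_eq, ← hk, hg]
    have hB2 : B * B = C ^ 2 - k ^ 2 := by linarith
    rw [div_mul_eq_mul_div, hB2]
    field_simp
  -- The term `q (l - C)` is the growth absent from the nominal bound. Here `q ≤ 1` because both
  -- eigenvalues lie in `[0, 1]`, and `q ≤ 2 η²` because `s ≤ 1`.
  have hmin : q ≤ min 1 (2 * ((1 - g ^ 2) / g ^ 2)) := by
    refine le_min hq1 (hqη.trans ?_)
    rw [← hη]
    nlinarith [sq_nonneg (eta B X)]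
  have hex := min_mul_sub_le_excess hgpos hg1 (sub_nonneg.2 ((one_le_div hCpos).2 hlC))
  have h1 : q * z ≤ eta B X ^ 2 * (s + 1) * A + q * (l - C) := by
    have h2 := mul_le_mul_of_nonneg_left hzA hq0
    have h3 := mul_le_mul_of_nonneg_right hqη hA0
    linarith
  have hlc : l - C = C * (l / C - 1) := by field_simp
  have h2 : q * (l - C) ≤ C * (min 1 (2 * ((1 - g ^ 2) / g ^ 2)) * (l / C - 1)) := by
    rw [hlc]
    have h3 : 0 ≤ l / C - 1 := sub_nonneg.2 ((one_le_div hCpos).2 hlC)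
    have h4 := mul_le_mul_of_nonneg_left (mul_le_mul_of_nonneg_right hmin h3) hCpos.le
    linarith
  have h3 : (1 / k - 1 / C) * C ^ 2 = C * ((1 - g) / g) := by
    rw [hg]; field_simp
  have h4 := mul_le_mul_of_nonneg_left hex hCpos.le
  rw [hηB, h3]
  linarith

/-- The sensitivity of the noiseless feature-response product. -/
lemma l2norm_featResp_mulVec_sub_le (h : Neighbours B X Z r) {Xt Zt : Matrix (Fin n) (Fin p) ℝ}
    (hXt : IsNormalizedKnockoff X Xt) (hZt : IsNormalizedKnockoff Z Zt) (β : Fin p → ℝ) :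
    l2norm (featResp X Xt (X *ᵥ β) - featResp Z Zt (Z *ᵥ β)) ≤
      l2norm β * (Real.sqrt 2 * (eta B X / B - 1 / cMin X) * frobNorm (gram X) +
        2 * eta B X * B + (cMin X - B / eta B X) * lamMin (gramN X) +
        eta B X ^ 2 * (lamMin (gramN X) + 1) * Real.sqrt (cMin X ^ 2 + B ^ 2)) := by
  set C := cMin X with hC
  set k := reducedNorm B X with hk
  have hCpos : 0 < C := h.cMin_pos
  have hkpos : 0 < k := h.reducedNorm_pos
  have hkC : k < C := h.reducedNorm_lt
  set K := 1 / k - 1 / C with hK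
  have hK0 : 0 ≤ K := sub_nonneg.2 (one_div_le_one_div_of_le hkpos hkC.le)
  set κ : Fin p → ℝ := fun i => 1 / colNorm X i - 1 / colNorm Z i with hκ
  set W : Fin p → ℝ := fun i => ∑ j, κ i * gram X i j * β j with hW
  set ρ : Fin p → ℝ := fun i =>
    ((X r ⬝ᵥ β) • X r - (Z r ⬝ᵥ β) • Z r) i / colNorm Z i with hρ
  set b : Fin p → ℝ := fun j =>
    (lamMin (gramN X) * colNorm X j - lamMin (gramN Z) * colNorm Z j) * β j with hb
  -- `W` is the effect of renormalizing the old Gram matrix, `ρ` that of its rank-one change under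
  -- the new norms, and `b` that of the term `λ_min` times the column norm, present only in the
  -- knockoff block.
  have hdiff : featResp X Xt (X *ᵥ β) - featResp Z Zt (Z *ᵥ β) =
      Sum.elim (W + ρ) ((W + ρ) - b) := by
    have hM : ((normalizeCols X)ᵀ * X) *ᵥ β - ((normalizeCols Z)ᵀ * Z) *ᵥ β = W + ρ := by
      have hMi : ∀ (Y : Matrix (Fin n) (Fin p) ℝ) (i : Fin p),
          (((normalizeCols Y)ᵀ * Y) *ᵥ β) i = ∑ j, gram Y i j / colNorm Y i * β j := by
        intro Y i
        rw [mulVec, dotProduct]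
        refine Finset.sum_congr rfl fun j _ => ?_
        rw [mul_apply, gram_apply, Finset.sum_div]
        congr 1
        refine Finset.sum_congr rfl fun a _ => ?_
        rw [transpose_apply, normalizeCols, of_apply]
        ring
      ext i
      rw [Pi.sub_apply, hMi, hMi, Pi.add_apply]
      simp only [hW, hρ, hκ, Pi.sub_apply, Pi.smul_apply, smul_eq_mul, dotProduct]
      rw [Finset.sum_mul, Finset.sum_mul, ← Finset.sum_sub_distrib, ← Finset.sum_sub_distrib,
        Finset.sum_div, ← Finset.sum_add_distrib]
      refine Finset.sum_congr rfl fun j _ => ?_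
      rw [h.gram_apply_eq]
      ring
    rw [featResp_mulVec h.colNorm_pos (isUnit_gram_normalizeCols h.colNorm_pos h.left.1) hXt,
      featResp_mulVec h.colNorm_pos' (isUnit_gram_normalizeCols h.colNorm_pos' h.right.1) hZt,
      ← hM]
    ext (i | i)
    · simp
    · simp only [Pi.sub_apply, Sum.elim_inr, hb]
      ring
  have hρle : l2norm ρ ≤ eta B X * B * l2norm β := by
    refine (h.l2norm_div_le _).trans ?_
    have h1 := l2norm_rankOne_sub_le (h.left.2.1 r) (h.right.2.1 r) β
    calc l2norm ((X r ⬝ᵥ β) • X r - (Z r ⬝ᵥ β) • Z r) / reducedNorm B X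
        ≤ B ^ 2 * l2norm β / reducedNorm B X := div_le_div_of_nonneg_right h1 hkpos.le
      _ = _ := by rw [h.eta_eq]; ring
  -- The share `(2 - √2) η B` is what remains of `2 η B` after `ρ`, occurring in both blocks, has
  -- used `√2 η B`.
  set n₀ := (C - k) * lamMin (gramN X) +
    eta B X ^ 2 * (lamMin (gramN X) + 1) * Real.sqrt (C ^ 2 + B ^ 2) +
    (2 - Real.sqrt 2) * (eta B X * B) with hn₀
  have hs2 : Real.sqrt 2 ≤ 2 := Real.sqrt_le_iff.2 ⟨by norm_num, by norm_num⟩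
  have hs0 : 0 ≤ lamMin (gramN X) := lamMin_nonneg _
  have hn₀0 : 0 ≤ n₀ := by
    have h1 := h.eta_pos
    have h2 := h.B_pos
    have h3 : 0 ≤ C - k := by linarith
    have h4 : 0 ≤ 2 - Real.sqrt 2 := by linarith
    positivity
  have hble : l2norm b ≤ n₀ * l2norm β +
      l2norm (fun j => K * C ^ 2 * max 0 (4.45 * (colNorm X j / C - 1) - 1.06) * β j) := by
    have h1 : n₀ * l2norm β = l2norm (n₀ • fun j => |β j|) := by
      rw [l2norm_smul, abs_of_nonneg hn₀0]
      congr 1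
      simp [l2norm]
    have h2 : l2norm (fun j => K * C ^ 2 * max 0 (4.45 * (colNorm X j / C - 1) - 1.06) * β j) =
        l2norm fun j => K * C ^ 2 * max 0 (4.45 * (colNorm X j / C - 1) - 1.06) * |β j| := by
      simp [l2norm, mul_pow]
    rw [h1, h2]
    refine le_trans (l2norm_mono fun j => ?_) (l2norm_add_le _ _)
    refine le_trans ?_ (le_abs_self _)
    simp only [hb, abs_mul, Pi.add_apply, Pi.smul_apply, smul_eq_mul]
    rw [← add_mul]
    exact mul_le_mul_of_nonneg_right (h.abs_lamMin_mul_colNorm_sub_le j) (abs_nonneg _)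
  have hcore := l2norm_weighted_mulVec_add_le (gram X)
    (fun i j => by conv_lhs => rw [← gram_transpose]
                   rfl)
    (fun j => gram_self X j) hCpos (cMin_le_colNorm X) hK0
    (κ := κ) (fun i => abs_inv_sub_inv_le hkpos hCpos h.reducedNorm_sq (h.colNorm_pos i)
      (h.ratio_mul_le i) (h.abs_sq_sub_sq_le i)) β
  rw [hdiff]
  refine (l2norm_sumElim_sub_le _ _).trans ?_
  have h1 := mul_le_mul_of_nonneg_left (l2norm_add_le W ρ) (Real.sqrt_nonneg 2)
  have h2 := mul_le_mul_of_nonneg_left hρle (Real.sqrt_nonneg 2)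
  rw [h.eta_div_eq, h.div_eta_eq]
  have h3 : l2norm β * (Real.sqrt 2 * K * frobNorm (gram X) + 2 * eta B X * B +
      (C - k) * lamMin (gramN X) +
      eta B X ^ 2 * (lamMin (gramN X) + 1) * Real.sqrt (C ^ 2 + B ^ 2)) =
      Real.sqrt 2 * K * frobNorm (gram X) * l2norm β +
        Real.sqrt 2 * (eta B X * B * l2norm β) + n₀ * l2norm β := by
    rw [hn₀]; ring
  rw [h3]
  linarith

lemma gam_pos (h : Neighbours B X Z r) : 0 < gam X := by
  have h1 := lamMin_le_one (colNorm_normalizeCols h.colNorm_pos)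
  have h2 := one_le_lamMax (colNorm_normalizeCols h.colNorm_pos)
  simp only [gam, gramN]
  linarith

lemma gam_pos' (h : Neighbours B X Z r) : 0 < gam Z := by
  have h1 := lamMin_le_one (colNorm_normalizeCols h.colNorm_pos')
  have h2 := one_le_lamMax (colNorm_normalizeCols h.colNorm_pos')
  simp only [gam, gramN]
  linarith

lemma sqrt_gam_le (h : Neighbours B X Z r) :
    Real.sqrt (gam Z) ≤ Real.sqrt (gam X) +
      eta B X * Real.sqrt (3 + 2 * lamMax (gramN X) + lamMin (gramN X)) := by
  have h1 := lamMin_nonneg (normalizeCols X)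
  have h2 := one_le_lamMax (colNorm_normalizeCols h.colNorm_pos)
  have h3 : 0 ≤ 3 + 2 * lamMax (gramN X) + lamMin (gramN X) := by
    simp only [gramN]
    positivity
  have h4 := h.eta_pos.le
  refine Real.sqrt_le_iff.2 ⟨by positivity, h.gam_le.trans ?_⟩
  rw [add_sq, mul_pow, Real.sq_sqrt h.gam_pos.le, Real.sq_sqrt h3]
  have : 0 ≤ 2 * Real.sqrt (gam X) *
      (eta B X * Real.sqrt (3 + 2 * lamMax (gramN X) + lamMin (gramN X))) := by positivity
  linarith

/-- Off the two exceptional events of the model errors, the feature-response products differ by at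
most the sensitivity bound. -/
lemma l2norm_featResp_sub_le (h : Neighbours B X Z r) {Xt Zt : Matrix (Fin n) (Fin p) ℝ}
    (hXt : IsNormalizedKnockoff X Xt) (hZt : IsNormalizedKnockoff Z Zt) (β : Fin p → ℝ)
    {σ δ₂ : ℝ} {w v : Fin n → ℝ}
    (hw : l2norm ((augmented X Xt)ᵀ *ᵥ w) ^ 2 ≤ gam X * zeta p σ δ₂)
    (hv : l2norm ((augmented Z Zt)ᵀ *ᵥ v) ^ 2 ≤ gam Z * zeta p σ δ₂) :
    l2norm (featResp X Xt (X *ᵥ β + w) - featResp Z Zt (Z *ᵥ β + v)) ≤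
      sensFeatResp B σ δ₂ β X := by
  have e : featResp X Xt (X *ᵥ β + w) - featResp Z Zt (Z *ᵥ β + v) =
      ((augmented X Xt)ᵀ *ᵥ w - (augmented Z Zt)ᵀ *ᵥ v) +
        (featResp X Xt (X *ᵥ β) - featResp Z Zt (Z *ᵥ β)) := by
    simp only [featResp, mulVec_add]
    abel
  rw [e, sensFeatResp]
  refine (l2norm_add_le _ _).trans
    (add_le_add ((l2norm_sub_le _ _).trans ?_) (h.l2norm_featResp_mulVec_sub_le hXt hZt β))
  have h1 : l2norm ((augmented X Xt)ᵀ *ᵥ w) ≤ Real.sqrt (gam X) * Real.sqrt (zeta p σ δ₂) := by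
    rw [← Real.sqrt_mul h.gam_pos.le]
    exact Real.le_sqrt_of_sq_le hw
  have h2 : l2norm ((augmented Z Zt)ᵀ *ᵥ v) ≤ Real.sqrt (gam Z) * Real.sqrt (zeta p σ δ₂) := by
    rw [← Real.sqrt_mul h.gam_pos'.le]
    exact Real.le_sqrt_of_sq_le hv
  have h3 := mul_le_mul_of_nonneg_right h.sqrt_gam_le (Real.sqrt_nonneg (zeta p σ δ₂))
  linarith

end Neighbours

/-- The quadratic form of the model errors exceeds its bound with probability at most `δ₂ / 2`. -/
lemma measure_featResp_noise_gt_le [NeZero p] {Ω : Type*} [MeasurableSpace Ω] {P : Measure Ω}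
    {X Xt : Matrix (Fin n) (Fin p) ℝ} (hpos : ∀ j, 0 < colNorm X j) (hX : IsUnit (gram X))
    (hXt : IsNormalizedKnockoff X Xt) {δ₂ : ℝ} (hδ₂ : 2 * Real.exp (-(p : ℝ) / 2) < δ₂)
    (σ : ℝ≥0) {w : Ω → Fin n → ℝ} (hw : HasLaw w (iidGaussian (Fin n) σ) P) :
    P {ω | gam X * zeta p σ δ₂ < l2norm ((augmented X Xt)ᵀ *ᵥ w ω) ^ 2} ≤
      ENNReal.ofReal (δ₂ / 2) := by
  have h1 := lamMin_le_one (colNorm_normalizeCols hpos)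
  have h2 := one_le_lamMax (colNorm_normalizeCols hpos)
  have hg : 0 < gam X := by simp only [gam, gramN]; linarith
  have h3 := measure_l2norm_transpose_mulVec_gt_le (NeZero.pos p) (augmented X Xt)
    (by simp [two_mul]) σ hg
    (l2norm_augmented_mulVec_sq_le (isUnit_gram_normalizeCols hpos hX) hXt (h1.trans h2)) hδ₂
  have hS : MeasurableSet
      {u : Fin n → ℝ | gam X * zeta p σ δ₂ < l2norm ((augmented X Xt)ᵀ *ᵥ u) ^ 2} :=
    measurableSet_lt measurable_const ((measurable_l2norm.comp (measurable_mulVec _)).pow_const 2)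
  rw [← hw.map_eq, Measure.map_apply_of_aemeasurable hw.aemeasurable hS] at h3
  exact h3

end FeatResp

end PrivateKnockoff

end

/-! ### Assembly of the privacy guarantee -/

theorem theorem3 {n p : ℕ} (hnp : 2 * p ≤ n)
    {R : Type*} [MeasurableSpace R]
    (f : Matrix (Fin p ⊕ Fin p) (Fin p ⊕ Fin p) ℝ → (Fin p ⊕ Fin p → ℝ) → R)
    (hf : Measurable (Function.uncurry f))
    -- privacy parameters
    (ε ε₁ ε₂ δ δ₁ δ₂ : ℝ)
    (hε : 0 < ε) (hε' : ε < 1) (hε₁ : 0 < ε₁) (hε₂ : 0 < ε₂) (hε₂' : ε₂ < 1)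
    (hδ : 0 < δ) (hδ' : δ < 1) (hδ₁ : 0 < δ₁) (hδ₁' : δ₁ < 1)
    (hδ₂ : 2 * Real.exp (-(p : ℝ) / 2) < δ₂)
    -- the linear model and the bound on rows and columns
    (β : Fin p → ℝ) (σ : ℝ≥0) (B : ℝ)
    -- the observed design `X`, a neighbouring one `Z`, and knockoffs of their normalizations
    (X Z Xt Zt : Matrix (Fin n) (Fin p) ℝ)
    (hX : PrivateKnockoff.Admissible B X) (hZ : PrivateKnockoff.Admissible B Z)
    (hB : B < PrivateKnockoff.cMin X)
    (hXt : PrivateKnockoff.IsNormalizedKnockoff X Xt)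
    (hZt : PrivateKnockoff.IsNormalizedKnockoff Z Zt)
    -- the noise variances, calibrated to the observed data
    (κ₁ κ₂ : ℝ≥0)
    (hκ₁ : PrivateKnockoff.kappaOneSqBound B ε₂ δ X ≤ (κ₁ : ℝ) ^ 2)
    (hκ₂ : PrivateKnockoff.kappaTwoSqBound B σ ε δ₁ δ₂ β X < (κ₂ : ℝ) ^ 2)
    -- the responses follow the linear model, and the two data sets are adjacent
    {Ω : Type*} [MeasurableSpace Ω] (P : Measure Ω) [IsProbabilityMeasure P]
    (w v : Ω → Fin n → ℝ)
    (hw : HasLaw w (PrivateKnockoff.iidGaussian (Fin n) σ) P)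
    (hv : HasLaw v (PrivateKnockoff.iidGaussian (Fin n) σ) P)
    (hadj : ∀ᵐ ω ∂P, PrivateKnockoff.Adjacent (X, X *ᵥ β + w ω) (Z, Z *ᵥ β + v ω)) :
    -- the sensitivity bound holds with probability at least `1 - δ₂`
    P {ω | PrivateKnockoff.sensFeatResp B σ δ₂ β X <
        PrivateKnockoff.l2norm
          (PrivateKnockoff.featResp X Xt (X *ᵥ β + w ω) -
            PrivateKnockoff.featResp Z Zt (Z *ᵥ β + v ω))} ≤ ENNReal.ofReal δ₂ ∧
    -- given the data, privacy holds with probability at least `1 - δ₂` over the model errors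
    P {ω | ¬ PrivateKnockoff.DPClose (ε + (ε₁ + ε₂)) (δ + δ₁)
        (PrivateKnockoff.release f
          (PrivateKnockoff.noiseLaw p (PrivateKnockoff.laplaceScale B ε₁ X) κ₁ κ₂)
          X Xt (X *ᵥ β + w ω))
        (PrivateKnockoff.release f
          (PrivateKnockoff.noiseLaw p (PrivateKnockoff.laplaceScale B ε₁ X) κ₁ κ₂)
          Z Zt (Z *ᵥ β + v ω))} ≤ ENNReal.ofReal δ₂ ∧
    -- privacy with respect to all the randomness
    PrivateKnockoff.DPClose (ε + (ε₁ + ε₂)) (δ + (δ₁ + δ₂))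
      (PrivateKnockoff.releaseRandom P f
        (PrivateKnockoff.noiseLaw p (PrivateKnockoff.laplaceScale B ε₁ X) κ₁ κ₂)
        X Xt (fun ω => X *ᵥ β + w ω))
      (PrivateKnockoff.releaseRandom P f
        (PrivateKnockoff.noiseLaw p (PrivateKnockoff.laplaceScale B ε₁ X) κ₁ κ₂)
        Z Zt (fun ω => Z *ᵥ β + v ω)) := by
  -- Without columns the released statistic is the same for both data sets, and `δ₂ > 2` makes the
  -- probability bounds trivial. Otherwise the spectra are nonempty, so `λ_min` and `λ_max` are
  -- attained.
  rcases Nat.eq_zero_or_pos p with rfl | hp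
  · have hG : PrivateKnockoff.augGram Z Zt = PrivateKnockoff.augGram X Xt := Subsingleton.elim _ _
    have hstat : ∀ (y yz : Fin n → ℝ), PrivateKnockoff.statistic f Z Zt yz =
        PrivateKnockoff.statistic f X Xt y := by
      intro y yz
      ext z
      rw [PrivateKnockoff.statistic, PrivateKnockoff.statistic, hG,
        Subsingleton.elim (PrivateKnockoff.featResp Z Zt yz) (PrivateKnockoff.featResp X Xt y)]
    have hδ₂' : (1:ℝ) ≤ δ₂ := by
      norm_num at hδ₂
      linarith
    have h1 : ∀ S : Set Ω, P S ≤ ENNReal.ofReal δ₂ := fun S =>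
      prob_le_one.trans (ENNReal.one_le_ofReal.2 hδ₂')
    refine ⟨h1 _, h1 _, ?_⟩
    have h2 : ∀ (N : Measure _), PrivateKnockoff.releaseRandom P f N Z Zt
        (fun ω => Z *ᵥ β + v ω) =
        PrivateKnockoff.releaseRandom P f N X Xt (fun ω => X *ᵥ β + w ω) := by
      intro N
      rw [PrivateKnockoff.releaseRandom, PrivateKnockoff.releaseRandom]
      congr 1
      ext t
      rw [hstat (X *ᵥ β + w t.1)]
    rw [h2]
    exact PrivateKnockoff.dpClose_refl (by linarith) _
  have : NeZero p := ⟨hp.ne'⟩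
  -- The designs are deterministic, so a single outcome where adjacency holds identifies the row in
  -- which they differ.
  obtain ⟨ω₀, r, hr⟩ := hadj.exists
  have hN : PrivateKnockoff.Neighbours B X Z r := ⟨hX, hZ, hB, fun a ha => (hr a ha).1⟩
  have hδ₂0 : 0 < δ₂ := lt_trans (by positivity) hδ₂
  have hb : 0 < PrivateKnockoff.laplaceScale B ε₁ X := by
    have h1 := hN.eta_pos
    have h2 : 0 ≤ PrivateKnockoff.lamMin (PrivateKnockoff.gramN X) :=
      PrivateKnockoff.lamMin_nonneg _
    unfold PrivateKnockoff.laplaceScale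
    positivity
  have := PrivateKnockoff.isProbabilityMeasure_noiseLaw p hb κ₁ κ₂
  set bad : Set Ω :=
    {ω | PrivateKnockoff.gam X * PrivateKnockoff.zeta p σ δ₂ <
      PrivateKnockoff.l2norm ((PrivateKnockoff.augmented X Xt)ᵀ *ᵥ w ω) ^ 2} ∪
    {ω | PrivateKnockoff.gam Z * PrivateKnockoff.zeta p σ δ₂ <
      PrivateKnockoff.l2norm ((PrivateKnockoff.augmented Z Zt)ᵀ *ᵥ v ω) ^ 2} with hbad
  have hbadP : P bad ≤ ENNReal.ofReal δ₂ := by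
    refine (measure_union_le _ _).trans ((add_le_add
      (PrivateKnockoff.measure_featResp_noise_gt_le hN.colNorm_pos hX.1 hXt hδ₂ σ hw)
      (PrivateKnockoff.measure_featResp_noise_gt_le hN.colNorm_pos' hZ.1 hZt hδ₂ σ hv)).trans ?_)
    rw [← ENNReal.ofReal_add (by positivity) (by positivity), add_halves]
  have hsens : ∀ ω, ω ∉ bad → PrivateKnockoff.l2norm
      (PrivateKnockoff.featResp X Xt (X *ᵥ β + w ω) -
        PrivateKnockoff.featResp Z Zt (Z *ᵥ β + v ω)) ≤
      PrivateKnockoff.sensFeatResp B σ δ₂ β X := by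
    intro ω hω
    rw [hbad, Set.mem_union, not_or] at hω
    exact hN.l2norm_featResp_sub_le hXt hZt β (not_lt.1 hω.1) (not_lt.1 hω.2)
  have hdp : P {ω | ¬ PrivateKnockoff.DPClose (ε + (ε₁ + ε₂)) (δ + δ₁)
        (PrivateKnockoff.release f
          (PrivateKnockoff.noiseLaw p (PrivateKnockoff.laplaceScale B ε₁ X) κ₁ κ₂)
          X Xt (X *ᵥ β + w ω))
        (PrivateKnockoff.release f
          (PrivateKnockoff.noiseLaw p (PrivateKnockoff.laplaceScale B ε₁ X) κ₁ κ₂)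
          Z Zt (Z *ᵥ β + v ω))} ≤ ENNReal.ofReal δ₂ := by
    refine (measure_mono fun ω hω => ?_).trans hbadP
    by_contra hn
    refine hω (PrivateKnockoff.dpClose_release hf hε hε' hε₂ hε₂' hδ hδ' hδ₁ hδ₁' hb
      (PrivateKnockoff.lamMin (PrivateKnockoff.gramN X) -
        PrivateKnockoff.lamMin (PrivateKnockoff.gramN Z))
      (PrivateKnockoff.upperPart (PrivateKnockoff.gramN Z - PrivateKnockoff.gramN X))
      (PrivateKnockoff.augGram_eq_add_gramNoise hX.1 hZ.1 hN.colNorm_pos hN.colNorm_pos' hXt hZt)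
      ?_ ((PrivateKnockoff.l2norm_upperPart_le _).trans hN.frobNorm_gramN_sub_le)
      (hsens ω hn) ?_ hκ₂.le)
    · rw [PrivateKnockoff.laplaceScale, div_mul_cancel₀ _ hε₁.ne']
      exact hN.abs_lamMin_sub_le
    · refine le_trans (le_of_eq ?_) hκ₁
      rw [PrivateKnockoff.kappaOneSqBound]
      ring
  refine ⟨(measure_mono fun ω hω => ?_).trans hbadP, hdp, ?_⟩
  · by_contra hn
    exact absurd hω (not_lt.2 (hsens ω hn))
  · rw [← add_assoc δ]
    exact PrivateKnockoff.dpClose_releaseRandom hf (hw.aemeasurable.const_add _)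
      (hv.aemeasurable.const_add _) (add_pos hδ hδ₁).le hδ₂0.le hdp
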